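/- Let $d\ge 3$, let $n$ be a number of particles with masses $m_1,\dots,m_n>0$, let $V:\mathbb R^{dn}\to\mathbb R$ and $\chi_1,\dots,\chi_n:\mathbb R^d\to\mathbb C$, and let $\epsilon_1,\dots,\epsilon_{d-1}:\mathbb R^d\to\mathbb R^d$ be measurable and such that for almost every $k$ the vectors $\epsilon_1(k),\dots,\epsilon_{d-1}(k)$ are orthonormal and orthogonal to $k$. For $\hbar\in(0,1)$ consider, on the Hilbert space $$\mathscr H=L^2(\mathbb R^{dn},\mathbb C)\otimes\Gamma_{\mathrm s}\bigl(L^2(\mathbb R^d,\mathbb C^{d-1})\bigr)$$ (where $\Gamma_{\mathrm s}$ denotes the symmetric Fock space), the momenta $\hat p_i=-i\hbar\nabla_{x_i}$, the annihilation and creation operators $\hat a(f)=\sum_\lambda\int\overline{f_\lambda(k)}\,\hat a_\lambda(k)\,dk$ and $\hat a^*(f)=\sum_\lambda\int f_\lambda(k)\,\hat a^*_\lambda(k)\,dk$ normalized by $[\hat a_\lambda(k),\hat a^*_{\lambda'}(k')]=\hbar\,\delta(k-k')\,\delta_{\lambda\lambda'}$, the field energy $\hat H_{\mathrm f}=\sum_{\lambda=1}^{d-1}\int|k|\,\hat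 a_\lambda^*(k)\hat a_\lambda(k)\,dk$, and the vector potentials $$\hat A_i=\sum_{\lambda=1}^{d-1}\int_{\mathbb R^d}\frac{\epsilon_\lambda(k)}{\sqrt{2|k|}}\Bigl(\overline{\chi_i(k)}\,\hat a_\lambda(k)\,e^{2\pi i k\cdot x_i}+\chi_i(k)\,\hat a_\lambda^*(k)\,e^{-2\pi i k\cdot x_i}\Bigr)dk .$$ The free Hamiltonian and the Pauli–Fierz Hamiltonian are $$\hat H^0_\hbar=\sum_{i=1}^n\frac1{2m_i}\hat p_i^2+\hat H_{\mathrm f},\qquad \hat H_\hbar=\sum_{i=1}^n\frac1{2m_i}\bigl(\hat p_i-\hat A_i\bigr)^2+V(x)+\hat H_{\mathrm f},$$ with $D(\hat H^0_\hbar)=D(\hat p^2)\cap D(\hat H_{\mathrm f})$ and with $\hat H_\hbar$ on the natural domain of the expression defining it. Assume - $(A_0)$: $V$ is of class $C^2$, and $V$ and its first and second derivatives are bounded; - $(A_1)$: $|\cdot|^{-1}\chi_i\in L^2(\mathbb R^d,\mathbb C)$ for every $i$; - $(A_2^{(1)})$: $|\cdot|^{1/2}\chi_i\in L^2(\mathbb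 R^d,\mathbb C)$ for every $i$. Then there are constants $c,C,\gamma>0$, independent of $\hbar$, such that for all $\hbar\in(0,1)$ and all $\psi\in D(\hat H^0_\hbar)$ one has $\psi\in D(\hat H_\hbar)$ and $$c\,\|(\hat H_\hbar+\gamma)\psi\|\le\|(\hat H^0_\hbar+1)\psi\|\le C\,\|(\hat H_\hbar+\gamma)\psi\| .$$ -/

import Mathlib

open MeasureTheory
open scoped ENNReal LineDeriv SchwartzMap

noncomputable section

namespace PauliFierz

/-! ### Unbounded operators -/

section Operators

variable {E : Type*} [AddCommGroup E] [Module ℂ E]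

/-- The composition `T S` of two unbounded operators on its natural domain
`{ψ ∈ D(S) : S ψ ∈ D(T)}`. -/
def opComp (T S : E →ₗ.[ℂ] E) : E →ₗ.[ℂ] E :=
  T.comp (S.domRestrict ((T.domain.comap S.toFun).map S.domain.subtype)) (by
    rintro ⟨x, hx⟩
    obtain ⟨⟨y, hy, hyx⟩, hxS⟩ := hx
    have hy' : S y ∈ T.domain := hy
    have : S.domRestrict ((T.domain.comap S.toFun).map S.domain.subtype)
        ⟨x, ⟨⟨y, hy, hyx⟩, hxS⟩⟩ = S y := LinearPMap.domRestrict_apply hyx.symm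
    rw [this]
    exact hy')

theorem mem_opComp_domain (T S : E →ₗ.[ℂ] E) (x : E) :
    x ∈ (opComp T S).domain ↔ ∃ hx : x ∈ S.domain, S ⟨x, hx⟩ ∈ T.domain := by
  constructor
  · rintro ⟨⟨y, hy, hyx⟩, hxS⟩
    subst hyx
    exact ⟨hxS, hy⟩
  · rintro ⟨hx, h⟩
    exact ⟨⟨⟨x, hx⟩, h, rfl⟩, hx⟩

theorem opComp_apply (T S : E →ₗ.[ℂ] E) (x : E) (h : x ∈ (opComp T S).domain)
    (hx : x ∈ S.domain) (hT : S ⟨x, hx⟩ ∈ T.domain) :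
    opComp T S ⟨x, h⟩ = T ⟨S ⟨x, hx⟩, hT⟩ := rfl

/-- A linear subspace of `E × E` is the graph of an operator. -/
def IsFunctional (g : Submodule ℂ (E × E)) : Prop :=
  ∀ x ∈ g, x.1 = 0 → x.2 = 0

end Operators

/-! ### Weak derivatives of vector valued `L²` functions -/

section WeakDerivative

variable {X F : Type*} [NormedAddCommGroup X] [InnerProductSpace ℝ X] [FiniteDimensional ℝ X]
  [MeasurableSpace X] [BorelSpace X]
  [NormedAddCommGroup F] [NormedSpace ℂ F] [CompleteSpace F]

/-- The vector valued tempered distribution given by an `L²` function. -/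
def toDist : Lp F 2 (volume : Measure X) →ₗ[ℂ] 𝓢'(X, F) :=
  (Lp.toTemperedDistributionCLM F (volume : Measure X) 2).toLinearMap

theorem toDist_injective : Function.Injective (toDist (X := X) (F := F)) :=
  LinearMap.ker_eq_bot.1 (Lp.ker_toTemperedDistributionCLM_eq_bot (E := X) (F := F)
    (μ := volume) (p := 2))

/-- Graph of the operator `-iħ ∂_v` in `L²(X; F)`: the pairs `(Ψ, Φ)` of `L²` functions with
`Φ = -iħ ∂_v Ψ` in the sense of distributions. -/
def weakDerivGraph (F : Type*) [NormedAddCommGroup F] [NormedSpace ℂ F] [CompleteSpace F]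
    (ħ : ℝ) (v : X) :
    Submodule ℂ (Lp F 2 (volume : Measure X) × Lp F 2 (volume : Measure X)) where
  carrier := {Ψ | toDist Ψ.2 = (-Complex.I * (ħ : ℂ)) • ∂_{v} (toDist Ψ.1)}
  zero_mem' := by
    change toDist (0 : Lp F 2 (volume : Measure X)) =
      (-Complex.I * (ħ : ℂ)) • ∂_{v} (toDist (0 : Lp F 2 (volume : Measure X)))
    rw [map_zero, LineDeriv.lineDerivOp_zero, smul_zero]
  add_mem' := by
    intro Ψ Φ hΨ hΦ
    change toDist (Ψ.2 + Φ.2) = (-Complex.I * (ħ : ℂ)) • ∂_{v} (toDist (Ψ.1 + Φ.1))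
    rw [map_add, map_add, LineDeriv.lineDerivOp_add, smul_add]
    exact congrArg₂ _ hΨ hΦ
  smul_mem' := by
    intro c Ψ hΨ
    change toDist (c • Ψ.2) = (-Complex.I * (ħ : ℂ)) • ∂_{v} (toDist (c • Ψ.1))
    rw [map_smul, map_smul, LineDeriv.lineDerivOp_smul, smul_comm]
    exact congrArg _ hΨ

theorem weakDerivGraph_functional (ħ : ℝ) (v : X) : IsFunctional (weakDerivGraph F ħ v) := by
  rintro ⟨Ψ, Φ⟩ h hΨ
  obtain rfl : Ψ = 0 := hΨ
  apply toDist_injective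
  refine (show _ = _ from h).trans ?_
  change (-Complex.I * (ħ : ℂ)) • ∂_{v} (toDist (0 : Lp F 2 (volume : Measure X))) = toDist 0
  rw [map_zero, LineDeriv.lineDerivOp_zero, smul_zero]

end WeakDerivative

/-! ### The one-photon space and the symmetric Fock space -/

/-- Photon modes: pairs `(k, λ)` of a momentum `k ∈ ℝᵈ` and one of the `d - 1` polarizations.
`L²(ℝᵈ; ℂ^(d-1))` is identified with `L²(Mode d)`. -/
abbrev Mode (d : ℕ) : Type := EuclideanSpace ℝ (Fin d) × Fin (d - 1)

/-- Lebesgue measure in `k` times counting measure in `λ`. -/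
abbrev modeMeasure (d : ℕ) : Measure (Mode d) :=
  (volume : Measure (EuclideanSpace ℝ (Fin d))).prod (Measure.count : Measure (Fin (d - 1)))

/-- The product measure on the `N`-photon configurations. -/
abbrev photonMeasure (d N : ℕ) : Measure (Fin N → Mode d) :=
  Measure.pi fun _ => modeMeasure d

theorem measurePreserving_perm (d N : ℕ) (σ : Equiv.Perm (Fin N)) :
    MeasurePreserving (fun K : Fin N → Mode d => fun j => K (σ j))
      (photonMeasure d N) (photonMeasure d N) := by
  have h := measurePreserving_piCongrLeft (fun _ : Fin N => modeMeasure d) σ.symm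
  convert! h using 1
  funext K j
  have := Equiv.piCongrLeft_apply_apply (fun _ : Fin N => Mode d) σ.symm K (σ j)
  simp only [MeasurableEquiv.coe_piCongrLeft]
  simpa using this.symm

/-- The `N`-photon space: the `Ψ ∈ L²((ℝᵈ × {1,…,d-1})ᴺ)` that are invariant under all
permutations of the `N` photons. -/
def symL2 (d N : ℕ) : Submodule ℂ (Lp ℂ 2 (photonMeasure d N)) :=
  ⨅ σ : Equiv.Perm (Fin N), LinearMap.eqLocus
    (Lp.compMeasurePreservingₗᵢ ℂ _ (measurePreserving_perm d N σ)).toLinearMap LinearMap.id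

theorem isClosed_symL2 (d N : ℕ) :
    IsClosed (symL2 d N : Set (Lp ℂ 2 (photonMeasure d N))) := by
  rw [symL2, Submodule.coe_iInf]
  exact isClosed_iInter fun σ => isClosed_eq
    (Lp.compMeasurePreservingₗᵢ ℂ _ (measurePreserving_perm d N σ)).continuous continuous_id

instance (d N : ℕ) : CompleteSpace (symL2 d N) := (isClosed_symL2 d N).completeSpace_coe

/-- The symmetric Fock space `Γ_s(L²(ℝᵈ; ℂ^(d-1)))`: the Hilbert direct sum over `N` of the
`N`-photon spaces. -/
abbrev Fock (d : ℕ) : Type := lp (fun N => symL2 d N) 2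

/-- The `N`-photon component of `Ψ`, as a function of the `N` photon modes. -/
def comp {d : ℕ} (Ψ : Fock d) (N : ℕ) : (Fin N → Mode d) → ℂ :=
  ((Ψ N : symL2 d N) : Lp ℂ 2 (photonMeasure d N))

theorem comp_zero {d : ℕ} (N : ℕ) : comp (0 : Fock d) N =ᵐ[photonMeasure d N] 0 :=
  Lp.coeFn_zero ℂ 2 _

theorem comp_add {d : ℕ} (Ψ Φ : Fock d) (N : ℕ) :
    comp (Ψ + Φ) N =ᵐ[photonMeasure d N] comp Ψ N + comp Φ N :=
  Lp.coeFn_add _ _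

theorem comp_smul {d : ℕ} (c : ℂ) (Ψ : Fock d) (N : ℕ) :
    comp (c • Ψ) N =ᵐ[photonMeasure d N] c • comp Ψ N :=
  Lp.coeFn_smul _ _

theorem eq_zero_of_comp {d : ℕ} {Ψ : Fock d}
    (h : ∀ N, ∀ᵐ K ∂photonMeasure d N, comp Ψ N K = 0) : Ψ = 0 := by
  ext1
  funext N
  apply Subtype.ext
  exact (Lp.eq_zero_iff_ae_eq_zero).2 (h N)

theorem ae_cons {d N : ℕ} {P : (Fin (N + 1) → Mode d) → Prop}
    (h : ∀ᵐ K ∂photonMeasure d (N + 1), P K) :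
    ∀ᵐ K ∂photonMeasure d N, ∀ᵐ κ ∂modeMeasure d, P (Fin.cons κ K) := by
  have e := measurePreserving_piFinSuccAbove (fun _ : Fin (N + 1) => modeMeasure d) 0
  have h1 := (e.symm _).quasiMeasurePreserving.ae h
  have h2 := (Measure.measurePreserving_swap
    (μ := photonMeasure d N) (ν := modeMeasure d)).quasiMeasurePreserving.ae h1
  have h3 := Measure.ae_ae_of_ae_prod h2
  filter_upwards [h3] with K hK
  filter_upwards [hK] with κ hκ
  simpa [MeasurableEquiv.piFinSuccAbove, Fin.insertNthEquiv] using hκ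

theorem ae_removeNth {d N : ℕ} (j : Fin (N + 1)) {P : (Fin N → Mode d) → Prop}
    (h : ∀ᵐ K ∂photonMeasure d N, P K) :
    ∀ᵐ K ∂photonMeasure d (N + 1), P (j.removeNth K) := by
  have e := measurePreserving_piFinSuccAbove (fun _ : Fin (N + 1) => modeMeasure d) j
  have h1 := (Measure.quasiMeasurePreserving_snd
    (μ := modeMeasure d) (ν := photonMeasure d N)).ae h
  exact e.quasiMeasurePreserving.ae h1

/-! ### Field operators, in the `ħ`-scaled normalization `[a(f), a*(g)] = ħ ⟨f, g⟩` -/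

/-- Graph of the annihilation operator
`(a(f)Ψ)_N(K) = √(ħ (N+1)) ∫ conj(f(κ)) Ψ_{N+1}(κ, K) dκ`, on its maximal domain. -/
def annihilationGraph {d : ℕ} (ħ : ℝ) (f : Mode d → ℂ) : Submodule ℂ (Fock d × Fock d) where
  carrier := {x | ∀ N, ∀ᵐ K ∂photonMeasure d N,
    Integrable (fun κ => star (f κ) * comp x.1 (N + 1) (Fin.cons κ K)) (modeMeasure d) ∧
    comp x.2 N K = (Real.sqrt (ħ * (N + 1)) : ℂ) *
      ∫ κ, star (f κ) * comp x.1 (N + 1) (Fin.cons κ K) ∂modeMeasure d}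
  zero_mem' := by
    intro N
    filter_upwards [comp_zero N, ae_cons (comp_zero (d := d) (N + 1))] with K h1 h2
    have h3 : (fun κ => star (f κ) * comp (0 : Fock d) (N + 1) (Fin.cons κ K))
        =ᵐ[modeMeasure d] fun _ => (0 : ℂ) := by
      filter_upwards [h2] with κ hκ
      simp [hκ]
    refine ⟨(integrable_zero _ _ _).congr h3.symm, ?_⟩
    change comp (0 : Fock d) N K = _ * ∫ κ, star (f κ) * comp (0 : Fock d) (N + 1) (Fin.cons κ K)
      ∂modeMeasure d
    rw [integral_congr_ae h3]
    simp [h1]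
  add_mem' := by
    intro x y hx hy N
    filter_upwards [hx N, hy N, comp_add x.2 y.2 N, ae_cons (comp_add x.1 y.1 (N + 1))]
      with K hx hy h1 h2
    have h3 : (fun κ => star (f κ) * comp (x.1 + y.1) (N + 1) (Fin.cons κ K))
        =ᵐ[modeMeasure d] fun κ => star (f κ) * comp x.1 (N + 1) (Fin.cons κ K) +
          star (f κ) * comp y.1 (N + 1) (Fin.cons κ K) := by
      filter_upwards [h2] with κ hκ
      simp [hκ, mul_add]
    refine ⟨(hx.1.add hy.1).congr h3.symm, ?_⟩
    change comp (x.2 + y.2) N K = _ * ∫ κ, star (f κ) * comp (x.1 + y.1) (N + 1) (Fin.cons κ K)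
      ∂modeMeasure d
    rw [integral_congr_ae h3, integral_add hx.1 hy.1, h1, Pi.add_apply, hx.2, hy.2]
    ring
  smul_mem' := by
    intro c x hx N
    filter_upwards [hx N, comp_smul c x.2 N, ae_cons (comp_smul c x.1 (N + 1))] with K hx h1 h2
    have h3 : (fun κ => star (f κ) * comp (c • x.1) (N + 1) (Fin.cons κ K))
        =ᵐ[modeMeasure d] fun κ => c * (star (f κ) * comp x.1 (N + 1) (Fin.cons κ K)) := by
      filter_upwards [h2] with κ hκ
      simp only [hκ, Pi.smul_apply, smul_eq_mul]
      ring
    refine ⟨(hx.1.const_mul c).congr h3.symm, ?_⟩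
    change comp (c • x.2) N K = _ * ∫ κ, star (f κ) * comp (c • x.1) (N + 1) (Fin.cons κ K)
      ∂modeMeasure d
    rw [integral_congr_ae h3, integral_const_mul, h1, Pi.smul_apply, hx.2, smul_eq_mul]
    ring

/-- Graph of the creation operator: `(a*(f)Ψ)_0 = 0` and
`(a*(f)Ψ)_{N+1}(K) = √(ħ/(N+1)) ∑_j f(K_j) Ψ_N(K without K_j)`, on its maximal domain. -/
def creationGraph {d : ℕ} (ħ : ℝ) (f : Mode d → ℂ) : Submodule ℂ (Fock d × Fock d) where
  carrier := {x | (∀ᵐ K ∂photonMeasure d 0, comp x.2 0 K = 0) ∧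
    ∀ N, ∀ᵐ K ∂photonMeasure d (N + 1),
      comp x.2 (N + 1) K = (Real.sqrt (ħ / (N + 1)) : ℂ) *
        ∑ j : Fin (N + 1), f (K j) * comp x.1 N (j.removeNth K)}
  zero_mem' := by
    refine ⟨comp_zero 0, fun N => ?_⟩
    filter_upwards [comp_zero (N + 1),
      ae_all_iff.2 fun j : Fin (N + 1) => ae_removeNth j (comp_zero (d := d) N)] with K h1 h2
    simp [h1, h2]
  add_mem' := by
    intro x y hx hy
    refine ⟨?_, fun N => ?_⟩
    · filter_upwards [hx.1, hy.1, comp_add x.2 y.2 0] with K h1 h2 h3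
      simp [h1, h2, h3]
    · filter_upwards [hx.2 N, hy.2 N, comp_add x.2 y.2 (N + 1),
        ae_all_iff.2 fun j : Fin (N + 1) => ae_removeNth j (comp_add x.1 y.1 N)] with K h1 h2 h3 h4
      simp [h1, h2, h3, h4, mul_add, Finset.sum_add_distrib]
  smul_mem' := by
    intro c x hx
    refine ⟨?_, fun N => ?_⟩
    · filter_upwards [hx.1, comp_smul c x.2 0] with K h1 h2
      simp [h1, h2]
    · filter_upwards [hx.2 N, comp_smul c x.2 (N + 1),
        ae_all_iff.2 fun j : Fin (N + 1) => ae_removeNth j (comp_smul c x.1 N)] with K h1 h2 h3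
      simp only [Prod.smul_fst, Prod.smul_snd, h1, h2, h3, Pi.smul_apply, smul_eq_mul,
        Finset.mul_sum]
      exact Finset.sum_congr rfl fun j _ => by ring

/-- Graph of the field energy `(H_f Ψ)_N(K) = ħ (|k_1| + ⋯ + |k_N|) Ψ_N(K)`, on its maximal
domain. -/
def fieldEnergyGraph (d : ℕ) (ħ : ℝ) : Submodule ℂ (Fock d × Fock d) where
  carrier := {x | ∀ N, ∀ᵐ K ∂photonMeasure d N,
    comp x.2 N K = ((ħ * ∑ j : Fin N, ‖(K j).1‖ : ℝ) : ℂ) * comp x.1 N K}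
  zero_mem' := by
    intro N
    filter_upwards [comp_zero N] with K h1
    simp [h1]
  add_mem' := by
    intro x y hx hy N
    filter_upwards [hx N, hy N, comp_add x.2 y.2 N, comp_add x.1 y.1 N] with K h1 h2 h3 h4
    simp only [Prod.fst_add, Prod.snd_add, h1, h2, h3, h4, Pi.add_apply, mul_add]
  smul_mem' := by
    intro c x hx N
    filter_upwards [hx N, comp_smul c x.2 N, comp_smul c x.1 N] with K h1 h2 h3
    simp only [Prod.smul_fst, Prod.smul_snd, h1, h2, h3, Pi.smul_apply, smul_eq_mul]
    ring

theorem annihilationGraph_functional {d : ℕ} (ħ : ℝ) (f : Mode d → ℂ) :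
    IsFunctional (annihilationGraph ħ f) := by
  rintro ⟨x, y⟩ h hx
  obtain rfl : x = 0 := hx
  refine eq_zero_of_comp fun N => ?_
  filter_upwards [h N, ae_cons (comp_zero (d := d) (N + 1))] with K h1 h2
  have h3 : (fun κ => star (f κ) * comp (0 : Fock d) (N + 1) (Fin.cons κ K))
      =ᵐ[modeMeasure d] fun _ => (0 : ℂ) := by
    filter_upwards [h2] with κ hκ
    simp [hκ]
  rw [h1.2, integral_congr_ae h3]
  simp

theorem creationGraph_functional {d : ℕ} (ħ : ℝ) (f : Mode d → ℂ) :
    IsFunctional (creationGraph ħ f) := by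
  rintro ⟨x, y⟩ h hx
  obtain rfl : x = 0 := hx
  refine eq_zero_of_comp fun N => ?_
  cases N with
  | zero => exact h.1
  | succ N =>
    filter_upwards [h.2 N,
      ae_all_iff.2 fun j : Fin (N + 1) => ae_removeNth j (comp_zero (d := d) N)] with K h1 h2
    rw [h1]
    simp [h2]

theorem fieldEnergyGraph_functional (d : ℕ) (ħ : ℝ) : IsFunctional (fieldEnergyGraph d ħ) := by
  rintro ⟨x, y⟩ h hx
  obtain rfl : x = 0 := hx
  refine eq_zero_of_comp fun N => ?_
  filter_upwards [h N, comp_zero (d := d) N] with K h1 h2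
  rw [h1]
  simp [h2]

/-- The annihilation operator `a(f) = ∑_λ ∫ conj(f_λ(k)) a_λ(k) dk` on Fock space. -/
def annihilation {d : ℕ} (ħ : ℝ) (f : Mode d → ℂ) : Fock d →ₗ.[ℂ] Fock d :=
  (annihilationGraph ħ f).toLinearPMap

/-- The creation operator `a*(f) = ∑_λ ∫ f_λ(k) a*_λ(k) dk` on Fock space. -/
def creation {d : ℕ} (ħ : ℝ) (f : Mode d → ℂ) : Fock d →ₗ.[ℂ] Fock d :=
  (creationGraph ħ f).toLinearPMap

/-- The field Hamiltonian `H_f = ∑_λ ∫ |k| a*_λ(k) a_λ(k) dk` on Fock space. -/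
def fieldEnergy (d : ℕ) (ħ : ℝ) : Fock d →ₗ.[ℂ] Fock d :=
  (fieldEnergyGraph d ħ).toLinearPMap

/-! ### The particles-field space `L²(ℝ^{dn}) ⊗ Γ_s ≅ L²(ℝ^{dn}; Γ_s)` -/

/-- The configuration space `ℝ^{dn}` of the particles; `x (i, ν)` is the `ν`-th coordinate of the
`i`-th particle. -/
abbrev Config (d n : ℕ) : Type := EuclideanSpace ℝ (Fin n × Fin d)

/-- The position `x_i ∈ ℝᵈ` of the `i`-th particle. -/
def position {d n : ℕ} (x : Config d n) (i : Fin n) : EuclideanSpace ℝ (Fin d) :=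
  WithLp.toLp 2 fun ν => x (i, ν)

/-- The Hilbert space of the particles-field system. -/
abbrev State (d n : ℕ) : Type := Lp (Fock d) 2 (volume : Measure (Config d n))

/-- Graph of the operator `(TΨ)(x) = T(x) Ψ(x)` for a family `T(x)` of operators on Fock space,
on its maximal domain. -/
def fiberGraph {d n : ℕ} (T : Config d n → (Fock d →ₗ.[ℂ] Fock d)) :
    Submodule ℂ (State d n × State d n) where
  carrier := {Ψ | ∀ᵐ x, (Ψ.1 x, Ψ.2 x) ∈ (T x).graph}
  zero_mem' := by
    have h : ((0 : State d n) : Config d n → Fock d) =ᵐ[volume] 0 := Lp.coeFn_zero _ _ _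
    filter_upwards [h] with x hx
    simp only [Prod.fst_zero, Prod.snd_zero, hx, Pi.zero_apply]
    exact (T x).graph.zero_mem
  add_mem' := by
    intro Ψ Φ hΨ hΦ
    filter_upwards [hΨ, hΦ, Lp.coeFn_add Ψ.1 Φ.1, Lp.coeFn_add Ψ.2 Φ.2] with x h1 h2 h3 h4
    simp only [Prod.fst_add, Prod.snd_add, h3, h4, Pi.add_apply]
    exact (T x).graph.add_mem h1 h2
  smul_mem' := by
    intro c Ψ hΨ
    filter_upwards [hΨ, Lp.coeFn_smul c Ψ.1, Lp.coeFn_smul c Ψ.2] with x h1 h2 h3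
    simp only [Prod.smul_fst, Prod.smul_snd, h2, h3, Pi.smul_apply]
    exact (T x).graph.smul_mem c h1

theorem fiberGraph_functional {d n : ℕ} (T : Config d n → (Fock d →ₗ.[ℂ] Fock d)) :
    IsFunctional (fiberGraph T) := by
  rintro ⟨Ψ, Φ⟩ h hΨ
  obtain rfl : Ψ = 0 := hΨ
  refine (Lp.eq_zero_iff_ae_eq_zero).2 ?_
  have h0 : ((0 : State d n) : Config d n → Fock d) =ᵐ[volume] 0 := Lp.coeFn_zero _ _ _
  have h' : ∀ᵐ x, ((0 : State d n) x, Φ x) ∈ (T x).graph := h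
  filter_upwards [h', h0] with x h1 h2
  exact (T x).graph_fst_eq_zero_snd h1 h2

/-- The operator `(TΨ)(x) = T(x) Ψ(x)` on the particles-field space. -/
def fiberOp {d n : ℕ} (T : Config d n → (Fock d →ₗ.[ℂ] Fock d)) :
    State d n →ₗ.[ℂ] State d n :=
  (fiberGraph T).toLinearPMap

/-- The `ν`-th component of the momentum operator `p_i = -iħ∇_{x_i}`. -/
def momentum {d n : ℕ} (ħ : ℝ) (i : Fin n) (ν : Fin d) : State d n →ₗ.[ℂ] State d n :=
  (weakDerivGraph (Fock d) ħ (EuclideanSpace.single (i, ν) 1 : Config d n)).toLinearPMap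

/-- The field Hamiltonian `1 ⊗ H_f` on the particles-field space. -/
def fieldHamiltonian {d n : ℕ} (ħ : ℝ) : State d n →ₗ.[ℂ] State d n :=
  fiberOp fun _ => fieldEnergy d ħ

/-- The operator of multiplication by `V(x)`. -/
def potential {d n : ℕ} (V : Config d n → ℝ) : State d n →ₗ.[ℂ] State d n :=
  fiberOp fun x => (V x : ℂ) • (LinearMap.id : Fock d →ₗ[ℂ] Fock d).toPMap ⊤

/-- The coupling function
`(k, λ) ↦ ε_λ^ν(k) χ(k) exp(-2πi k·q) / √(2|k|)`. -/
def coupling {d : ℕ} (ε : Fin (d - 1) → EuclideanSpace ℝ (Fin d) → EuclideanSpace ℝ (Fin d))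
    (χ : EuclideanSpace ℝ (Fin d) → ℂ) (ν : Fin d) (q : EuclideanSpace ℝ (Fin d)) :
    Mode d → ℂ := fun κ =>
  ((ε κ.2 κ.1 ν / Real.sqrt (2 * ‖κ.1‖) : ℝ) : ℂ) * χ κ.1 *
    Complex.exp (-(2 * Real.pi * inner ℝ κ.1 q : ℝ) * Complex.I)

/-- The `ν`-th component of the quantized vector potential `A_i(q_i, a)`: at the configuration `x`
it is `a(v) + a*(v)` with `v` the coupling function at `q = x_i`. -/
def vectorPotential {d n : ℕ} (ħ : ℝ)
    (ε : Fin (d - 1) → EuclideanSpace ℝ (Fin d) → EuclideanSpace ℝ (Fin d))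
    (χ : Fin n → EuclideanSpace ℝ (Fin d) → ℂ) (i : Fin n) (ν : Fin d) :
    State d n →ₗ.[ℂ] State d n :=
  fiberOp (fun x => annihilation ħ (coupling ε (χ i) ν (position x i))) +
    fiberOp (fun x => creation ħ (coupling ε (χ i) ν (position x i)))

/-- The component `p_i^ν - A_i^ν` of the kinetic momentum. -/
def kineticMomentum {d n : ℕ} (ħ : ℝ)
    (ε : Fin (d - 1) → EuclideanSpace ℝ (Fin d) → EuclideanSpace ℝ (Fin d))
    (χ : Fin n → EuclideanSpace ℝ (Fin d) → ℂ) (i : Fin n) (ν : Fin d) :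
    State d n →ₗ.[ℂ] State d n :=
  momentum ħ i ν - vectorPotential ħ ε χ i ν

/-- The free Hamiltonian `∑_i (1/2m_i) p_i² + H_f`, with natural domain `D(p²) ∩ D(H_f)`. -/
def freeHamiltonian {d n : ℕ} (ħ : ℝ) (m : Fin n → ℝ) : State d n →ₗ.[ℂ] State d n :=
  (∑ i, ((1 / (2 * m i) : ℝ) : ℂ) • ∑ ν : Fin d, opComp (momentum ħ i ν) (momentum ħ i ν)) +
    fieldHamiltonian ħ

/-- The Pauli–Fierz Hamiltonian `∑_i (1/2m_i) (p_i - A_i)² + V + H_f`, with the natural domain of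
this expression. -/
def pauliFierz {d n : ℕ} (ħ : ℝ) (m : Fin n → ℝ) (V : Config d n → ℝ)
    (ε : Fin (d - 1) → EuclideanSpace ℝ (Fin d) → EuclideanSpace ℝ (Fin d))
    (χ : Fin n → EuclideanSpace ℝ (Fin d) → ℂ) : State d n →ₗ.[ℂ] State d n :=
  (∑ i, ((1 / (2 * m i) : ℝ) : ℂ) • ∑ ν : Fin d,
      opComp (kineticMomentum ħ ε χ i ν) (kineticMomentum ħ ε χ i ν)) +
    potential V + fieldHamiltonian ħ

/-! ### The assumptions -/

/-- Polarization vectors: for almost every `k`, `ε_1(k), …, ε_{d-1}(k)` are orthonormal and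
orthogonal to `k` (so that together with `k/|k|` they form an orthonormal basis of `ℝᵈ`). -/
structure IsPolarization {d : ℕ}
    (ε : Fin (d - 1) → EuclideanSpace ℝ (Fin d) → EuclideanSpace ℝ (Fin d)) : Prop where
  aemeasurable : ∀ l, AEMeasurable (ε l) volume
  orthogonal : ∀ᵐ k, ∀ l, inner ℝ k (ε l k) = 0
  orthonormal : ∀ᵐ k, Orthonormal ℝ fun l => ε l k

/-- Assumption `(A_0)`: `V` is a bounded `C²` function with bounded first and second
derivatives. -/
def AssumptionA0 {d n : ℕ} (V : Config d n → ℝ) : Prop :=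
  ContDiff ℝ 2 V ∧ ∃ M : ℝ, ∀ j ≤ 2, ∀ x, ‖iteratedFDeriv ℝ j V x‖ ≤ M

/-- Assumption `(A_1)`: `|k|⁻¹ χ(k)` is square integrable. -/
def AssumptionA1 {d : ℕ} (χ : EuclideanSpace ℝ (Fin d) → ℂ) : Prop :=
  MemLp (fun k => ((‖k‖⁻¹ : ℝ) : ℂ) * χ k) 2 volume

/-- Assumption `(A_2^{(σ)})`: `|k|^{3/2 - σ} χ(k)` is square integrable. -/
def AssumptionA2 {d : ℕ} (σ : ℝ) (χ : EuclideanSpace ℝ (Fin d) → ℂ) : Prop :=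
  MemLp (fun k => ((‖k‖ ^ (3 / 2 - σ) : ℝ) : ℂ) * χ k) 2 volume

end PauliFierz

end

open PauliFierz

noncomputable section

namespace PauliFierz

/-! ### Graphs of unbounded operators -/

section Graphs

variable {E : Type*} [AddCommGroup E] [Module ℂ E]

/-! Fix ψ in the free domain and put R = (1 + H_f)^{-1/2}, η = (1 + H_f)ψ and φ = Rη = (1 +
H_f)^{1/2}ψ, so that ψ = R²η. For every coordinate α = (i, ν) compare P = p²ψ with Q = (p - A)²ψ.
Since p commutes with H_f, Re⟨P, η⟩ = ‖θ‖² with θ = (1 + H_f)^{1/2}pψ. Hence there is no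
cancellation in (H⁰ + 1)ψ = ∑ c P + η: its norm controls ‖η‖ and every ‖θ‖. The difference P - Q
consists of A applied to pψ, A applied to (p - A)ψ, and [p, A]ψ. Because A is bounded relative to (1
+ H_f)^{1/2}, it is at most a constant times ‖θ‖ + ‖η‖. This gives the inclusion of domains and the
first inequality.

The second inequality repeats the argument with ξ = (1 + H_f)^{1/2}(p - A)ψ in place of θ. Now Re⟨Q,
η⟩ equals ‖ξ‖² only up to a commutator of A with H_f. That commutator is again a field operator,
with form factor |k|f, so the error is at most K‖ξ‖‖φ‖. Positivity of (p - A)² and the choice γ = M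
+ 1, where |V| ≤ M, give ‖φ‖ ≤ ‖(H + γ)ψ‖, which absorbs the error. The bookkeeping of both
inequalities is `exists_comparison_constants`.

The field estimates reduce to finiteness of ∫ (1 + |k|)^m |k|⁻¹ |f|². The exponent m = 1 bounds AR,
m = 2 bounds R⁻¹AR², and m = 3 bounds [p, A]R and the commutators with H_f, because each of these
multiplies f by |k|. As f is of size χ/√|k|, the case m = 3 is what (A_1) and (A_2) provide. The
bounds are uniform in ħ because the factors √(ħ(N + 1)) and √(ħ/(N + 1)) combine with the photon
momenta to the energy ħ∑|k_j| (`sectorForm_le_of_lowering`, `sectorForm_le_of_raising`), while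
commutators bring a factor ħ < 1.

Two devices settle the domain questions. Weak derivatives are identified with generators of
translations in L² (`hasTranslationDeriv_iff`), which yields closedness, symmetry and the product
rule pA = Ap + [p, A]. Unbounded functions of H_f are approximated by bounded ones, with 1 + H_f
replaced by (1 + H_f)(1 + δ(1 + H_f))⁻¹ and δ → 0 (`RegularizedMomentum.exists_L_momentum`,
`RegularizedField.exists_kinetic`). -/

theorem mem_graph_add {S T : E →ₗ.[ℂ] E} {x y z : E} (hS : (x, y) ∈ S.graph)
    (hT : (x, z) ∈ T.graph) : (x, y + z) ∈ (S + T).graph := by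
  obtain ⟨a, rfl, rfl⟩ := (LinearPMap.mem_graph_iff S).1 hS
  obtain ⟨b, hb, rfl⟩ := (LinearPMap.mem_graph_iff T).1 hT
  have hb' : (b : E) = a := hb
  refine (LinearPMap.mem_graph_iff _).2 ⟨⟨a, a.2, hb' ▸ b.2⟩, rfl, ?_⟩
  rw [LinearPMap.add_apply]
  congr 2
  exact Subtype.ext hb.symm

theorem mem_graph_sub {S T : E →ₗ.[ℂ] E} {x y z : E} (hS : (x, y) ∈ S.graph)
    (hT : (x, z) ∈ T.graph) : (x, y - z) ∈ (S - T).graph := by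
  obtain ⟨a, rfl, rfl⟩ := (LinearPMap.mem_graph_iff S).1 hS
  obtain ⟨b, hb, rfl⟩ := (LinearPMap.mem_graph_iff T).1 hT
  have hb' : (b : E) = a := hb
  refine (LinearPMap.mem_graph_iff _).2 ⟨⟨a, a.2, hb' ▸ b.2⟩, rfl, ?_⟩
  rw [LinearPMap.sub_apply]
  congr 2
  exact Subtype.ext hb.symm

theorem mem_graph_const_smul {S : E →ₗ.[ℂ] E} {x y : E} (c : ℂ) (hS : (x, y) ∈ S.graph) :
    (x, c • y) ∈ (c • S).graph := by
  obtain ⟨a, rfl, rfl⟩ := (LinearPMap.mem_graph_iff S).1 hS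
  exact (LinearPMap.mem_graph_iff _).2 ⟨⟨a, a.2⟩, rfl, rfl⟩

theorem mem_graph_opComp {T S : E →ₗ.[ℂ] E} {x y z : E} (hS : (x, y) ∈ S.graph)
    (hT : (y, z) ∈ T.graph) : (x, z) ∈ (opComp T S).graph := by
  obtain ⟨a, rfl, rfl⟩ := (LinearPMap.mem_graph_iff S).1 hS
  obtain ⟨b, hb, rfl⟩ := (LinearPMap.mem_graph_iff T).1 hT
  have hb' : S ⟨a, a.2⟩ ∈ T.domain := by
    have := b.2
    rwa [hb] at this
  have h : (a : E) ∈ (opComp T S).domain := (mem_opComp_domain T S a).2 ⟨a.2, hb'⟩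
  refine (LinearPMap.mem_graph_iff _).2 ⟨⟨a, h⟩, rfl, ?_⟩
  rw [opComp_apply T S a h a.2 hb']
  congr 1
  exact Subtype.ext hb.symm

theorem exists_of_mem_opComp_domain {T S : E →ₗ.[ℂ] E} {x : E}
    (h : x ∈ (opComp T S).domain) : ∃ y z, (x, y) ∈ S.graph ∧ (y, z) ∈ T.graph := by
  obtain ⟨hx, hT⟩ := (mem_opComp_domain T S x).1 h
  exact ⟨_, _, S.mem_graph ⟨x, hx⟩, T.mem_graph ⟨_, hT⟩⟩

theorem mem_graph_sum {ι : Type*} (s : Finset ι) {T : ι → E →ₗ.[ℂ] E} {x : E} {y : ι → E}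
    (h : ∀ i ∈ s, (x, y i) ∈ (T i).graph) : (x, ∑ i ∈ s, y i) ∈ (∑ i ∈ s, T i).graph := by
  classical
  induction s using Finset.induction_on with
  | empty =>
    -- The empty sum is the zero operator with full domain.
    rw [Finset.sum_empty, Finset.sum_empty]
    exact (LinearPMap.mem_graph_iff _).2 ⟨⟨x, Submodule.mem_top⟩, rfl, rfl⟩
  | insert a s ha ih =>
    rw [Finset.sum_insert ha, Finset.sum_insert ha]
    exact mem_graph_add (h a (Finset.mem_insert_self a s))
      (ih fun i hi => h i (Finset.mem_insert_of_mem hi))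

theorem mem_domain_of_mem_sum_domain {ι : Type*} {s : Finset ι} {T : ι → E →ₗ.[ℂ] E} {x : E}
    (h : x ∈ (∑ i ∈ s, T i).domain) : ∀ i ∈ s, x ∈ (T i).domain := by
  classical
  induction s using Finset.induction_on with
  | empty => simp
  | insert a s ha ih =>
    rw [Finset.sum_insert ha] at h
    intro i hi
    rcases Finset.mem_insert.1 hi with rfl | hi
    · exact h.1
    · exact ih h.2 i hi

/-- All operators here are built from graphs, so reasoning with pairs in a graph avoids carrying
domain proofs inside terms. -/
theorem IsFunctional.mem_graph_iff {g : Submodule ℂ (E × E)} (hg : IsFunctional g) {x : E × E} :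
    x ∈ g.toLinearPMap.graph ↔ x ∈ g := by
  rw [Submodule.toLinearPMap_graph_eq g hg]

theorem apply_eq_of_mem_graph {T : E →ₗ.[ℂ] E} {x y : E} (h : (x, y) ∈ T.graph)
    (hx : x ∈ T.domain) : T ⟨x, hx⟩ = y :=
  LinearPMap.mem_graph_snd_inj T (T.mem_graph ⟨x, hx⟩) h rfl

end Graphs

/-! ### An abstract two-sided estimate -/

section Abstract

variable {H ι : Type*} [NormedAddCommGroup H] [InnerProductSpace ℂ H] [Fintype ι]

/-- Converts quadratic control, which is what the absence of cancellation yields, into the weighted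
linear control that the perturbation terms require. The point is (c w)² = c (c w²) ≤ c D², with c
and √c dominated by 1 + ∑ c. -/
theorem sum_mul_le_of_sq_le (c : ι → ℝ) (hc : ∀ i, 0 < c i) {w : ι → ℝ}
    {e D : ℝ} (hD : 0 ≤ D) (h : e ^ 2 + ∑ i, c i * w i ^ 2 ≤ D ^ 2) :
    ∑ i, c i * (w i + e) ≤ (Fintype.card ι * (∑ i, c i + 1) + ∑ i, c i) * D := by
  have hS : 0 ≤ ∑ i, c i := Finset.sum_nonneg fun i _ => (hc i).le
  have hcw : ∀ i, 0 ≤ c i * w i ^ 2 := fun i => mul_nonneg (hc i).le (sq_nonneg _)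
  have hsum : 0 ≤ ∑ i, c i * w i ^ 2 := Finset.sum_nonneg fun i _ => hcw i
  have heD : e ≤ D := abs_le_of_sq_le_sq' (by linarith) hD |>.2
  have h1 : ∀ i, c i * w i ≤ (∑ i, c i + 1) * D := by
    intro i
    have hci : c i ≤ ∑ i, c i := Finset.single_le_sum (fun i _ => (hc i).le) (Finset.mem_univ i)
    have hwi : c i * w i ^ 2 ≤ D ^ 2 :=
      (Finset.single_le_sum (fun i _ => hcw i) (Finset.mem_univ i)).trans (by nlinarith)
    refine abs_le_of_sq_le_sq' ?_ (by positivity) |>.2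
    calc (c i * w i) ^ 2 = c i * (c i * w i ^ 2) := by ring
      _ ≤ c i * D ^ 2 := by gcongr; exact (hc i).le
      _ ≤ (∑ i, c i + 1) ^ 2 * D ^ 2 := by gcongr; nlinarith
      _ = _ := by ring
  calc ∑ i, c i * (w i + e) = ∑ i, c i * w i + (∑ i, c i) * e := by
        rw [Finset.sum_mul, ← Finset.sum_add_distrib]
        exact Finset.sum_congr rfl fun i _ => by ring
    _ ≤ ∑ _i : ι, (∑ i, c i + 1) * D + (∑ i, c i) * D := by
        gcongr ?_ + _ * ?_
        exact Finset.sum_le_sum fun i _ => h1 i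
    _ = _ := by
        rw [Finset.sum_const, Finset.card_univ, nsmul_eq_mul]
        ring

theorem norm_sum_smul_le (c : ι → ℝ) (hc : ∀ i, 0 < c i) {K e : ℝ} {X : ι → H} {w : ι → ℝ}
    (h : ∀ i, ‖X i‖ ≤ K * (w i + e)) :
    ‖∑ i, (c i : ℂ) • X i‖ ≤ K * ∑ i, c i * (w i + e) := by
  refine (norm_sum_le _ _).trans ?_
  rw [Finset.mul_sum]
  refine Finset.sum_le_sum fun i _ => ?_
  rw [norm_smul, Complex.norm_real, Real.norm_of_nonneg (hc i).le]
  nlinarith [h i, hc i]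

theorem norm_sum_smul_add_sq (c : ι → ℝ) (X : ι → H) (η : H) :
    ‖∑ i, (c i : ℂ) • X i + η‖ ^ 2 = ‖∑ i, (c i : ℂ) • X i‖ ^ 2 +
      2 * ∑ i, c i * RCLike.re (inner ℂ (X i) η) + ‖η‖ ^ 2 := by
  have h : ∀ i, RCLike.re (inner ℂ ((c i : ℂ) • X i) η) = c i * RCLike.re (inner ℂ (X i) η) := by
    intro i
    rw [inner_smul_left, Complex.conj_ofReal]
    exact RCLike.re_ofReal_mul _ _
  rw [norm_add_sq (𝕜 := ℂ), sum_inner, map_sum]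
  simp only [h]

/-- Comparison of `∑ c_i P_i + η` and `∑ c_i Q_i + η` when `P_i` and `Q_i` differ by a lower order
term, both are almost positively correlated with `η`. -/
theorem exists_comparison_constants (c : ι → ℝ) (hc : ∀ i, 0 < c i) (K M : ℝ) (hK : 0 ≤ K)
    (hM : 0 ≤ M) :
    ∃ a C : ℝ, 0 < a ∧ 0 < C ∧ ∀ (ψ φ η v : H) (P Q θ ξ : ι → H),
      ‖v‖ ≤ M * ‖ψ‖ → -M * ‖ψ‖ ^ 2 ≤ RCLike.re (inner ℂ ψ v) → ‖ψ‖ ≤ ‖φ‖ → ‖φ‖ ≤ ‖η‖ →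
      RCLike.re (inner ℂ ψ η) = ‖φ‖ ^ 2 →
      (∀ i, 0 ≤ RCLike.re (inner ℂ ψ (Q i))) →
      (∀ i, RCLike.re (inner ℂ (P i) η) = ‖θ i‖ ^ 2) →
      (∀ i, ‖ξ i‖ ^ 2 - K * ‖ξ i‖ * ‖φ‖ ≤ RCLike.re (inner ℂ (Q i) η)) →
      (∀ i, ‖P i - Q i‖ ≤ K * (‖θ i‖ + ‖η‖)) →
      (∀ i, ‖P i - Q i‖ ≤ K * (‖ξ i‖ + ‖η‖)) →
      a * ‖∑ i, (c i : ℂ) • Q i + η + v + (M : ℂ) • ψ‖ ≤ ‖∑ i, (c i : ℂ) • P i + η‖ ∧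
      ‖∑ i, (c i : ℂ) • P i + η‖ ≤ C * ‖∑ i, (c i : ℂ) • Q i + η + v + (M : ℂ) • ψ‖ := by
  set S := ∑ i, c i with hS
  have hS0 : 0 ≤ S := Finset.sum_nonneg fun i _ => (hc i).le
  set A := (Fintype.card ι * (S + 1) + S) with hA
  have hA0 : 0 ≤ A := by positivity
  set D := (1 + 2 * M) + K * (S + 1) with hD
  have hD0 : 0 ≤ D := by positivity
  -- `A` is the constant of `sum_mul_le_of_sq_le`; `D` bounds the quadratic quantity in `η` and `ξ`
  -- by the norm of the interacting vector. The contribution 2M comes from v + Mψ.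
  refine ⟨(1 + K * A + 2 * M)⁻¹, 1 + 2 * M + K * A * D, by positivity, by positivity, ?_⟩
  intro ψ φ η v P Q θ ξ hv hv' hψφ hφη hη hQ hP hQη hPQ hPQ'
  have hPQsum : ∑ i, (c i : ℂ) • P i = ∑ i, (c i : ℂ) • Q i + ∑ i, (c i : ℂ) • (P i - Q i) := by
    rw [← Finset.sum_add_distrib]
    exact Finset.sum_congr rfl fun i _ => by rw [← smul_add]; abel_nf
  constructor
  · set N := ‖∑ i, (c i : ℂ) • P i + η‖ with hN
    have hN0 : 0 ≤ N := norm_nonneg _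
    -- The cross terms in the expanded square are the nonnegative numbers 2 c ‖θ‖².
    have h1 : ‖η‖ ^ 2 + ∑ i, c i * ‖θ i‖ ^ 2 ≤ N ^ 2 := by
      rw [hN, norm_sum_smul_add_sq]
      simp only [hP]
      have : 0 ≤ ∑ i, c i * ‖θ i‖ ^ 2 :=
        Finset.sum_nonneg fun i _ => mul_nonneg (hc i).le (sq_nonneg _)
      nlinarith [sq_nonneg ‖∑ i, (c i : ℂ) • P i‖]
    have h2 := sum_mul_le_of_sq_le c hc hN0 h1
    have h3 := norm_sum_smul_le c hc hPQ
    have hηN : ‖η‖ ≤ N := abs_le_of_sq_le_sq' (by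
      have : 0 ≤ ∑ i, c i * ‖θ i‖ ^ 2 :=
        Finset.sum_nonneg fun i _ => mul_nonneg (hc i).le (sq_nonneg _)
      linarith) hN0 |>.2
    have hψN : ‖ψ‖ ≤ N := hψφ.trans (hφη.trans hηN)
    rw [inv_mul_le_iff₀ (by positivity)]
    have h4 : ∑ i, (c i : ℂ) • Q i + η + v + (M : ℂ) • ψ =
        (∑ i, (c i : ℂ) • P i + η) - ∑ i, (c i : ℂ) • (P i - Q i) + (v + (M : ℂ) • ψ) := by
      rw [hPQsum]; abel
    have h5 : ‖v + (M : ℂ) • ψ‖ ≤ 2 * M * ‖ψ‖ := by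
      refine (norm_add_le _ _).trans ?_
      rw [norm_smul, Complex.norm_real, Real.norm_of_nonneg hM]
      linarith
    rw [h4]
    refine (norm_add_le _ _).trans ((add_le_add (norm_sub_le _ _) h5).trans ?_)
    have h6 := mul_le_mul_of_nonneg_left h2 hK
    have h7 := mul_le_mul_of_nonneg_left hψN (by positivity : 0 ≤ 2 * M)
    linarith
  · set u := ∑ i, (c i : ℂ) • Q i + η + v + (M : ℂ) • ψ with hu
    set N := ‖u‖ with hN
    have hN0 : 0 ≤ N := norm_nonneg _
    -- Pairing with ψ: the terms with Q are nonnegative, the shift Mψ compensates the negative part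
    -- of v, and η contributes ‖φ‖². Together with ‖ψ‖ ≤ ‖φ‖ this bounds φ itself by N.
    have hlow : ‖φ‖ ^ 2 ≤ ‖ψ‖ * N := by
      refine le_trans ?_ ((RCLike.re_le_norm _).trans (norm_inner_le_norm (𝕜 := ℂ) ψ u))
      rw [hu, inner_add_right, inner_add_right, inner_add_right, inner_sum]
      simp only [inner_smul_right, map_add, map_sum]
      have h1 : ∀ i, RCLike.re ((c i : ℂ) * inner ℂ ψ (Q i)) = c i * RCLike.re (inner ℂ ψ (Q i)) :=
        fun i => RCLike.re_ofReal_mul _ _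
      have h2 : RCLike.re ((M : ℂ) * inner ℂ ψ ψ) = M * ‖ψ‖ ^ 2 := by
        rw [← inner_self_eq_norm_sq (𝕜 := ℂ) ψ]
        exact RCLike.re_ofReal_mul _ _
      rw [h2, hη]
      simp only [h1]
      have h3 : 0 ≤ ∑ i, c i * RCLike.re (inner ℂ ψ (Q i)) :=
        Finset.sum_nonneg fun i _ => mul_nonneg (hc i).le (hQ i)
      linarith
    have hφN : ‖φ‖ ≤ N := by
      by_contra! hlt
      nlinarith [norm_nonneg φ, norm_nonneg ψ]
    have hψN : ‖ψ‖ ≤ N := hψφ.trans hφN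
    have h5 : ‖v + (M : ℂ) • ψ‖ ≤ 2 * M * N := by
      refine (norm_add_le _ _).trans ?_
      rw [norm_smul, Complex.norm_real, Real.norm_of_nonneg hM]
      nlinarith
    set h := ∑ i, (c i : ℂ) • Q i + η with hh
    have hhN : ‖h‖ ≤ (1 + 2 * M) * N := by
      have : h = u - (v + (M : ℂ) • ψ) := by rw [hu, hh]; abel
      rw [this]
      refine (norm_sub_le _ _).trans ?_
      linarith
    -- The commutator error is absorbed by 2(x² - K x N) ≥ x² - K²N² with x = ‖ξ‖. The price S K²N²
    -- is what the summand K(S + 1) of `D` pays for.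
    have h1 : ‖η‖ ^ 2 + ∑ i, c i * ‖ξ i‖ ^ 2 ≤ (D * N) ^ 2 := by
      have h6 : ‖η‖ ^ 2 + ∑ i, c i * (‖ξ i‖ ^ 2 - K ^ 2 * N ^ 2) ≤ ‖h‖ ^ 2 := by
        rw [hh, norm_sum_smul_add_sq]
        have : ∑ i, c i * (‖ξ i‖ ^ 2 - K ^ 2 * N ^ 2) ≤
            2 * ∑ i, c i * RCLike.re (inner ℂ (Q i) η) := by
          rw [Finset.mul_sum]
          refine Finset.sum_le_sum fun i _ => ?_
          have h7 := hQη i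
          have h8 : K * ‖ξ i‖ * ‖φ‖ ≤ K * ‖ξ i‖ * N := by gcongr
          nlinarith [hc i, sq_nonneg (‖ξ i‖ - K * N)]
        nlinarith [sq_nonneg ‖∑ i, (c i : ℂ) • Q i‖]
      have h9 : ∑ i, c i * (‖ξ i‖ ^ 2 - K ^ 2 * N ^ 2) =
          ∑ i, c i * ‖ξ i‖ ^ 2 - S * (K ^ 2 * N ^ 2) := by
        rw [hS, Finset.sum_mul, ← Finset.sum_sub_distrib]
        exact Finset.sum_congr rfl fun i _ => by ring
      have h10 : ‖h‖ ^ 2 ≤ ((1 + 2 * M) * N) ^ 2 := by gcongr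
      have h11 : (1 + 2 * M) ^ 2 + S * K ^ 2 ≤ D ^ 2 := by
        rw [hD]
        have : 0 ≤ (1 + 2 * M) * (K * (S + 1)) := by positivity
        nlinarith [sq_nonneg K, mul_nonneg hS0 (sq_nonneg K),
          mul_nonneg (mul_nonneg hS0 hS0) (sq_nonneg K)]
      have h12 := mul_le_mul_of_nonneg_right h11 (sq_nonneg N)
      rw [h9] at h6
      have e1 : ((1 + 2 * M) * N) ^ 2 = (1 + 2 * M) ^ 2 * N ^ 2 := by ring
      have e2 : (D * N) ^ 2 = D ^ 2 * N ^ 2 := by ring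
      have e3 : ((1 + 2 * M) ^ 2 + S * K ^ 2) * N ^ 2 =
        (1 + 2 * M) ^ 2 * N ^ 2 + S * (K ^ 2 * N ^ 2) := by ring
      rw [e2]
      linarith
    have h2 := sum_mul_le_of_sq_le c hc
      (mul_nonneg hD0 hN0) h1
    have h3 := norm_sum_smul_le c hc hPQ'
    have h4 : ∑ i, (c i : ℂ) • P i + η = h + ∑ i, (c i : ℂ) • (P i - Q i) := by
      rw [hPQsum, hh]; abel
    rw [h4]
    refine (norm_add_le _ _).trans ?_
    have h6 := mul_le_mul_of_nonneg_left h2 hK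
    calc ‖h‖ + ‖∑ i, (c i : ℂ) • (P i - Q i)‖ ≤ (1 + 2 * M) * N + K * (A * (D * N)) :=
          add_le_add hhN (h3.trans h6)
      _ = _ := by ring

end Abstract

/-! ### Translations of `L²` functions and weak derivatives -/

theorem lineDerivOp_compSubConstCLM {X : Type*} [NormedAddCommGroup X] [InnerProductSpace ℝ X]
    (g : 𝓢(X, ℂ)) (a v : X) :
    (∂_{v} (g.compSubConstCLM ℂ a) : 𝓢(X, ℂ)) = (∂_{v} g : 𝓢(X, ℂ)).compSubConstCLM ℂ a := by
  ext x
  rw [SchwartzMap.compSubConstCLM_apply, SchwartzMap.lineDerivOp_apply_eq_fderiv,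
    SchwartzMap.lineDerivOp_apply_eq_fderiv]
  have : (g.compSubConstCLM ℂ a : X → ℂ) = fun x => g (x - a) := rfl
  rw [this, fderiv_comp_sub]

section Translation

open Filter Topology

variable {X F : Type*} [NormedAddCommGroup X] [InnerProductSpace ℝ X] [FiniteDimensional ℝ X]
  [MeasurableSpace X] [BorelSpace X]
  [NormedAddCommGroup F]

theorem hasDerivAt_clm_apply {G : Type*} [NormedAddCommGroup G] [NormedSpace ℂ G]
    {T : ℝ → G →L[ℂ] G} {T' : G →L[ℂ] G} {u : ℝ → G} {u' : G} {t : ℝ}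
    (hT : HasDerivAt T T' t) (hu : HasDerivAt u u' t) :
    HasDerivAt (fun s => T s (u s)) (T' (u t) + T t u') t :=
  HasDerivAt.clm_apply
    ((ContinuousLinearMap.restrictScalarsL ℂ G G ℝ ℝ).hasFDerivAt.comp_hasDerivAt t hT) hu

/-- The translation `(τ_a Ψ)(x) = Ψ(x + a)`. -/
def translate (𝕜 : Type*) [NormedField 𝕜] [NormedSpace 𝕜 F] (a : X) :
    Lp F 2 (volume : Measure X) →ₗᵢ[𝕜] Lp F 2 (volume : Measure X) :=
  Lp.compMeasurePreservingₗᵢ 𝕜 (fun x => x + a) (measurePreserving_add_right volume a)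

variable [NormedSpace ℂ F]

theorem coeFn_translate (a : X) (Ψ : Lp F 2 (volume : Measure X)) :
    translate ℂ a Ψ =ᵐ[volume] fun x => Ψ (x + a) :=
  Lp.coeFn_compMeasurePreserving Ψ (measurePreserving_add_right volume a)

theorem translate_zero (Ψ : Lp F 2 (volume : Measure X)) : translate ℂ (0 : X) Ψ = Ψ := by
  ext1
  filter_upwards [coeFn_translate (0 : X) Ψ] with x hx
  rw [hx, add_zero]

theorem translate_translate (a b : X) (Ψ : Lp F 2 (volume : Measure X)) :
    translate ℂ a (translate ℂ b Ψ) = translate ℂ (a + b) Ψ := by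
  ext1
  have h := (measurePreserving_add_right volume a).quasiMeasurePreserving.ae (coeFn_translate b Ψ)
  filter_upwards [coeFn_translate a (translate ℂ b Ψ), coeFn_translate (a + b) Ψ, h] with x h1 h2 h3
  rw [h1, h2, h3, add_assoc]

/-- Strong continuity of the translation group; it makes the integral of s ↦ τ_{sv}Φ differentiable
in t. -/
theorem continuous_translate (Ψ : Lp F 2 (volume : Measure X)) :
    Continuous fun a : X => translate ℂ a Ψ := by
  have hf : Continuous fun _ : X => Ψ := continuous_const
  let g : C(X, C(X, X)) := (ContinuousMap.mk (fun a : X × X => a.2 + a.1) (by fun_prop)).curry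
  exact hf.compMeasurePreservingLp g.continuous (fun a => measurePreserving_add_right volume a)
    (by simp)

/-- `Φ` is the derivative at `0` of `t ↦ Ψ(· + t v)` in `L²`. -/
def HasTranslationDeriv (v : X) (Ψ Φ : Lp F 2 (volume : Measure X)) : Prop :=
  HasDerivAt (fun t : ℝ => translate ℂ (t • v) Ψ) Φ 0

theorem HasTranslationDeriv.clm {v : X} {Ψ Φ : Lp F 2 (volume : Measure X)}
    (T : Lp F 2 (volume : Measure X) →L[ℂ] Lp F 2 (volume : Measure X))
    (hT : ∀ a Ψ, translate ℂ a (T Ψ) = T (translate ℂ a Ψ))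
    (h : HasTranslationDeriv v Ψ Φ) : HasTranslationDeriv v (T Ψ) (T Φ) := by
  unfold HasTranslationDeriv
  simp only [hT]
  exact (T.restrictScalars ℝ).hasFDerivAt.comp_hasDerivAt 0 h

/-- Product rule for an operator whose conjugates by translations are norm differentiable. -/
theorem HasTranslationDeriv.clm_apply {v : X} {Ψ Φ : Lp F 2 (volume : Measure X)}
    {T : ℝ → Lp F 2 (volume : Measure X) →L[ℂ] Lp F 2 (volume : Measure X)}
    {T' : Lp F 2 (volume : Measure X) →L[ℂ] Lp F 2 (volume : Measure X)}
    (hT : ∀ (t : ℝ) Ψ, translate ℂ (t • v) (T 0 Ψ) = T t (translate ℂ (t • v) Ψ))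
    (hT' : HasDerivAt T T' 0)
    (h : HasTranslationDeriv v Ψ Φ) : HasTranslationDeriv v (T 0 Ψ) (T' Ψ + T 0 Φ) := by
  unfold HasTranslationDeriv
  simp only [hT]
  have := hasDerivAt_clm_apply hT' h
  rwa [zero_smul, translate_zero] at this

theorem toDist_apply [CompleteSpace F] (Ψ : Lp F 2 (volume : Measure X)) (g : 𝓢(X, ℂ)) :
    toDist Ψ g = ∫ x, g x • Ψ x := by
  simp [toDist]

theorem toDist_translate [CompleteSpace F] (a : X) (Ψ : Lp F 2 (volume : Measure X))
    (g : 𝓢(X, ℂ)) :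
    toDist (translate ℂ a Ψ) g = toDist Ψ (g.compSubConstCLM ℂ a) := by
  rw [toDist_apply, toDist_apply]
  have h1 : ∫ x, g x • (translate ℂ a Ψ) x = ∫ x, g x • Ψ (x + a) := by
    refine integral_congr_ae ?_
    filter_upwards [coeFn_translate a Ψ] with x hx
    rw [hx]
  rw [h1, ← integral_add_right_eq_self (fun x => (g.compSubConstCLM ℂ a) x • Ψ x) a]
  simp

/-- Evaluation of `L²` functions at a Schwartz function. -/
def toDistEval [CompleteSpace F] (g : 𝓢(X, ℂ)) : Lp F 2 (volume : Measure X) →L[ℝ] F :=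
  ((PointwiseConvergenceCLM.evalCLM (RingHom.id ℂ) F g).comp
    (Lp.toTemperedDistributionCLM F (volume : Measure X) 2)).restrictScalars ℝ

theorem toDistEval_apply [CompleteSpace F] (g : 𝓢(X, ℂ)) (Ψ : Lp F 2 (volume : Measure X)) :
    toDistEval g Ψ = toDist Ψ g := rfl

theorem continuous_toDist [CompleteSpace F] (g : 𝓢(X, ℂ)) :
    Continuous fun Ψ : Lp F 2 (volume : Measure X) => toDist Ψ g := by
  exact (toDistEval g).continuous

/-- Move the translation onto the test function and differentiate under the integral. No
differentiability of Ψ is needed, since the pairing with a Schwartz function is smooth along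
translations. -/
theorem hasDerivAt_toDist_translate [CompleteSpace F] (v : X) (Ψ : Lp F 2 (volume : Measure X))
    (g : 𝓢(X, ℂ)) :
    HasDerivAt (fun t : ℝ => toDist (translate ℂ (t • v) Ψ) g) (-toDist Ψ (∂_{v} g)) 0 := by
  -- A decay order exceeding the dimension makes (1 + ‖x‖)^{-k} integrable.
  set k : ℕ := Module.finrank ℝ X + 1 with hk
  obtain ⟨C, hC⟩ : ∃ C : ℝ, ∀ x, (1 + ‖x‖) ^ k * ‖(∂_{v} g : 𝓢(X, ℂ)) x‖ ≤ C := by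
    refine ⟨2 ^ k * (Finset.Iic (k, 0)).sup (fun m => SchwartzMap.seminorm ℂ m.1 m.2)
      (∂_{v} g : 𝓢(X, ℂ)), fun x => ?_⟩
    have := SchwartzMap.one_add_le_sup_seminorm_apply (𝕜 := ℂ) (m := (k, 0)) le_rfl le_rfl
      (∂_{v} g : 𝓢(X, ℂ)) x
    rwa [norm_iteratedFDeriv_zero] at this
  have hΨ := Lp.memLp Ψ
  have hline : ∀ (x : X) (t : ℝ),
      HasDerivAt (fun s : ℝ => g (x - s • v)) (-(∂_{v} g : 𝓢(X, ℂ)) (x - t • v)) t := by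
    intro x t
    have h1 : HasDerivAt (fun s : ℝ => x - s • v) (-v) t := by
      simpa using ((hasDerivAt_id t).smul_const v).const_sub x
    have h2 := (g.differentiableAt (x := x - t • v)).hasFDerivAt.comp_hasDerivAt t h1
    rw [map_neg, ← SchwartzMap.lineDerivOp_apply_eq_fderiv] at h2
    exact h2
  have hInt : ∀ t : ℝ, Integrable fun x => g (x - t • v) • Ψ x := by
    intro t
    have hg : MemLp (fun x => g (x - t • v)) 2 (volume : Measure X) :=
      (g.compSubConstCLM ℂ (t • v)).memLp 2 volume
    exact memLp_one_iff_integrable.1 (hΨ.smul hg)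
  have key := hasDerivAt_integral_of_dominated_loc_of_deriv_le (μ := (volume : Measure X))
    (F := fun (t : ℝ) x => g (x - t • v) • Ψ x)
    (F' := fun t x => (-(∂_{v} g : 𝓢(X, ℂ)) (x - t • v)) • Ψ x) (x₀ := (0 : ℝ))
    (s := Metric.ball 0 1)
    (bound := fun x => (C * (1 + ‖v‖) ^ k) * ((1 + ‖x‖) ^ (-(k : ℝ)) + ‖Ψ x‖ ^ 2))
    (Metric.ball_mem_nhds 0 one_pos) (Eventually.of_forall fun t => (hInt t).aestronglyMeasurable)
    (hInt 0) ?_ ?_ ?_ ?_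
  · have h0 := key.2
    have e1 : (fun t : ℝ => toDist (translate ℂ (t • v) Ψ) g) =
        fun t : ℝ => ∫ x, g (x - t • v) • Ψ x := by
      funext t
      rw [toDist_translate, toDist_apply]
      rfl
    have e2 : -toDist Ψ (∂_{v} g) =
        ∫ x, (-(∂_{v} g : 𝓢(X, ℂ)) (x - (0 : ℝ) • v)) • Ψ x := by
      rw [toDist_apply, ← integral_neg]
      simp
    rwa [e1, e2]
  · simp only [zero_smul, sub_zero]
    exact ((∂_{v} g : 𝓢(X, ℂ)).continuous.neg.aestronglyMeasurable).smul hΨ.1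
  · refine Eventually.of_forall fun x t ht => ?_
    have ht1 : |t| ≤ 1 := by simpa using (mem_ball_zero_iff.1 ht).le
    -- Peetre's inequality turns the decay centred at tv into decay centred at 0, uniformly for |t|
    -- ≤ 1.
    have hx : 1 + ‖x‖ ≤ (1 + ‖x - t • v‖) * (1 + ‖v‖) := by
      have h1 : ‖x‖ ≤ ‖x - t • v‖ + ‖t • v‖ := by
        simpa using norm_add_le (x - t • v) (t • v)
      have h2 : ‖t • v‖ ≤ ‖v‖ := by
        rw [norm_smul, Real.norm_eq_abs]
        nlinarith [norm_nonneg v]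
      nlinarith [norm_nonneg v, norm_nonneg (x - t • v)]
    have hxk : 0 < (1 + ‖x‖) ^ k := by positivity
    have hC' : (1 + ‖x‖) ^ k * ‖(∂_{v} g : 𝓢(X, ℂ)) (x - t • v)‖ ≤ C * (1 + ‖v‖) ^ k := by
      calc _ ≤ ((1 + ‖x - t • v‖) * (1 + ‖v‖)) ^ k * ‖(∂_{v} g : 𝓢(X, ℂ)) (x - t • v)‖ := by
            gcongr
        _ = (1 + ‖x - t • v‖) ^ k * ‖(∂_{v} g : 𝓢(X, ℂ)) (x - t • v)‖ * (1 + ‖v‖) ^ k := by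
          rw [mul_pow]; ring
        _ ≤ _ := by gcongr; exact hC _
    have hCv : 0 ≤ C * (1 + ‖v‖) ^ k := le_trans (by positivity) hC'
    rw [norm_smul, norm_neg, Real.rpow_neg (by positivity), Real.rpow_natCast]
    set w := ((1 + ‖x‖) ^ k)⁻¹ with hw
    have hw0 : 0 ≤ w := by positivity
    have hw1 : w ≤ 1 := inv_le_one_of_one_le₀ (one_le_pow₀ (by linarith [norm_nonneg x]))
    have hb : ‖(∂_{v} g : 𝓢(X, ℂ)) (x - t • v)‖ ≤ C * (1 + ‖v‖) ^ k * w := by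
      rw [hw, ← div_eq_mul_inv, le_div_iff₀ hxk, mul_comm]
      exact hC'
    -- As 0 ≤ w ≤ 1, the product w‖Ψ‖ is at most w + ‖Ψ‖², an integrable function.
    calc _ ≤ C * (1 + ‖v‖) ^ k * w * ‖Ψ x‖ := by gcongr
      _ = C * (1 + ‖v‖) ^ k * (w * ‖Ψ x‖) := by ring
      _ ≤ _ := by
        gcongr
        nlinarith [sq_nonneg (w - ‖Ψ x‖), sq_nonneg (w + ‖Ψ x‖)]
  · refine Integrable.const_mul (Integrable.add ?_ ?_) _
    · exact integrable_one_add_norm (by rw [hk]; push_cast; linarith)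
    · exact hΨ.integrable_norm_pow (by norm_num)
  · refine Eventually.of_forall fun x t _ => ?_
    exact (hline x t).smul_const (Ψ x)

/-- Strong and weak derivatives agree in L². The weak statement propagates along the translation
group, so τ_{tv}Ψ and Ψ + ∫₀ᵗ τ_{sv}Φ ds have the same distributional derivative in t. They
therefore coincide, and the fundamental theorem of calculus applies to the continuous integrand. -/
theorem hasTranslationDeriv_iff [CompleteSpace F] {v : X} {Ψ Φ : Lp F 2 (volume : Measure X)} :
    HasTranslationDeriv v Ψ Φ ↔ ∀ g : 𝓢(X, ℂ), toDist Φ g = -toDist Ψ (∂_{v} g) := by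
  constructor
  · intro h g
    have h1 : HasDerivAt (fun t : ℝ => toDist (translate ℂ (t • v) Ψ) g) (toDist Φ g) 0 :=
      (toDistEval g).hasFDerivAt.comp_hasDerivAt (f := fun t : ℝ => translate ℂ (t • v) Ψ) 0 h
    exact h1.unique (hasDerivAt_toDist_translate v Ψ g)
  · intro h
    have hcont : Continuous fun t : ℝ => translate ℂ (t • v) Φ :=
      (continuous_translate Φ).comp (by fun_prop)
    have hW : ∀ t, HasDerivAt (fun t : ℝ => ∫ s in (0 : ℝ)..t, translate ℂ (s • v) Φ)
        (translate ℂ (t • v) Φ) t := fun t => hcont.integral_hasStrictDerivAt 0 t |>.hasDerivAt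
    have hweak : ∀ (t : ℝ) (g : 𝓢(X, ℂ)),
        toDist (translate ℂ (t • v) Φ) g = -toDist (translate ℂ (t • v) Ψ) (∂_{v} g) := by
      intro t g
      rw [toDist_translate, toDist_translate, h, lineDerivOp_compSubConstCLM]
    have hderiv : ∀ (t : ℝ) (g : 𝓢(X, ℂ)),
        HasDerivAt (fun t : ℝ => toDist (translate ℂ (t • v) Ψ) g)
          (toDist (translate ℂ (t • v) Φ) g) t := by
      intro t g
      -- The derivative at 0 for the translated function becomes the derivative at t by the group
      -- law.
      have h1 := hasDerivAt_toDist_translate v (translate ℂ (t • v) Ψ) g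
      rw [← hweak, ← sub_self t] at h1
      have h2 := h1.comp_sub_const t t
      simpa [translate_translate, ← add_smul] using h2
    -- Tested against each Schwartz function, the difference of both sides has zero derivative and
    -- vanishes at t = 0. Injectivity of the embedding into distributions does the rest.
    have hconst : ∀ t : ℝ, translate ℂ (t • v) Ψ =
        (∫ s in (0 : ℝ)..t, translate ℂ (s • v) Φ) + Ψ := by
      intro t
      apply toDist_injective
      ext g
      have h1 : ∀ t, HasDerivAt (fun t : ℝ => toDist (translate ℂ (t • v) Ψ) g -
          toDistEval g (∫ s in (0 : ℝ)..t, translate ℂ (s • v) Φ)) 0 t := by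
        intro t
        have := (hderiv t g).sub ((toDistEval g).hasFDerivAt.comp_hasDerivAt t (hW t))
        rwa [toDistEval_apply, sub_self] at this
      have h2 := is_const_of_deriv_eq_zero (fun t => (h1 t).differentiableAt)
        (fun t => (h1 t).deriv) t 0
      simp only [zero_smul, translate_zero, intervalIntegral.integral_same, map_zero,
        sub_zero] at h2
      rw [map_add]
      change _ = toDist (∫ s in (0 : ℝ)..t, translate ℂ (s • v) Φ) g + toDist Ψ g
      rw [← h2, toDistEval_apply]
      abel
    have h3 := (hW 0).add_const Ψ
    unfold HasTranslationDeriv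
    simp only [hconst]
    rwa [zero_smul, translate_zero] at h3

theorem mem_weakDerivGraph_iff [CompleteSpace F] {ħ : ℝ} (hħ : ħ ≠ 0) {v : X}
    {Ψ Φ : Lp F 2 (volume : Measure X)} :
    (Ψ, Φ) ∈ weakDerivGraph F ħ v ↔
      ∃ Φ', HasTranslationDeriv v Ψ Φ' ∧ Φ = (-Complex.I * ħ : ℂ) • Φ' := by
  have hc : (-Complex.I * ħ : ℂ) ≠ 0 := by simp [hħ]
  have key : ∀ Φ', HasTranslationDeriv v Ψ Φ' ↔ toDist Φ' = ∂_{v} (toDist Ψ) := by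
    intro Φ'
    rw [hasTranslationDeriv_iff]
    constructor
    · intro h
      ext g
      rw [h, TemperedDistribution.lineDerivOp_apply_apply, map_neg]
    · intro h g
      rw [h, TemperedDistribution.lineDerivOp_apply_apply, map_neg]
  change toDist Φ = (-Complex.I * ħ : ℂ) • ∂_{v} (toDist Ψ) ↔ _
  constructor
  · intro h
    refine ⟨(-Complex.I * ħ : ℂ)⁻¹ • Φ, (key _).2 ?_, ?_⟩
    · rw [map_smul, h, smul_smul, inv_mul_cancel₀ hc, one_smul]
    · rw [smul_smul, mul_inv_cancel₀ hc, one_smul]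
  · rintro ⟨Φ', h, rfl⟩
    rw [map_smul, (key _).1 h]

/-- Closedness of the derivative: the weak formulation involves only pairings that are continuous in
L². -/
theorem HasTranslationDeriv.of_tendsto [CompleteSpace F] {v : X}
    {Ψ Φ : ℕ → Lp F 2 (volume : Measure X)} {Ψ₀ Φ₀ : Lp F 2 (volume : Measure X)}
    (h : ∀ k, HasTranslationDeriv v (Ψ k) (Φ k)) (hΨ : Tendsto Ψ atTop (𝓝 Ψ₀))
    (hΦ : Tendsto Φ atTop (𝓝 Φ₀)) : HasTranslationDeriv v Ψ₀ Φ₀ := by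
  rw [hasTranslationDeriv_iff]
  intro g
  refine tendsto_nhds_unique (((continuous_toDist g).tendsto Φ₀).comp hΦ) ?_
  refine Tendsto.congr (fun k => (hasTranslationDeriv_iff.1 (h k) g).symm) ?_
  exact (((continuous_toDist _).tendsto Ψ₀).comp hΨ).neg

end Translation

/-! ### Skew-symmetry of the translation derivative. -/

section TranslationInner

variable {X F : Type*} [NormedAddCommGroup X] [InnerProductSpace ℝ X] [FiniteDimensional ℝ X]
  [MeasurableSpace X] [BorelSpace X]
  [NormedAddCommGroup F] [InnerProductSpace ℂ F]

/-- Translations are isometric, so t ↦ ⟨τ_{tv}Ψ, τ_{tv}Φ⟩ is constant; its derivative at 0 is the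
integration by parts formula. -/
theorem HasTranslationDeriv.inner_eq {v : X} {Ψ Ψ' Φ Φ' : Lp F 2 (volume : Measure X)}
    (h : HasTranslationDeriv v Ψ Ψ') (h' : HasTranslationDeriv v Φ Φ') :
    inner ℂ Ψ' Φ = -inner ℂ Ψ Φ' := by
  have h1 := HasDerivAt.inner ℂ h h'
  simp only [LinearIsometry.inner_map_map, zero_smul, translate_zero] at h1
  have := h1.unique (hasDerivAt_const (0 : ℝ) (inner ℂ Ψ Φ))
  linear_combination this

end TranslationInner

/-! ### Sectors of Fock space -/

section FockSpace

variable {d : ℕ}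

theorem Fock.ext_comp {Ψ Φ : Fock d}
    (h : ∀ N, comp Ψ N =ᵐ[photonMeasure d N] comp Φ N) : Ψ = Φ := by
  ext1
  funext N
  exact Subtype.ext (Lp.ext (h N))

theorem comp_sub (Ψ Φ : Fock d) (N : ℕ) :
    comp (Ψ - Φ) N =ᵐ[photonMeasure d N] comp Ψ N - comp Φ N :=
  Lp.coeFn_sub _ _

theorem stronglyMeasurable_comp (Ψ : Fock d) (N : ℕ) : StronglyMeasurable (comp Ψ N) :=
  Lp.stronglyMeasurable _

theorem measurable_comp (Ψ : Fock d) (N : ℕ) : Measurable (comp Ψ N) :=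
  (stronglyMeasurable_comp Ψ N).measurable

theorem comp_perm (Ψ : Fock d) (N : ℕ) (σ : Equiv.Perm (Fin N)) :
    (fun K => comp Ψ N (fun j => K (σ j))) =ᵐ[photonMeasure d N] comp Ψ N := by
  have h : ((Ψ N : symL2 d N) : Lp ℂ 2 (photonMeasure d N)) ∈ symL2 d N := (Ψ N).2
  have h1 := LinearMap.mem_eqLocus.1 ((Submodule.mem_iInf _).1 h σ)
  have h2 := Lp.coeFn_compMeasurePreserving ((Ψ N : symL2 d N) : Lp ℂ 2 (photonMeasure d N))
    (measurePreserving_perm d N σ)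
  refine h2.symm.trans ?_
  exact Filter.EventuallyEq.of_eq (congrArg (fun f : Lp ℂ 2 (photonMeasure d N) =>
    (f : (Fin N → Mode d) → ℂ)) h1)

theorem Lp_enorm_sq {α F : Type*} [MeasurableSpace α] {μ : Measure α} [NormedAddCommGroup F]
    (f : Lp F 2 μ) : ‖f‖ₑ ^ 2 = ∫⁻ x, ‖f x‖ₑ ^ 2 ∂μ := by
  rw [Lp.enorm_def, eLpNorm_eq_lintegral_rpow_enorm_toReal (by norm_num) (by norm_num),
    ← ENNReal.rpow_natCast, ← ENNReal.rpow_mul]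
  norm_num

theorem enorm_sq_eq_tsum (Ψ : Fock d) :
    ‖Ψ‖ₑ ^ 2 = ∑' N, ∫⁻ K, ‖comp Ψ N K‖ₑ ^ 2 ∂photonMeasure d N := by
  have h := lp.hasSum_norm (p := 2) (by norm_num) Ψ
  simp only [ENNReal.toReal_ofNat, Real.rpow_ofNat] at h
  have h1 : ‖Ψ‖ₑ ^ 2 = ENNReal.ofReal (‖Ψ‖ ^ 2) := by
    rw [← ofReal_norm, ENNReal.ofReal_pow (norm_nonneg _)]
  rw [h1, ← h.tsum_eq, ENNReal.ofReal_tsum_of_nonneg (fun _ => sq_nonneg _) h.summable]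
  refine tsum_congr fun N => ?_
  rw [ENNReal.ofReal_pow (norm_nonneg _), ofReal_norm]
  exact Lp_enorm_sq ((Ψ N : symL2 d N) : Lp ℂ 2 (photonMeasure d N))

/-- A Fock space vector is given by square summable, permutation invariant sector functions. -/
theorem exists_fock {u : ∀ N, (Fin N → Mode d) → ℂ}
    (hm : ∀ N, AEStronglyMeasurable (u N) (photonMeasure d N))
    (hs : ∀ N (σ : Equiv.Perm (Fin N)),
      (fun K => u N (fun j => K (σ j))) =ᵐ[photonMeasure d N] u N)
    (hu : ∑' N, ∫⁻ K, ‖u N K‖ₑ ^ 2 ∂photonMeasure d N ≠ ∞) :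
    ∃ Φ : Fock d, ∀ N, comp Φ N =ᵐ[photonMeasure d N] u N := by
  have h1 : ∀ N, ∫⁻ K, ‖u N K‖ₑ ^ 2 ∂photonMeasure d N ≠ ∞ := ENNReal.ne_top_of_tsum_ne_top hu
  have hL : ∀ N, MemLp (u N) 2 (photonMeasure d N) := by
    intro N
    refine ⟨hm N, ?_⟩
    rw [eLpNorm_lt_top_iff_lintegral_rpow_enorm_lt_top (by norm_num) (by norm_num)]
    simpa using (h1 N).lt_top
  have hsym : ∀ N, (hL N).toLp ∈ symL2 d N := by
    intro N
    rw [symL2, Submodule.mem_iInf]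
    intro σ
    rw [LinearMap.mem_eqLocus]
    change Lp.compMeasurePreserving _ (measurePreserving_perm d N σ) ((hL N).toLp) = (hL N).toLp
    rw [Lp.toLp_compMeasurePreserving (hL N) (measurePreserving_perm d N σ)]
    exact MemLp.toLp_congr _ _ (hs N σ)
  have hnorm : ∀ N, ‖(⟨(hL N).toLp, hsym N⟩ : symL2 d N)‖ ^ 2 =
      (∫⁻ K, ‖u N K‖ₑ ^ 2 ∂photonMeasure d N).toReal := by
    intro N
    have h2 := Lp_enorm_sq ((hL N).toLp)
    have h3 : ∫⁻ K, ‖(hL N).toLp (u N) K‖ₑ ^ 2 ∂photonMeasure d N =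
        ∫⁻ K, ‖u N K‖ₑ ^ 2 ∂photonMeasure d N := by
      refine lintegral_congr_ae ?_
      filter_upwards [(hL N).coeFn_toLp] with K hK
      rw [hK]
    rw [← h3, ← h2, ENNReal.toReal_pow, toReal_enorm]
    rfl
  refine ⟨⟨fun N => ⟨(hL N).toLp, hsym N⟩, memℓp_gen ?_⟩, fun N => (hL N).coeFn_toLp⟩
  simp only [ENNReal.toReal_ofNat, Real.rpow_ofNat]
  simp only [hnorm]
  exact ENNReal.summable_toReal hu

theorem inner_eq_tsum_integral (Φ Ψ : Fock d) :
    inner ℂ Φ Ψ = ∑' N, ∫ K, inner ℂ (comp Φ N K) (comp Ψ N K) ∂photonMeasure d N :=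
  tsum_congr fun N => L2.inner_def
    ((Φ N : symL2 d N) : Lp ℂ 2 (photonMeasure d N))
    ((Ψ N : symL2 d N) : Lp ℂ 2 (photonMeasure d N))

theorem summable_integral_inner (Φ Ψ : Fock d) :
    Summable fun N => ∫ K, inner ℂ (comp Φ N K) (comp Ψ N K) ∂photonMeasure d N := by
  refine (lp.summable_inner (𝕜 := ℂ) Φ Ψ).congr fun N => ?_
  exact (L2.inner_def ((Φ N : symL2 d N) : Lp ℂ 2 (photonMeasure d N))
    ((Ψ N : symL2 d N) : Lp ℂ 2 (photonMeasure d N)))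

/-! ### Functions of the field energy -/

/-- The field energy `ħ (|k_1| + ⋯ + |k_N|)` of a photon configuration. -/
def photonEnergy (ħ : ℝ) {N : ℕ} (K : Fin N → Mode d) : ℝ := ħ * ∑ j, ‖(K j).1‖

theorem photonEnergy_nonneg {ħ : ℝ} (hħ : 0 ≤ ħ) {N : ℕ} (K : Fin N → Mode d) :
    0 ≤ photonEnergy ħ K :=
  mul_nonneg hħ (Finset.sum_nonneg fun _ _ => norm_nonneg _)

theorem measurable_photonEnergy (ħ : ℝ) (N : ℕ) :
    Measurable (photonEnergy ħ : (Fin N → Mode d) → ℝ) := by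
  unfold photonEnergy
  fun_prop

theorem photonEnergy_perm (ħ : ℝ) {N : ℕ} (K : Fin N → Mode d) (σ : Equiv.Perm (Fin N)) :
    photonEnergy ħ (fun j => K (σ j)) = photonEnergy ħ K := by
  unfold photonEnergy
  rw [Equiv.sum_comp σ fun j => ‖(K j).1‖]

theorem photonEnergy_insertNth (ħ : ℝ) {N : ℕ} (j : Fin (N + 1)) (κ : Mode d)
    (K : Fin N → Mode d) :
    photonEnergy ħ (j.insertNth κ K : Fin (N + 1) → Mode d) = ħ * ‖κ.1‖ + photonEnergy ħ K := by
  unfold photonEnergy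
  rw [Fin.sum_univ_succAbove _ j]
  simp [mul_add]

theorem photonEnergy_cons (ħ : ℝ) {N : ℕ} (κ : Mode d) (K : Fin N → Mode d) :
    photonEnergy ħ (Fin.cons κ K : Fin (N + 1) → Mode d) = ħ * ‖κ.1‖ + photonEnergy ħ K := by
  rw [← Fin.insertNth_zero', photonEnergy_insertNth]

theorem photonEnergy_removeNth (ħ : ℝ) {N : ℕ} (j : Fin (N + 1)) (K : Fin (N + 1) → Mode d) :
    photonEnergy ħ K = ħ * ‖(K j).1‖ + photonEnergy ħ (j.removeNth K) := by
  conv_lhs => rw [← Fin.insertNth_self_removeNth j K]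
  rw [photonEnergy_insertNth]

/-- The quadratic form of `w(H_f)`, on families of sector functions. -/
def sectorForm (ħ : ℝ) (w : ℝ → ℝ≥0∞) (v : ∀ N, (Fin N → Mode d) → ℝ≥0∞) : ℝ≥0∞ :=
  ∑' N, ∫⁻ K, w (photonEnergy ħ K) * v N K ^ 2 ∂photonMeasure d N

/-- The quadratic form of `w(H_f)`. -/
def energyForm (ħ : ℝ) (w : ℝ → ℝ≥0∞) (Ψ : Fock d) : ℝ≥0∞ :=
  sectorForm ħ w fun N K => ‖comp Ψ N K‖ₑ

theorem energyForm_one (ħ : ℝ) (Ψ : Fock d) : energyForm ħ (fun _ => 1) Ψ = ‖Ψ‖ₑ ^ 2 := by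
  simp [energyForm, sectorForm, enorm_sq_eq_tsum]

theorem energyForm_mono {ħ : ℝ} (hħ : 0 ≤ ħ) {w w' : ℝ → ℝ≥0∞} (h : ∀ e, 0 ≤ e → w e ≤ w' e)
    (Ψ : Fock d) : energyForm ħ w Ψ ≤ energyForm ħ w' Ψ := by
  refine ENNReal.tsum_le_tsum fun N => lintegral_mono fun K => ?_
  gcongr
  exact h _ (photonEnergy_nonneg hħ K)

theorem enorm_ofReal_complex (r : ℝ) : ‖(r : ℂ)‖ₑ = ‖r‖ₑ := by
  rw [← ofReal_norm, Complex.norm_real, ofReal_norm]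

/-- Existence of `g(H_f) Ψ`. -/
theorem exists_energy_mul {ħ : ℝ} {g : ℝ → ℝ} (hg : Measurable g)
    {Ψ : Fock d} (h : energyForm ħ (fun e => ‖g e‖ₑ ^ 2) Ψ ≠ ∞) :
    ∃ Φ : Fock d, ∀ N, comp Φ N =ᵐ[photonMeasure d N]
      fun K => (g (photonEnergy ħ K) : ℂ) * comp Ψ N K := by
  refine exists_fock (fun N => ?_) (fun N σ => ?_) ?_
  · exact ((Complex.measurable_ofReal.comp (hg.comp (measurable_photonEnergy ħ N))).mul
      (measurable_comp Ψ N)).aestronglyMeasurable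
  · filter_upwards [comp_perm Ψ N σ] with K hK
    rw [photonEnergy_perm, hK]
  · refine ne_of_eq_of_ne (tsum_congr fun N => lintegral_congr fun K => ?_) h
    rw [enorm_mul, mul_pow, enorm_ofReal_complex]

theorem energyForm_of_comp_eq {ħ : ℝ} {g : ℝ → ℝ} {Ψ Φ : Fock d}
    (h : ∀ N, comp Φ N =ᵐ[photonMeasure d N]
      fun K => (g (photonEnergy ħ K) : ℂ) * comp Ψ N K) (w : ℝ → ℝ≥0∞) :
    energyForm ħ w Φ = energyForm ħ (fun e => w e * ‖g e‖ₑ ^ 2) Ψ := by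
  refine tsum_congr fun N => lintegral_congr_ae ?_
  filter_upwards [h N] with K hK
  rw [hK, enorm_mul, mul_pow, enorm_ofReal_complex, mul_assoc]

theorem enorm_le_of_sq_le {E : Type*} [NormedAddCommGroup E] {x : E} {C : ℝ} (hC : 0 ≤ C)
    (h : ‖x‖ₑ ^ 2 ≤ ENNReal.ofReal (C ^ 2)) : ‖x‖ ≤ C := by
  rw [← ofReal_norm, ← ENNReal.ofReal_pow (norm_nonneg _),
    ENNReal.ofReal_le_ofReal_iff (sq_nonneg _)] at h
  exact abs_le_of_sq_le_sq' h hC |>.2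

theorem exists_energyOp {ħ : ℝ} (hħ : 0 ≤ ħ) {g : ℝ → ℝ} (hg : Measurable g) {C : ℝ}
    (hC : ∀ e, 0 ≤ e → |g e| ≤ C) :
    ∃ T : Fock d →L[ℂ] Fock d, (∀ Ψ N, comp (T Ψ) N =ᵐ[photonMeasure d N]
      fun K => (g (photonEnergy ħ K) : ℂ) * comp Ψ N K) ∧ ‖T‖ ≤ C := by
  have hC0 : 0 ≤ C := (abs_nonneg _).trans (hC 0 le_rfl)
  have hle : ∀ Ψ : Fock d, energyForm ħ (fun e => ‖g e‖ₑ ^ 2) Ψ ≤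
      ENNReal.ofReal ((C * ‖Ψ‖) ^ 2) := by
    intro Ψ
    refine (energyForm_mono hħ (w' := fun _ => ENNReal.ofReal (C ^ 2)) (fun e he => ?_) Ψ).trans ?_
    · rw [← ofReal_norm, ← ENNReal.ofReal_pow (norm_nonneg _)]
      exact ENNReal.ofReal_le_ofReal (pow_le_pow_left₀ (norm_nonneg _) (hC e he) 2)
    · have : energyForm ħ (fun _ => ENNReal.ofReal (C ^ 2)) Ψ =
          ENNReal.ofReal (C ^ 2) * ‖Ψ‖ₑ ^ 2 := by
        rw [enorm_sq_eq_tsum, ← ENNReal.tsum_mul_left]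
        refine tsum_congr fun N => ?_
        rw [lintegral_const_mul _ ((measurable_comp Ψ N).enorm.pow_const 2)]
      rw [this, mul_pow, ENNReal.ofReal_mul (sq_nonneg _), ENNReal.ofReal_pow (norm_nonneg _),
        ofReal_norm]
  choose T hT using fun Ψ : Fock d =>
    exists_energy_mul hg ((hle Ψ).trans_lt ENNReal.ofReal_lt_top).ne
  have hadd : ∀ Ψ Φ, T (Ψ + Φ) = T Ψ + T Φ := by
    intro Ψ Φ
    refine Fock.ext_comp fun N => ?_
    filter_upwards [hT (Ψ + Φ) N, hT Ψ N, hT Φ N, comp_add Ψ Φ N, comp_add (T Ψ) (T Φ) N]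
      with K h1 h2 h3 h4 h5
    rw [h1, h5, h4, Pi.add_apply, Pi.add_apply, h2, h3, mul_add]
  have hsmul : ∀ (c : ℂ) Ψ, T (c • Ψ) = c • T Ψ := by
    intro c Ψ
    refine Fock.ext_comp fun N => ?_
    filter_upwards [hT (c • Ψ) N, hT Ψ N, comp_smul c Ψ N, comp_smul c (T Ψ) N]
      with K h1 h2 h4 h5
    rw [h1, h5, h4, Pi.smul_apply, Pi.smul_apply, h2, smul_eq_mul, smul_eq_mul]
    ring
  have hbound : ∀ Ψ, ‖T Ψ‖ ≤ C * ‖Ψ‖ := by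
    intro Ψ
    refine enorm_le_of_sq_le (by positivity) ?_
    rw [← energyForm_one ħ, energyForm_of_comp_eq (hT Ψ)]
    simpa using hle Ψ
  exact ⟨LinearMap.mkContinuous ⟨⟨T, hadd⟩, hsmul⟩ C hbound, hT,
    LinearMap.mkContinuous_norm_le _ hC0 _⟩

open Classical in
/-- The bounded operator `g(H_f)` for a bounded function `g`. -/
def energyOp (d : ℕ) (ħ : ℝ) (g : ℝ → ℝ) : Fock d →L[ℂ] Fock d :=
  if h : ∃ T : Fock d →L[ℂ] Fock d, ∀ Ψ N, comp (T Ψ) N =ᵐ[photonMeasure d N]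
      fun K => (g (photonEnergy ħ K) : ℂ) * comp Ψ N K then h.choose else 0

/-- `g` is measurable, and bounded by `C` on the nonnegative half line. -/
structure IsBoundedEnergyFun (g : ℝ → ℝ) (C : ℝ) : Prop where
  measurable : Measurable g
  bound : ∀ e, 0 ≤ e → |g e| ≤ C

variable {ħ : ℝ} {g h : ℝ → ℝ} {C C' : ℝ}

theorem comp_energyOp (hħ : 0 ≤ ħ) (hg : IsBoundedEnergyFun g C) (Ψ : Fock d) (N : ℕ) :
    comp (energyOp d ħ g Ψ) N =ᵐ[photonMeasure d N]
      fun K => (g (photonEnergy ħ K) : ℂ) * comp Ψ N K := by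
  obtain ⟨T, hT, -⟩ := exists_energyOp (d := d) hħ hg.measurable hg.bound
  have hex : ∃ T : Fock d →L[ℂ] Fock d, ∀ Ψ N, comp (T Ψ) N =ᵐ[photonMeasure d N]
      fun K => (g (photonEnergy ħ K) : ℂ) * comp Ψ N K := ⟨T, hT⟩
  rw [energyOp, dif_pos hex]
  exact hex.choose_spec Ψ N

theorem energyOp_eq (hħ : 0 ≤ ħ) (hg : IsBoundedEnergyFun g C) {Ψ Φ : Fock d}
    (hΦ : ∀ N, comp Φ N =ᵐ[photonMeasure d N]
      fun K => (g (photonEnergy ħ K) : ℂ) * comp Ψ N K) : energyOp d ħ g Ψ = Φ :=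
  Fock.ext_comp fun N => (comp_energyOp hħ hg Ψ N).trans (hΦ N).symm

theorem norm_energyOp_le (hħ : 0 ≤ ħ) (hg : IsBoundedEnergyFun g C) :
    ‖energyOp d ħ g‖ ≤ C := by
  obtain ⟨T, hT, hTC⟩ := exists_energyOp (d := d) hħ hg.measurable hg.bound
  have : energyOp d ħ g = T := by
    ext1 Ψ
    exact energyOp_eq hħ hg (hT Ψ)
  rwa [this]

theorem energyOp_energyOp (hħ : 0 ≤ ħ) (hg : IsBoundedEnergyFun g C)
    (hh : IsBoundedEnergyFun h C') {k : ℝ → ℝ} {C'' : ℝ} (hk : IsBoundedEnergyFun k C'')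
    (hgh : ∀ e, 0 ≤ e → k e = g e * h e) (Ψ : Fock d) :
    energyOp d ħ g (energyOp d ħ h Ψ) = energyOp d ħ k Ψ := by
  refine Fock.ext_comp fun N => ?_
  filter_upwards [comp_energyOp hħ hg (energyOp d ħ h Ψ) N, comp_energyOp hħ hh Ψ N,
    comp_energyOp hħ hk Ψ N] with K h1 h2 h3
  rw [h1, h2, h3, hgh _ (photonEnergy_nonneg hħ K)]
  push_cast
  ring

theorem energyForm_energyOp (hħ : 0 ≤ ħ) (hg : IsBoundedEnergyFun g C) (Ψ : Fock d)
    (w : ℝ → ℝ≥0∞) :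
    energyForm ħ w (energyOp d ħ g Ψ) = energyForm ħ (fun e => w e * ‖g e‖ₑ ^ 2) Ψ :=
  energyForm_of_comp_eq (comp_energyOp hħ hg Ψ) w

theorem inner_energyOp_left (hħ : 0 ≤ ħ) (hg : IsBoundedEnergyFun g C) (Φ Ψ : Fock d) :
    inner ℂ (energyOp d ħ g Φ) Ψ = inner ℂ Φ (energyOp d ħ g Ψ) := by
  rw [inner_eq_tsum_integral, inner_eq_tsum_integral]
  refine tsum_congr fun N => integral_congr_ae ?_
  filter_upwards [comp_energyOp hħ hg Φ N, comp_energyOp hħ hg Ψ N] with K h1 h2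
  rw [h1, h2, ← smul_eq_mul, ← smul_eq_mul, inner_smul_left, inner_smul_right,
    Complex.conj_ofReal]

end FockSpace

/-! ### Estimates for creation and annihilation operators -/

section Estimates

variable {d : ℕ}

theorem measurePreserving_insertNth {N : ℕ} (j : Fin (N + 1)) :
    MeasurePreserving
      (fun p : (Fin N → Mode d) × Mode d => (j.insertNth p.2 p.1 : Fin (N + 1) → Mode d))
      ((photonMeasure d N).prod (modeMeasure d)) (photonMeasure d (N + 1)) := by
  have e := measurePreserving_piFinSuccAbove (fun _ : Fin (N + 1) => modeMeasure d) j
  exact (e.symm _).comp (Measure.measurePreserving_swap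
    (μ := photonMeasure d N) (ν := modeMeasure d))

theorem lintegral_insertNth {N : ℕ} (j : Fin (N + 1)) {f : (Fin (N + 1) → Mode d) → ℝ≥0∞}
    (hf : AEMeasurable f (photonMeasure d (N + 1))) :
    ∫⁻ K, f K ∂photonMeasure d (N + 1) =
      ∫⁻ K, ∫⁻ κ, f (j.insertNth κ K) ∂modeMeasure d ∂photonMeasure d N := by
  have h := measurePreserving_insertNth (d := d) j
  rw [← h.map_eq] at hf ⊢
  rw [lintegral_map' hf h.aemeasurable]
  exact lintegral_prod _ (hf.comp_aemeasurable h.aemeasurable)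

theorem ae_insertNth {N : ℕ} (j : Fin (N + 1)) {P : (Fin (N + 1) → Mode d) → Prop}
    (h : ∀ᵐ K ∂photonMeasure d (N + 1), P K) :
    ∀ᵐ K ∂photonMeasure d N, ∀ᵐ κ ∂modeMeasure d, P (j.insertNth κ K) :=
  Measure.ae_ae_of_ae_prod ((measurePreserving_insertNth j).quasiMeasurePreserving.ae h)

/-- Bosonic symmetry: the slot that receives the extra photon is irrelevant. The permutation used is
the cycle that moves slot j to the front. -/
theorem comp_insertNth (Ψ : Fock d) {N : ℕ} (j : Fin (N + 1)) :
    ∀ᵐ K ∂photonMeasure d N, ∀ᵐ κ ∂modeMeasure d,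
      comp Ψ (N + 1) (j.insertNth κ K) = comp Ψ (N + 1) (Fin.cons κ K) := by
  filter_upwards [ae_insertNth j (comp_perm Ψ (N + 1) j.cycleRange.symm)] with K hK
  filter_upwards [hK] with κ hκ
  rw [← hκ]
  congr 1
  funext i
  exact Fin.insertNth_apply_cycleRange_symm (α := Mode d) j κ K i

theorem measurable_cons (N : ℕ) : Measurable fun p : (Fin N → Mode d) × Mode d =>
    (Fin.cons p.2 p.1 : Fin (N + 1) → Mode d) := by
  simpa only [Fin.insertNth_zero'] using
    (measurePreserving_insertNth (d := d) (N := N) 0).measurable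

/-- The weights |k| and |k|⁻¹ are inverse to each other in `ℝ≥0∞` only away from k = 0. -/
theorem ae_mode_ne_zero (hd : 0 < d) : ∀ᵐ κ ∂modeMeasure d, κ.1 ≠ 0 := by
  have : NeZero d := ⟨hd.ne'⟩
  have h : ∀ᵐ k : EuclideanSpace ℝ (Fin d), k ≠ 0 := by
    have : Nontrivial (EuclideanSpace ℝ (Fin d)) := by
      rw [← Module.finrank_pos_iff (R := ℝ)]
      simpa using hd
    exact Measure.ae_ne volume 0
  exact (Measure.quasiMeasurePreserving_fst (μ := (volume : Measure (EuclideanSpace ℝ (Fin d))))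
    (ν := (Measure.count : Measure (Fin (d - 1))))).ae h

/-- The weighted norm `∫ (1 + |k|)^m |k|⁻¹ g(k)² dk`. -/
def couplingForm (m : ℕ) (g : Mode d → ℝ≥0∞) : ℝ≥0∞ :=
  ∫⁻ κ, ENNReal.ofReal ((1 + ‖κ.1‖) ^ m) * ‖κ.1‖ₑ⁻¹ * g κ ^ 2 ∂modeMeasure d

theorem couplingForm_mono {m m' : ℕ} (h : m ≤ m') (g : Mode d → ℝ≥0∞) :
    couplingForm m g ≤ couplingForm m' g := by
  refine lintegral_mono fun κ => ?_
  gcongr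
  linarith [norm_nonneg κ.1]

theorem ennreal_sq_le_of_rpow {a b c : ℝ≥0∞} (h : a ≤ b ^ (1 / 2 : ℝ) * c ^ (1 / 2 : ℝ)) :
    a ^ 2 ≤ b * c := by
  calc a ^ 2 ≤ (b ^ (1 / 2 : ℝ) * c ^ (1 / 2 : ℝ)) ^ 2 := by gcongr
    _ = b * c := by
      rw [mul_pow, ← ENNReal.rpow_natCast, ← ENNReal.rpow_natCast, ← ENNReal.rpow_mul,
        ← ENNReal.rpow_mul]
      norm_num

theorem mul_eq_weighted_mul {x g u : ℝ≥0∞} (h0 : x ≠ 0) (ht : x ≠ ∞) :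
    g * u = (x⁻¹ ^ (1 / 2 : ℝ) * g) * (x ^ (1 / 2 : ℝ) * u) := by
  have : x⁻¹ ^ (1 / 2 : ℝ) * x ^ (1 / 2 : ℝ) = 1 := by
    rw [← ENNReal.mul_rpow_of_nonneg _ _ (by norm_num), ENNReal.inv_mul_cancel h0 ht,
      ENNReal.one_rpow]
  calc g * u = (x⁻¹ ^ (1 / 2 : ℝ) * x ^ (1 / 2 : ℝ)) * (g * u) := by rw [this, one_mul]
    _ = _ := by ring

theorem weighted_sq (x g : ℝ≥0∞) : (x ^ (1 / 2 : ℝ) * g) ^ (2 : ℝ) = x * g ^ 2 := by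
  rw [ENNReal.mul_rpow_of_nonneg _ _ (by norm_num), ← ENNReal.rpow_mul]
  norm_num

/-- Cauchy–Schwarz after splitting g u = (|k|^{-1/2} g)(|k|^{1/2} u). The weight |k| on u is the one
that the field energy controls. -/
theorem sq_lintegral_mul_le (hd : 0 < d) {g u : Mode d → ℝ≥0∞}
    (hg : AEMeasurable g (modeMeasure d)) (hu : AEMeasurable u (modeMeasure d)) :
    (∫⁻ κ, g κ * u κ ∂modeMeasure d) ^ 2 ≤
      couplingForm 0 g * ∫⁻ κ, ‖κ.1‖ₑ * u κ ^ 2 ∂modeMeasure d := by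
  have hω : Measurable fun κ : Mode d => ‖κ.1‖ₑ := by fun_prop
  have h1 : ∫⁻ κ, g κ * u κ ∂modeMeasure d = ∫⁻ κ, ((fun κ => ‖κ.1‖ₑ⁻¹ ^ (1 / 2 : ℝ) * g κ) *
      fun κ => ‖κ.1‖ₑ ^ (1 / 2 : ℝ) * u κ) κ ∂modeMeasure d := by
    refine lintegral_congr_ae ?_
    filter_upwards [ae_mode_ne_zero hd] with κ hκ
    exact mul_eq_weighted_mul (by simpa using hκ) (by simp)
  refine ennreal_sq_le_of_rpow ?_
  rw [h1]
  refine (ENNReal.lintegral_mul_le_Lp_mul_Lq _ Real.HolderConjugate.two_two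
    (show AEMeasurable (fun κ : Mode d => ‖κ.1‖ₑ⁻¹ ^ (1 / 2 : ℝ) * g κ) _ from
      (hω.inv.pow_const _).aemeasurable.mul hg)
    (show AEMeasurable (fun κ : Mode d => ‖κ.1‖ₑ ^ (1 / 2 : ℝ) * u κ) _ from
      (hω.pow_const _).aemeasurable.mul hu)).trans_eq ?_
  simp only [weighted_sq, couplingForm, pow_zero, ENNReal.ofReal_one, one_mul]

/-- The discrete counterpart for the creation operator. Here the sum of the weights x_j is split
off, to become the total photon energy. -/
theorem sq_sum_mul_le {N : ℕ} {x g u : Fin N → ℝ≥0∞} (h0 : ∀ j, x j ≠ 0) (ht : ∀ j, x j ≠ ∞) :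
    (∑ j, g j * u j) ^ 2 ≤ (∑ j, x j) * ∑ j, (x j)⁻¹ * (g j * u j) ^ 2 := by
  have h1 : ∑ j, g j * u j =
      ∑ j, ((x j) ^ (1 / 2 : ℝ) * 1) * ((x j)⁻¹ ^ (1 / 2 : ℝ) * (g j * u j)) := by
    refine Finset.sum_congr rfl fun j _ => ?_
    rw [mul_comm (x j ^ (1 / 2 : ℝ) * 1), mul_comm (x j ^ (1 / 2 : ℝ)),
      ← mul_comm (x j ^ (1 / 2 : ℝ)), ← mul_eq_weighted_mul (h0 j) (ht j), mul_one]
  refine ennreal_sq_le_of_rpow ?_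
  rw [h1]
  refine (ENNReal.inner_le_Lp_mul_Lq _ _ _ Real.HolderConjugate.two_two).trans_eq ?_
  have h2 : ∀ y : ℝ≥0∞, (y ^ (1 / 2 : ℝ)) ^ (2 : ℝ) = y := fun y => by
    rw [← ENNReal.rpow_mul]; norm_num
  simp only [weighted_sq, mul_one, h2]

theorem ofReal_sqrt_sq {x : ℝ} (hx : 0 ≤ x) :
    ENNReal.ofReal (Real.sqrt x) ^ 2 = ENNReal.ofReal x := by
  rw [← ENNReal.ofReal_pow (Real.sqrt_nonneg _), Real.sq_sqrt hx]

theorem measurable_modeNorm : Measurable fun κ : Mode d => ‖κ.1‖ₑ := by fun_prop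

theorem ofReal_photonEnergy {ħ : ℝ} (hħ : 0 ≤ ħ) {N : ℕ} (K : Fin N → Mode d) :
    ENNReal.ofReal (photonEnergy ħ K) = ENNReal.ofReal ħ * ∑ j, ‖(K j).1‖ₑ := by
  rw [photonEnergy, ENNReal.ofReal_mul hħ, ENNReal.ofReal_sum_of_nonneg fun _ _ => norm_nonneg _]
  simp only [ofReal_norm]

/-- Bound for sector functions dominated by an annihilation operator. -/
theorem sectorForm_le_of_lowering (hd : 0 < d) {ħ : ℝ} (hħ : 0 < ħ) {w : ℝ → ℝ≥0∞}
    (hw : Measurable w) (hmono : ∀ e e', 0 ≤ e → e ≤ e' → w e ≤ w e') {g : Mode d → ℝ≥0∞}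
    (hg : AEMeasurable g (modeMeasure d)) {Ψ : Fock d}
    {v : ∀ N, (Fin N → Mode d) → ℝ≥0∞}
    (h : ∀ N, ∀ᵐ K ∂photonMeasure d N, v N K ≤ ENNReal.ofReal (Real.sqrt (ħ * (N + 1))) *
      ∫⁻ κ, g κ * ‖comp Ψ (N + 1) (Fin.cons κ K)‖ₑ ∂modeMeasure d) :
    sectorForm ħ w v ≤ couplingForm 0 g * energyForm ħ (fun e => ENNReal.ofReal e * w e) Ψ := by
  set J := couplingForm 0 g with hJ
  have hcons : ∀ N (K : Fin N → Mode d), Measurable fun κ : Mode d =>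
      (Fin.cons κ K : Fin (N + 1) → Mode d) := fun N K =>
    (measurable_cons N).comp measurable_prodMk_left
  have hterm : ∀ N, ∫⁻ K, w (photonEnergy ħ K) * v N K ^ 2 ∂photonMeasure d N ≤
      J * ∫⁻ K, (ENNReal.ofReal (photonEnergy ħ K) * w (photonEnergy ħ K)) *
        ‖comp Ψ (N + 1) K‖ₑ ^ 2 ∂photonMeasure d (N + 1) := by
    intro N
    set G : (Fin (N + 1) → Mode d) → ℝ≥0∞ :=
      fun K => w (photonEnergy ħ K) * ‖comp Ψ (N + 1) K‖ₑ ^ 2 with hG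
    have hGm : Measurable G :=
      (hw.comp (measurable_photonEnergy ħ _)).mul ((measurable_comp Ψ _).enorm.pow_const 2)
    have hjm : ∀ j : Fin (N + 1), Measurable fun K : Fin (N + 1) → Mode d => ‖(K j).1‖ₑ * G K :=
      fun j => (measurable_modeNorm.comp (measurable_pi_apply j)).mul hGm
    have h1 : ∀ᵐ K ∂photonMeasure d N, w (photonEnergy ħ K) * v N K ^ 2 ≤
        J * (ENNReal.ofReal (ħ * (N + 1)) *
          ∫⁻ κ, ‖κ.1‖ₑ * G (Fin.cons κ K) ∂modeMeasure d) := by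
      filter_upwards [h N] with K hK
      have hu : Measurable fun κ => ‖comp Ψ (N + 1) (Fin.cons κ K)‖ₑ :=
        ((measurable_comp Ψ (N + 1)).comp (hcons N K)).enorm
      calc w (photonEnergy ħ K) * v N K ^ 2
          ≤ w (photonEnergy ħ K) * (ENNReal.ofReal (Real.sqrt (ħ * (N + 1))) *
            ∫⁻ κ, g κ * ‖comp Ψ (N + 1) (Fin.cons κ K)‖ₑ ∂modeMeasure d) ^ 2 := by gcongr
        _ ≤ w (photonEnergy ħ K) * (ENNReal.ofReal (ħ * (N + 1)) * (J *
            ∫⁻ κ, ‖κ.1‖ₑ * ‖comp Ψ (N + 1) (Fin.cons κ K)‖ₑ ^ 2 ∂modeMeasure d)) := by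
            rw [mul_pow, ofReal_sqrt_sq (by positivity)]
            gcongr
            exact sq_lintegral_mul_le hd hg hu.aemeasurable
        _ = J * (ENNReal.ofReal (ħ * (N + 1)) * (w (photonEnergy ħ K) *
            ∫⁻ κ, ‖κ.1‖ₑ * ‖comp Ψ (N + 1) (Fin.cons κ K)‖ₑ ^ 2 ∂modeMeasure d)) := by ring
        _ ≤ _ := by
            gcongr
            have hm : Measurable fun κ : Mode d =>
                ‖κ.1‖ₑ * ‖comp Ψ (N + 1) (Fin.cons κ K)‖ₑ ^ 2 :=
              measurable_modeNorm.mul (hu.pow_const 2)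
            rw [← lintegral_const_mul _ hm]
            refine lintegral_mono fun κ => ?_
            rw [mul_left_comm]
            change ‖κ.1‖ₑ * _ ≤ ‖κ.1‖ₑ * (w (photonEnergy ħ (Fin.cons κ K)) *
              ‖comp Ψ (N + 1) (Fin.cons κ K)‖ₑ ^ 2)
            gcongr
            -- Adding a photon increases the energy, so the weight at K may be replaced by the
            -- weight at the larger configuration.
            refine hmono _ _ (photonEnergy_nonneg hħ.le K) ?_
            rw [photonEnergy_cons]
            have := mul_nonneg hħ.le (norm_nonneg κ.1)
            linarith
    -- All N + 1 slots contribute equally, so the prefactor N + 1 can be written as a sum over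
    -- slots.
    have hsym : ∀ j : Fin (N + 1), ∫⁻ K, ‖(K j).1‖ₑ * G K ∂photonMeasure d (N + 1) =
        ∫⁻ K, ∫⁻ κ, ‖κ.1‖ₑ * G (Fin.cons κ K) ∂modeMeasure d ∂photonMeasure d N := by
      intro j
      rw [lintegral_insertNth j (hjm j).aemeasurable]
      refine lintegral_congr_ae ?_
      filter_upwards [comp_insertNth Ψ j] with K hK
      refine lintegral_congr_ae ?_
      filter_upwards [hK] with κ hκ
      rw [hG]
      simp only [Fin.insertNth_apply_same, hκ, photonEnergy_insertNth, photonEnergy_cons]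
    calc _ ≤ ∫⁻ K, J * (ENNReal.ofReal (ħ * (N + 1)) *
          ∫⁻ κ, ‖κ.1‖ₑ * G (Fin.cons κ K) ∂modeMeasure d) ∂photonMeasure d N :=
          lintegral_mono_ae h1
      _ = J * (ENNReal.ofReal (ħ * (N + 1)) *
          ∫⁻ K, ∫⁻ κ, ‖κ.1‖ₑ * G (Fin.cons κ K) ∂modeMeasure d ∂photonMeasure d N) := by
          have hm : Measurable fun p : (Fin N → Mode d) × Mode d =>
              ‖p.2.1‖ₑ * G (Fin.cons p.2 p.1) :=
            (measurable_modeNorm.comp measurable_snd).mul (hGm.comp (measurable_cons N))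
          rw [lintegral_const_mul _ (hm.lintegral_prod_right'.const_mul _),
            lintegral_const_mul _ hm.lintegral_prod_right']
      -- The square of √(ħ(N + 1)) has turned into ħ∑|k_j|, the photon energy. No ħ remains outside
      -- the energy, whence the uniformity of the bound.
      _ = J * (ENNReal.ofReal ħ *
          ∑ j : Fin (N + 1), ∫⁻ K, ‖(K j).1‖ₑ * G K ∂photonMeasure d (N + 1)) := by
          simp only [hsym, Finset.sum_const, Finset.card_univ, Fintype.card_fin, nsmul_eq_mul]
          rw [ENNReal.ofReal_mul hħ.le, mul_assoc]
          congr 3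
          rw [← Nat.cast_succ, ENNReal.ofReal_natCast]
      _ = _ := by
          rw [← lintegral_finsetSum _ fun j _ => hjm j,
            ← lintegral_const_mul _ (Finset.measurable_fun_sum _ fun j _ => hjm j)]
          congr 1
          refine lintegral_congr fun K => ?_
          rw [hG, ← Finset.sum_mul, ofReal_photonEnergy hħ.le]
          ring
  calc sectorForm ħ w v ≤ ∑' N, J * ∫⁻ K, (ENNReal.ofReal (photonEnergy ħ K) *
        w (photonEnergy ħ K)) * ‖comp Ψ (N + 1) K‖ₑ ^ 2 ∂photonMeasure d (N + 1) :=
        ENNReal.tsum_le_tsum hterm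
    _ ≤ _ := by
      rw [ENNReal.tsum_mul_left]
      gcongr
      -- The image involves only the sectors with at least one photon; adding the vacuum sector
      -- enlarges the sum.
      exact ENNReal.tsum_comp_le_tsum_of_injective (add_left_injective 1) fun N =>
        ∫⁻ K, (ENNReal.ofReal (photonEnergy ħ K) * w (photonEnergy ħ K)) *
          ‖comp Ψ N K‖ₑ ^ 2 ∂photonMeasure d N

/-- Bound for sector functions dominated by a creation operator. -/
theorem sectorForm_le_of_raising (hd : 0 < d) {ħ : ℝ} (hħ : 0 < ħ) {w V : ℝ → ℝ≥0∞}
    (hV : Measurable V) {m : ℕ}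
    (hwV : ∀ r e, 0 ≤ r → 0 ≤ e → ENNReal.ofReal (ħ * r + e) * w (ħ * r + e) ≤
      ENNReal.ofReal ((1 + r) ^ m) * V e) {g : Mode d → ℝ≥0∞}
    (hg : AEMeasurable g (modeMeasure d)) {Ψ : Fock d}
    {v : ∀ N, (Fin N → Mode d) → ℝ≥0∞}
    (h0 : ∀ᵐ K ∂photonMeasure d 0, v 0 K = 0)
    (h : ∀ N, ∀ᵐ K ∂photonMeasure d (N + 1), v (N + 1) K ≤
      ENNReal.ofReal (Real.sqrt (ħ / (N + 1))) *
        ∑ j : Fin (N + 1), g (K j) * ‖comp Ψ N (j.removeNth K)‖ₑ) :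
    sectorForm ħ w v ≤ couplingForm m g * energyForm ħ V Ψ := by
  have hterm : ∀ N, ∫⁻ K, w (photonEnergy ħ K) * v (N + 1) K ^ 2
      ∂photonMeasure d (N + 1) ≤
      couplingForm m g * ∫⁻ K, V (photonEnergy ħ K) * ‖comp Ψ N K‖ₑ ^ 2 ∂photonMeasure d N := by
    intro N
    set A : Mode d → ℝ≥0∞ :=
      fun κ => ENNReal.ofReal ((1 + ‖κ.1‖) ^ m) * ‖κ.1‖ₑ⁻¹ * g κ ^ 2 with hA
    set B : (Fin N → Mode d) → ℝ≥0∞ :=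
      fun K => V (photonEnergy ħ K) * ‖comp Ψ N K‖ₑ ^ 2 with hB
    have hAm : AEMeasurable A (modeMeasure d) :=
      (Measurable.aemeasurable (by fun_prop)).mul (hg.pow_const 2)
    have hBm : Measurable B :=
      (hV.comp (measurable_photonEnergy ħ _)).mul ((measurable_comp Ψ _).enorm.pow_const 2)
    have hjm : ∀ j : Fin (N + 1), AEMeasurable
        (fun K : Fin (N + 1) → Mode d => A (K j) * B (j.removeNth K))
        (photonMeasure d (N + 1)) := by
      intro j
      refine (hAm.comp_quasiMeasurePreserving (Measure.quasiMeasurePreserving_eval _ j)).mul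
        (hBm.comp ?_).aemeasurable
      exact measurable_pi_lambda _ fun i => measurable_pi_apply _
    have h1 : ∀ᵐ K ∂photonMeasure d (N + 1), w (photonEnergy ħ K) * v (N + 1) K ^ 2 ≤
        ENNReal.ofReal (1 / (N + 1)) * ∑ j : Fin (N + 1), A (K j) * B (j.removeNth K) := by
      have hne : ∀ᵐ K ∂photonMeasure d (N + 1), ∀ j : Fin (N + 1), (K j).1 ≠ 0 :=
        ae_all_iff.2 fun j => (Measure.quasiMeasurePreserving_eval
          (fun _ : Fin (N + 1) => modeMeasure d) j).ae (ae_mode_ne_zero hd)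
      filter_upwards [h N, hne] with K hK hK0
      set u : Fin (N + 1) → ℝ≥0∞ := fun j => ‖comp Ψ N (j.removeNth K)‖ₑ with hu
      calc w (photonEnergy ħ K) * v (N + 1) K ^ 2
          ≤ w (photonEnergy ħ K) * (ENNReal.ofReal (Real.sqrt (ħ / (N + 1))) *
              ∑ j : Fin (N + 1), g (K j) * u j) ^ 2 := by gcongr
        _ ≤ w (photonEnergy ħ K) * (ENNReal.ofReal (1 / (N + 1)) * ENNReal.ofReal ħ *
              ((∑ j, ‖(K j).1‖ₑ) * ∑ j, ‖(K j).1‖ₑ⁻¹ * (g (K j) * u j) ^ 2)) := by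
            rw [mul_pow, ofReal_sqrt_sq (by positivity), ← ENNReal.ofReal_mul (by positivity),
              one_div_mul_eq_div]
            gcongr
            exact sq_sum_mul_le (fun j => by simpa using hK0 j) fun j => by simp
        -- ħ∑|k_j| is the energy of the full configuration. `hwV` then splits it into the momentum
        -- of photon j, charged to the form factor, and the energy of the other photons, charged to
        -- Ψ.
        _ = ENNReal.ofReal (1 / (N + 1)) * ∑ j, (ENNReal.ofReal (photonEnergy ħ K) *
              w (photonEnergy ħ K)) * (‖(K j).1‖ₑ⁻¹ * (g (K j) * u j) ^ 2) := by
            rw [← Finset.mul_sum, ofReal_photonEnergy hħ.le]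
            ring
        _ ≤ _ := by
            refine mul_le_mul_right (Finset.sum_le_sum fun j _ => ?_) _
            rw [photonEnergy_removeNth ħ j K]
            refine (mul_le_mul_left (hwV _ _ (norm_nonneg (K j).1)
              (photonEnergy_nonneg hħ.le _)) _).trans_eq ?_
            rw [hA, hB, mul_pow]
            ring
    calc _ ≤ ∫⁻ K, ENNReal.ofReal (1 / (N + 1)) * ∑ j : Fin (N + 1), A (K j) * B (j.removeNth K)
          ∂photonMeasure d (N + 1) := lintegral_mono_ae h1
      _ = ENNReal.ofReal (1 / (N + 1)) * ∑ j : Fin (N + 1), ∫⁻ K, A (K j) * B (j.removeNth K)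
          ∂photonMeasure d (N + 1) := by
          rw [lintegral_const_mul'' _ (Finset.aemeasurable_fun_sum _ fun j _ => hjm j),
            lintegral_finsetSum' _ fun j _ => hjm j]
      -- Each slot integral factorizes by Fubini into the coupling form and the N-photon integral.
      -- The N + 1 equal values cancel the prefactor.
      _ = ENNReal.ofReal (1 / (N + 1)) * ∑ _j : Fin (N + 1),
          couplingForm m g * ∫⁻ K, B K ∂photonMeasure d N := by
          congr 1
          refine Finset.sum_congr rfl fun j _ => ?_
          rw [lintegral_insertNth j (hjm j)]
          simp only [Fin.insertNth_apply_same, Fin.removeNth_insertNth]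
          calc _ = ∫⁻ K, couplingForm m g * B K ∂photonMeasure d N :=
                lintegral_congr fun K => lintegral_mul_const'' _ hAm
            _ = _ := lintegral_const_mul _ hBm
      _ = _ := by
          rw [Finset.sum_const, Finset.card_univ, Fintype.card_fin, nsmul_eq_mul, ← mul_assoc,
            ← ENNReal.ofReal_natCast, ← ENNReal.ofReal_mul (by positivity)]
          push_cast
          rw [one_div_mul_cancel (by positivity), ENNReal.ofReal_one, one_mul]
  have hz : ∫⁻ K, w (photonEnergy ħ K) * v 0 K ^ 2 ∂photonMeasure d 0 = 0 := by
    rw [← lintegral_zero (μ := photonMeasure d 0)]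
    refine lintegral_congr_ae ?_
    filter_upwards [h0] with K hK
    simp [hK]
  rw [sectorForm, tsum_eq_zero_add' ENNReal.summable, hz, zero_add, energyForm, sectorForm,
    ← ENNReal.tsum_mul_left]
  exact ENNReal.tsum_le_tsum hterm

end Estimates

/-! ### Existence of creation and annihilation operators -/

section Existence

variable {d : ℕ} {ħ : ℝ}

theorem sectorForm_one (v : ∀ N, (Fin N → Mode d) → ℝ≥0∞) :
    sectorForm ħ (fun _ => 1) v = ∑' N, ∫⁻ K, v N K ^ 2 ∂photonMeasure d N := by
  simp [sectorForm]

/-- The permutation on the right fixes slot 0 and acts as σ on the remaining ones; it transfers the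
symmetry of the (N + 1)-photon function to the annihilated function. -/
theorem cons_perm {α : Type*} {N : ℕ} (κ : α) (K : Fin N → α) (σ : Equiv.Perm (Fin N)) :
    (Fin.cons κ (fun j => K (σ j)) : Fin (N + 1) → α) =
      fun j => (Fin.cons κ K : Fin (N + 1) → α) (Equiv.Perm.decomposeFin.symm (0, σ) j) := by
  funext j
  refine Fin.cases ?_ (fun i => ?_) j
  · simp
  · simp

theorem aestronglyMeasurable_integral_cons {f : Mode d → ℂ}
    (hf : AEStronglyMeasurable f (modeMeasure d)) (Ψ : Fock d) (N : ℕ) :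
    AEStronglyMeasurable (fun p : (Fin N → Mode d) × Mode d =>
      star (f p.2) * comp Ψ (N + 1) (Fin.cons p.2 p.1))
      ((photonMeasure d N).prod (modeMeasure d)) := by
  refine AEStronglyMeasurable.mul ?_ ?_
  · exact Complex.continuous_conj.comp_aestronglyMeasurable hf.comp_snd
  · exact ((measurable_comp Ψ (N + 1)).comp (measurable_cons N)).aestronglyMeasurable

/-- The lowering bound is applied to the integral of absolute values. Its finiteness gives at once
the integrability required by the graph and the square summability of the result. -/
theorem exists_annihilation (hd : 0 < d) (hħ : 0 < ħ) {f : Mode d → ℂ}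
    (hf : AEStronglyMeasurable f (modeMeasure d)) (hfin : couplingForm 0 (fun κ => ‖f κ‖ₑ) ≠ ∞)
    {Ψ : Fock d} (hΨ : energyForm ħ ENNReal.ofReal Ψ ≠ ∞) :
    ∃ Φ, (Ψ, Φ) ∈ annihilationGraph ħ f := by
  set v : ∀ N, (Fin N → Mode d) → ℝ≥0∞ := fun N K => ENNReal.ofReal (Real.sqrt (ħ * (N + 1))) *
    ∫⁻ κ, ‖f κ‖ₑ * ‖comp Ψ (N + 1) (Fin.cons κ K)‖ₑ ∂modeMeasure d with hv
  set u : ∀ N, (Fin N → Mode d) → ℂ := fun N K => (Real.sqrt (ħ * (N + 1)) : ℂ) *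
    ∫ κ, star (f κ) * comp Ψ (N + 1) (Fin.cons κ K) ∂modeMeasure d with hu
  have hvle : sectorForm ħ (fun _ => 1) v ≠ ∞ := by
    refine ne_top_of_le_ne_top (ENNReal.mul_ne_top hfin hΨ)
      ((sectorForm_le_of_lowering hd hħ measurable_const (fun _ _ _ _ => le_rfl) hf.enorm
        (Ψ := Ψ) fun N => Filter.Eventually.of_forall fun K => le_rfl).trans_eq ?_)
    simp
  rw [sectorForm_one] at hvle
  have hvfin : ∀ N, ∀ᵐ K ∂photonMeasure d N, v N K ≠ ∞ := by
    intro N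
    have hm : AEMeasurable (v N) (photonMeasure d N) := by
      have h1 := (aestronglyMeasurable_integral_cons hf Ψ N).enorm
      have h2 := h1.lintegral_prod_right'
      refine (h2.congr (Filter.Eventually.of_forall fun K => ?_)).const_mul _
      refine lintegral_congr fun κ => ?_
      simp [enorm_mul]
    have h3 := ae_lt_top' (hm.pow_const 2) (ENNReal.ne_top_of_tsum_ne_top hvle N)
    filter_upwards [h3] with K hK
    intro h
    simp [h] at hK
  have hInt : ∀ N, ∀ᵐ K ∂photonMeasure d N,
      Integrable (fun κ => star (f κ) * comp Ψ (N + 1) (Fin.cons κ K)) (modeMeasure d) := by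
    intro N
    filter_upwards [hvfin N, (aestronglyMeasurable_integral_cons hf Ψ N).prodMk_left] with K hK hm
    refine ⟨hm, ?_⟩
    have h1 : ENNReal.ofReal (Real.sqrt (ħ * (N + 1))) ≠ 0 := by
      rw [Ne, ENNReal.ofReal_eq_zero, not_le]
      positivity
    have h2 : ∫⁻ κ, ‖f κ‖ₑ * ‖comp Ψ (N + 1) (Fin.cons κ K)‖ₑ ∂modeMeasure d ≠ ∞ :=
      fun h => hK (by rw [hv]; simp only [h]; exact ENNReal.mul_top h1)
    refine lt_of_eq_of_lt (lintegral_congr fun κ => ?_) h2.lt_top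
    simp [enorm_mul]
  have huv : ∀ N K, ‖u N K‖ₑ ≤ v N K := by
    intro N K
    rw [hu, hv]
    simp only [enorm_mul]
    rw [enorm_ofReal_complex, Real.enorm_of_nonneg (Real.sqrt_nonneg _)]
    gcongr
    refine (enorm_integral_le_lintegral_enorm _).trans_eq (lintegral_congr fun κ => ?_)
    simp [enorm_mul]
  suffices h : ∃ Φ : Fock d, ∀ N, comp Φ N =ᵐ[photonMeasure d N] u N by
    obtain ⟨Φ, hΦ⟩ := h
    exact ⟨Φ, fun N => (hInt N).and (hΦ N)⟩
  refine exists_fock (fun N => ?_) (fun N σ => ?_) ?_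
  · exact (aestronglyMeasurable_integral_cons hf Ψ N).integral_prod_right'.const_mul _
  · filter_upwards [ae_cons (comp_perm Ψ (N + 1) (Equiv.Perm.decomposeFin.symm (0, σ)))] with K hK
    simp only [hu]
    congr 1
    refine integral_congr_ae ?_
    filter_upwards [hK] with κ hκ
    rw [cons_perm, hκ]
  · refine ne_top_of_le_ne_top hvle ?_
    gcongr with N K
    exact huv N K

/-- Permuting all photons and then deleting one amounts to deleting another photon and permuting the
rest. This is why the sum defining the creation operator is symmetric. -/
theorem exists_perm_removeNth {N : ℕ} (σ : Equiv.Perm (Fin (N + 1))) (j : Fin (N + 1)) :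
    ∃ τ : Equiv.Perm (Fin N), ∀ i, σ (j.succAbove i) = (σ j).succAbove (τ i) := by
  have h : ∀ i, ∃ k, (σ j).succAbove k = σ (j.succAbove i) := fun i =>
    Fin.exists_succAbove_eq fun h => Fin.succAbove_ne j i (σ.injective h)
  choose t ht using h
  have hinj : Function.Injective t := fun a b hab => by
    have : σ (j.succAbove a) = σ (j.succAbove b) := by rw [← ht, ← ht, hab]
    exact Fin.succAbove_right_injective (σ.injective this)
  exact ⟨Equiv.ofBijective t (Finite.injective_iff_bijective.1 hinj), fun i => (ht i).symm⟩

theorem exists_creation (hd : 0 < d) (hħ : 0 < ħ) {f : Mode d → ℂ}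
    (hf : AEStronglyMeasurable f (modeMeasure d)) (hfin : couplingForm 1 (fun κ => ‖f κ‖ₑ) ≠ ∞)
    {Ψ : Fock d} (hΨ : energyForm ħ (fun e => ENNReal.ofReal (1 + e)) Ψ ≠ ∞) (hħ1 : ħ < 1) :
    ∃ Φ, (Ψ, Φ) ∈ creationGraph ħ f := by
  set u : ∀ N, (Fin N → Mode d) → ℂ := fun N => match N with
    | 0 => fun _ => 0
    | N + 1 => fun K => (Real.sqrt (ħ / (N + 1)) : ℂ) *
        ∑ j : Fin (N + 1), f (K j) * comp Ψ N (j.removeNth K) with hu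
  have hrem : ∀ N (j : Fin (N + 1)), Measurable fun K : Fin (N + 1) → Mode d => j.removeNth K :=
    fun N j => measurable_pi_lambda _ fun i => measurable_pi_apply _
  suffices h : ∃ Φ : Fock d, ∀ N, comp Φ N =ᵐ[photonMeasure d N] u N by
    obtain ⟨Φ, hΦ⟩ := h
    exact ⟨Φ, hΦ 0, fun N => hΦ (N + 1)⟩
  refine exists_fock (fun N => ?_) (fun N σ => ?_) ?_
  · match N with
    | 0 => exact aestronglyMeasurable_const
    | N + 1 =>
      refine AEStronglyMeasurable.const_mul (Finset.aestronglyMeasurable_fun_sum _ fun j _ => ?_) _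
      exact (hf.comp_quasiMeasurePreserving (Measure.quasiMeasurePreserving_eval _ j)).mul
        ((measurable_comp Ψ N).comp (hrem N j)).aestronglyMeasurable
  · match N with
    | 0 => exact Filter.Eventually.of_forall fun _ => rfl
    | N + 1 =>
      choose τ hτ using exists_perm_removeNth σ
      filter_upwards [ae_all_iff.2 fun j : Fin (N + 1) =>
        ae_removeNth (σ j) (comp_perm Ψ N (τ j))] with K hK
      simp only [hu]
      congr 1
      rw [← Equiv.sum_comp σ fun j => f (K j) * comp Ψ N (j.removeNth K)]
      refine Finset.sum_congr rfl fun j _ => ?_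
      rw [← hK j]
      congr 2
      funext i
      simp [Fin.removeNth, hτ]
  · rw [← sectorForm_one (ħ := ħ)]
    refine ne_top_of_le_ne_top (ENNReal.mul_ne_top hfin hΨ)
      (sectorForm_le_of_raising hd hħ (by fun_prop) (fun r e hr he => ?_) hf.enorm
        (Ψ := Ψ) (Filter.Eventually.of_forall fun _ => by simp [hu]) fun N =>
          Filter.Eventually.of_forall fun K => ?_)
    · rw [mul_one, ← ENNReal.ofReal_mul (by positivity)]
      refine ENNReal.ofReal_le_ofReal ?_
      nlinarith [mul_nonneg hr he, mul_nonneg (sub_nonneg.2 hħ1.le) hr]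
    · simp only [hu, enorm_mul]
      rw [enorm_ofReal_complex, Real.enorm_of_nonneg (Real.sqrt_nonneg _)]
      gcongr
      refine (enorm_sum_le _ _).trans_eq (Finset.sum_congr rfl fun j _ => enorm_mul _ _)

/-- A graph pulled back along R is single valued, so a pointwise choice of images is automatically
linear. -/
theorem exists_clm_of_graph {E : Type*} [NormedAddCommGroup E] [NormedSpace ℂ E]
    {G : Submodule ℂ (E × E)} (hG : IsFunctional G) (R : E →L[ℂ] E) {C : ℝ} (hC : 0 ≤ C)
    (h : ∀ x, ∃ y, (R x, y) ∈ G ∧ ‖y‖ ≤ C * ‖x‖) :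
    ∃ T : E →L[ℂ] E, (∀ x, (R x, T x) ∈ G) ∧ ‖T‖ ≤ C := by
  choose T hT hTC using h
  have huniq : ∀ {x y z}, (x, y) ∈ G → (x, z) ∈ G → y = z := fun {x y z} hy hz => by
    have := hG _ (G.sub_mem hy hz) (sub_self x)
    exact sub_eq_zero.1 this
  have hadd : ∀ x y, T (x + y) = T x + T y := fun x y =>
    huniq (hT (x + y)) (by rw [map_add]; exact G.add_mem (hT x) (hT y))
  have hsmul : ∀ (c : ℂ) x, T (c • x) = c • T x := fun c x =>
    huniq (hT (c • x)) (by rw [map_smul]; exact G.smul_mem c (hT x))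
  exact ⟨LinearMap.mkContinuous ⟨⟨T, hadd⟩, hsmul⟩ C hTC, hT, LinearMap.mkContinuous_norm_le _ hC _⟩

/-! ### Particular functions of the field energy -/

/-- The function `(1 + e)^{-1/2}`. -/
def invSqrtFun (e : ℝ) : ℝ := (Real.sqrt (1 + e))⁻¹

/-- The function `(1 + δ (1 + e))⁻¹`. -/
def resolventFun (δ e : ℝ) : ℝ := (1 + δ * (1 + e))⁻¹

theorem isBoundedEnergyFun_invSqrtFun : IsBoundedEnergyFun invSqrtFun 1 where
  measurable := by unfold invSqrtFun; fun_prop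
  bound e he := by
    rw [invSqrtFun, abs_of_nonneg (by positivity)]
    refine inv_le_one_of_one_le₀ (Real.one_le_sqrt.2 (by linarith))

theorem invSqrtFun_sq {e : ℝ} (he : 0 ≤ e) : invSqrtFun e ^ 2 = (1 + e)⁻¹ := by
  rw [invSqrtFun, inv_pow, Real.sq_sqrt (by positivity)]

theorem enorm_invSqrtFun_sq {e : ℝ} (he : 0 ≤ e) :
    ‖invSqrtFun e‖ₑ ^ 2 = ENNReal.ofReal (1 + e)⁻¹ := by
  rw [← invSqrtFun_sq he, ← ofReal_norm, ← ENNReal.ofReal_pow (norm_nonneg _), Real.norm_eq_abs,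
    sq_abs]

/-- The operator `R = (1 + H_f)^{-1/2}` on Fock space. -/
abbrev fockR (d : ℕ) (ħ : ℝ) : Fock d →L[ℂ] Fock d := energyOp d ħ invSqrtFun

theorem fockR_injective (hħ : 0 ≤ ħ) : Function.Injective (fockR d ħ) := by
  rw [injective_iff_map_eq_zero]
  intro Ψ h
  refine eq_zero_of_comp fun N => ?_
  have h1 := comp_energyOp hħ isBoundedEnergyFun_invSqrtFun Ψ N
  have h2 : comp (fockR d ħ Ψ) N =ᵐ[photonMeasure d N] 0 := by rw [h]; exact comp_zero N
  filter_upwards [h1, h2] with K h1 h2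
  rw [h2] at h1
  have h3 : invSqrtFun (photonEnergy ħ K) ≠ 0 := by
    have := photonEnergy_nonneg hħ K
    rw [invSqrtFun]
    positivity
  exact (mul_eq_zero.1 h1.symm).resolve_left (by exact_mod_cast h3)

/-- `R²` improves the energy form by a factor `(1 + e)²`, and `R` by a factor `1 + e`. -/
theorem energyForm_fockR_le (hħ : 0 ≤ ħ) {w w' : ℝ → ℝ≥0∞}
    (h : ∀ e, 0 ≤ e → w e ≤ w' e * ENNReal.ofReal (1 + e)) (Ψ : Fock d) :
    energyForm ħ w (fockR d ħ Ψ) ≤ energyForm ħ w' Ψ := by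
  rw [energyForm_energyOp hħ isBoundedEnergyFun_invSqrtFun]
  refine energyForm_mono hħ (fun e he => ?_) Ψ
  rw [enorm_invSqrtFun_sq he]
  refine (mul_le_mul_left (h e he) _).trans_eq ?_
  rw [mul_assoc, ← ENNReal.ofReal_mul (by positivity), mul_inv_cancel₀ (by positivity),
    ENNReal.ofReal_one, mul_one]

end Existence

/-! ### Bounded versions of the field operators -/

section Ladder

variable {d : ℕ} {ħ : ℝ}

/-- The graph of the annihilation operator (`false`) or of the creation operator (`true`). -/
def ladderGraph (b : Bool) (ħ : ℝ) (f : Mode d → ℂ) : Submodule ℂ (Fock d × Fock d) :=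
  match b with
  | false => annihilationGraph ħ f
  | true => creationGraph ħ f

theorem ladderGraph_functional (b : Bool) (f : Mode d → ℂ) : IsFunctional (ladderGraph b ħ f) := by
  cases b
  · exact annihilationGraph_functional ħ f
  · exact creationGraph_functional ħ f

/-- `Φ` is dominated pointwise by the annihilation or creation operator with the nonnegative form
factor `g`, applied to `|Ψ|`. -/
def IsLadderDominated (ħ : ℝ) (g : Mode d → ℝ≥0∞) (Ψ Φ : Fock d) : Prop :=
  (∀ N, ∀ᵐ K ∂photonMeasure d N, ‖comp Φ N K‖ₑ ≤ ENNReal.ofReal (Real.sqrt (ħ * (N + 1))) *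
      ∫⁻ κ, g κ * ‖comp Ψ (N + 1) (Fin.cons κ K)‖ₑ ∂modeMeasure d) ∨
  ((∀ᵐ K ∂photonMeasure d 0, ‖comp Φ 0 K‖ₑ = 0) ∧ ∀ N, ∀ᵐ K ∂photonMeasure d (N + 1),
    ‖comp Φ (N + 1) K‖ₑ ≤ ENNReal.ofReal (Real.sqrt (ħ / (N + 1))) *
        ∑ j : Fin (N + 1), g (K j) * ‖comp Ψ N (j.removeNth K)‖ₑ)

theorem IsLadderDominated.energyForm_one_le (hd : 0 < d) (hħ : 0 < ħ) (hħ1 : ħ < 1)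
    {g : Mode d → ℝ≥0∞} (hg : AEMeasurable g (modeMeasure d)) {Ψ Φ : Fock d}
    (h : IsLadderDominated ħ g Ψ Φ) :
    energyForm ħ (fun _ => 1) Φ ≤
      couplingForm 1 g * energyForm ħ (fun e => ENNReal.ofReal (1 + e)) Ψ := by
  rcases h with h | ⟨h0, h⟩
  · refine (sectorForm_le_of_lowering hd hħ measurable_const (fun _ _ _ _ => le_rfl) hg h).trans ?_
    refine mul_le_mul' (couplingForm_mono zero_le_one g) (energyForm_mono hħ.le (fun e he => ?_) Ψ)
    rw [mul_one]
    exact ENNReal.ofReal_le_ofReal (by linarith)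
  · refine sectorForm_le_of_raising hd hħ (by fun_prop) (fun r e hr he => ?_) hg h0 h
    rw [mul_one, ← ENNReal.ofReal_mul (by positivity)]
    refine ENNReal.ofReal_le_ofReal ?_
    -- Here ħ < 1 enters: ħr + e ≤ (1 + r)(1 + e), which explains the weight exponent 1.
    nlinarith [mul_nonneg hr he, mul_nonneg (sub_nonneg.2 hħ1.le) hr]

theorem IsLadderDominated.energyForm_add_le (hd : 0 < d) (hħ : 0 < ħ) (hħ1 : ħ < 1)
    {g : Mode d → ℝ≥0∞} (hg : AEMeasurable g (modeMeasure d)) {Ψ Φ : Fock d}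
    (h : IsLadderDominated ħ g Ψ Φ) :
    energyForm ħ (fun e => ENNReal.ofReal (1 + e)) Φ ≤
      couplingForm 2 g * energyForm ħ (fun e => ENNReal.ofReal ((1 + e) ^ 2)) Ψ := by
  rcases h with h | ⟨h0, h⟩
  · refine (sectorForm_le_of_lowering hd hħ (by fun_prop)
      (fun e e' _ he => ENNReal.ofReal_le_ofReal (by linarith)) hg h).trans ?_
    refine mul_le_mul' (couplingForm_mono zero_le_two g) (energyForm_mono hħ.le (fun e he => ?_) Ψ)
    rw [← ENNReal.ofReal_mul he]
    exact ENNReal.ofReal_le_ofReal (by nlinarith)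
  · refine sectorForm_le_of_raising hd hħ (by fun_prop) (fun r e hr he => ?_) hg h0 h
    rw [← ENNReal.ofReal_mul (by positivity), ← ENNReal.ofReal_mul (by positivity), ← mul_pow]
    refine ENNReal.ofReal_le_ofReal ?_
    -- Squaring this inequality dominates (ħr + e)(1 + ħr + e) and costs the weight exponent 2.
    have h1 : ħ * r + e + 1 ≤ (1 + r) * (1 + e) := by
      nlinarith [mul_nonneg hr he, mul_nonneg (sub_nonneg.2 hħ1.le) hr]
    have h2 : 0 ≤ ħ * r + e := by positivity
    nlinarith

theorem isLadderDominated_of_mem {b : Bool} {f : Mode d → ℂ} {Ψ Φ : Fock d}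
    (h : (Ψ, Φ) ∈ ladderGraph b ħ f) : IsLadderDominated ħ (fun κ => ‖f κ‖ₑ) Ψ Φ := by
  cases b
  · refine Or.inl fun N => ?_
    filter_upwards [h N] with K hK
    rw [hK.2, enorm_mul, enorm_ofReal_complex, Real.enorm_of_nonneg (Real.sqrt_nonneg _)]
    gcongr
    refine (enorm_integral_le_lintegral_enorm _).trans_eq (lintegral_congr fun κ => ?_)
    simp [enorm_mul]
  · refine Or.inr ⟨?_, fun N => ?_⟩
    · filter_upwards [h.1] with K hK
      rw [hK, enorm_zero]
    · filter_upwards [h.2 N] with K hK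
      rw [hK, enorm_mul, enorm_ofReal_complex, Real.enorm_of_nonneg (Real.sqrt_nonneg _)]
      gcongr
      exact (enorm_sum_le _ _).trans_eq (Finset.sum_congr rfl fun j _ => enorm_mul _ _)

/-- The commutator of a ladder operator with a Lipschitz function of the field energy is dominated
by a ladder operator with the form factor multiplied by `|k|`. -/
theorem isLadderDominated_commutator (hħ : 0 < ħ) (hħ1 : ħ < 1) {b : Bool} {f : Mode d → ℂ}
    {g : ℝ → ℝ} {C : ℝ} (hg : IsBoundedEnergyFun g C)
    (hlip : ∀ e e', 0 ≤ e → 0 ≤ e' → |g e - g e'| ≤ |e - e'|) {Ψ Φ Φ' : Fock d}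
    (h : (Ψ, Φ) ∈ ladderGraph b ħ f) (h' : (energyOp d ħ g Ψ, Φ') ∈ ladderGraph b ħ f) :
    IsLadderDominated ħ (fun κ => ‖κ.1‖ₑ * ‖f κ‖ₑ) Ψ (Φ' - energyOp d ħ g Φ) := by
  -- A ladder operator changes the field energy by ħ|k|, so a 1-Lipschitz function of it changes by
  -- at most |k|.
  have hdiff : ∀ {r e : ℝ}, 0 ≤ r → 0 ≤ e →
      ‖g (ħ * r + e) - g e‖ₑ ≤ ENNReal.ofReal r := by
    intro r e hr he
    rw [← ofReal_norm, Real.norm_eq_abs]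
    refine ENNReal.ofReal_le_ofReal ((hlip _ _ (by positivity) he).trans ?_)
    rw [add_sub_cancel_right, abs_of_nonneg (by positivity)]
    nlinarith
  cases b
  · refine Or.inl fun N => ?_
    filter_upwards [h N, h' N, comp_sub Φ' (energyOp d ħ g Φ) N, comp_energyOp hħ.le hg Φ N,
      ae_cons (comp_energyOp hħ.le hg Ψ (N + 1))] with K h1 h2 h3 h4 h5
    have h6 : comp (Φ' - energyOp d ħ g Φ) N K = (Real.sqrt (ħ * (N + 1)) : ℂ) *
        ∫ κ, (((g (ħ * ‖κ.1‖ + photonEnergy ħ K) - g (photonEnergy ħ K) : ℝ) : ℂ) *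
          (star (f κ) * comp Ψ (N + 1) (Fin.cons κ K))) ∂modeMeasure d := by
      rw [h3, Pi.sub_apply, h4, h1.2, h2.2, mul_left_comm,
        ← integral_const_mul (g (photonEnergy ħ K) : ℂ), ← mul_sub,
        ← integral_sub h2.1 (h1.1.const_mul _)]
      congr 1
      refine integral_congr_ae ?_
      filter_upwards [h5] with κ hκ
      rw [hκ, photonEnergy_cons]
      push_cast
      ring
    rw [h6, enorm_mul, enorm_ofReal_complex, Real.enorm_of_nonneg (Real.sqrt_nonneg _)]
    gcongr
    refine (enorm_integral_le_lintegral_enorm _).trans (lintegral_mono fun κ => ?_)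
    rw [enorm_mul, enorm_mul, enorm_ofReal_complex, ← mul_assoc, ← ofReal_norm κ.1]
    gcongr
    · exact hdiff (norm_nonneg _) (photonEnergy_nonneg hħ.le K)
    · simp
  · refine Or.inr ⟨?_, fun N => ?_⟩
    · filter_upwards [h.1, h'.1, comp_sub Φ' (energyOp d ħ g Φ) 0, comp_energyOp hħ.le hg Φ 0]
        with K h1 h2 h3 h4
      rw [h3, Pi.sub_apply, h4, h1, h2]
      simp
    · filter_upwards [h.2 N, h'.2 N, comp_sub Φ' (energyOp d ħ g Φ) (N + 1),
        comp_energyOp hħ.le hg Φ (N + 1), ae_all_iff.2 fun j : Fin (N + 1) =>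
          ae_removeNth j (comp_energyOp hħ.le hg Ψ N)] with K h1 h2 h3 h4 h5
      have h6 : comp (Φ' - energyOp d ħ g Φ) (N + 1) K = (Real.sqrt (ħ / (N + 1)) : ℂ) *
          ∑ j : Fin (N + 1), (((g (photonEnergy ħ (j.removeNth K)) -
            g (ħ * ‖(K j).1‖ + photonEnergy ħ (j.removeNth K)) : ℝ) : ℂ) *
          (f (K j) * comp Ψ N (j.removeNth K))) := by
        rw [h3, Pi.sub_apply, h4, h1, h2, mul_left_comm,
          Finset.mul_sum _ _ (g (photonEnergy ħ K) : ℂ), ← mul_sub,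
          ← Finset.sum_sub_distrib]
        congr 1
        refine Finset.sum_congr rfl fun j _ => ?_
        rw [h5 j, photonEnergy_removeNth ħ j K]
        push_cast
        ring
      rw [h6, enorm_mul, enorm_ofReal_complex, Real.enorm_of_nonneg (Real.sqrt_nonneg _)]
      gcongr
      refine (enorm_sum_le _ _).trans (Finset.sum_le_sum fun j _ => ?_)
      rw [enorm_mul, enorm_mul, enorm_ofReal_complex, ← mul_assoc, ← ofReal_norm (K j).1,
        ← enorm_neg, neg_sub]
      gcongr
      exact hdiff (norm_nonneg _) (photonEnergy_nonneg hħ.le _)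

/-- A form factor for which the field operator is controlled by `(1 + H_f)^{1/2}`. -/
structure IsCoupling (m : ℕ) (f : Mode d → ℂ) : Prop where
  aesm : AEStronglyMeasurable f (modeMeasure d)
  fin : couplingForm m (fun κ => ‖f κ‖ₑ) ≠ ∞

theorem IsCoupling.mono {m m' : ℕ} {f : Mode d → ℂ} (h : IsCoupling m' f) (hm : m ≤ m') :
    IsCoupling m f :=
  ⟨h.aesm, ne_top_of_le_ne_top h.fin (couplingForm_mono hm _)⟩

/-- The norm belonging to `couplingForm`. -/
def couplingNorm (m : ℕ) (f : Mode d → ℂ) : ℝ :=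
  Real.sqrt (couplingForm m fun κ => ‖f κ‖ₑ).toReal

theorem couplingNorm_nonneg (m : ℕ) (f : Mode d → ℂ) : 0 ≤ couplingNorm m f := Real.sqrt_nonneg _

theorem norm_le_of_enorm_sq_le {E E' : Type*} [NormedAddCommGroup E] [NormedAddCommGroup E']
    {x : E} {y : E'} {a : ℝ≥0∞}
    (ha : a ≠ ∞) (h : ‖x‖ₑ ^ 2 ≤ a * ‖y‖ₑ ^ 2) : ‖x‖ ≤ Real.sqrt a.toReal * ‖y‖ := by
  refine enorm_le_of_sq_le (by positivity) (h.trans_eq ?_)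
  rw [mul_pow, Real.sq_sqrt ENNReal.toReal_nonneg, ENNReal.ofReal_mul ENNReal.toReal_nonneg,
    ENNReal.ofReal_toReal ha, ENNReal.ofReal_pow (norm_nonneg _), ofReal_norm]

theorem exists_ladder (hd : 0 < d) (hħ : 0 < ħ) (hħ1 : ħ < 1) (b : Bool) {f : Mode d → ℂ}
    (hf : IsCoupling 1 f) {Ψ : Fock d}
    (hΨ : energyForm ħ (fun e => ENNReal.ofReal (1 + e)) Ψ ≠ ∞) :
    ∃ Φ, (Ψ, Φ) ∈ ladderGraph b ħ f := by
  cases b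
  · refine exists_annihilation hd hħ hf.aesm (hf.mono zero_le_one).fin
      (ne_top_of_le_ne_top hΨ (energyForm_mono hħ.le (fun e _ => ?_) Ψ))
    exact ENNReal.ofReal_le_ofReal (by linarith)
  · exact exists_creation hd hħ hf.aesm hf.fin hΨ hħ1

theorem energyForm_add_fockR_le (hħ : 0 ≤ ħ) (φ : Fock d) :
    energyForm ħ (fun e => ENNReal.ofReal (1 + e)) (fockR d ħ φ) ≤ ‖φ‖ₑ ^ 2 := by
  rw [← energyForm_one ħ]
  exact energyForm_fockR_le hħ (fun e _ => by rw [one_mul]) φ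

theorem energyForm_add_sq_fockR_le (hħ : 0 ≤ ħ) (φ : Fock d) :
    energyForm ħ (fun e => ENNReal.ofReal ((1 + e) ^ 2)) (fockR d ħ (fockR d ħ φ)) ≤ ‖φ‖ₑ ^ 2 := by
  refine le_trans ?_ (energyForm_add_fockR_le hħ φ)
  refine energyForm_fockR_le hħ (fun e he => ?_) _
  rw [← ENNReal.ofReal_mul (by positivity), sq]

theorem IsLadderDominated.norm_le (hd : 0 < d) (hħ : 0 < ħ) (hħ1 : ħ < 1)
    {g : Mode d → ℝ≥0∞} (hg : AEMeasurable g (modeMeasure d)) (hfin : couplingForm 1 g ≠ ∞)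
    {φ Φ : Fock d} (h : IsLadderDominated ħ g (fockR d ħ φ) Φ) :
    ‖Φ‖ ≤ Real.sqrt (couplingForm 1 g).toReal * ‖φ‖ := by
  refine norm_le_of_enorm_sq_le hfin ?_
  rw [← energyForm_one ħ]
  refine (h.energyForm_one_le hd hħ hħ1 hg).trans ?_
  gcongr
  exact energyForm_add_fockR_le hħ.le φ

theorem norm_le_of_mem_ladderGraph (hd : 0 < d) (hħ : 0 < ħ) (hħ1 : ħ < 1) {b : Bool}
    {f : Mode d → ℂ} (hf : IsCoupling 1 f) {φ Φ : Fock d}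
    (h : (fockR d ħ φ, Φ) ∈ ladderGraph b ħ f) : ‖Φ‖ ≤ couplingNorm 1 f * ‖φ‖ :=
  (isLadderDominated_of_mem h).norm_le hd hħ hħ1 hf.aesm.enorm hf.fin

theorem norm_le_of_fockR_mem_ladderGraph (hd : 0 < d) (hħ : 0 < ħ) (hħ1 : ħ < 1) {b : Bool}
    {f : Mode d → ℂ} (hf : IsCoupling 2 f) {φ Φ : Fock d}
    (h : (fockR d ħ (fockR d ħ φ), fockR d ħ Φ) ∈ ladderGraph b ħ f) :
    ‖Φ‖ ≤ couplingNorm 2 f * ‖φ‖ := by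
  refine norm_le_of_enorm_sq_le hf.fin ?_
  -- The form of 1 + H_f at RΦ is ‖Φ‖², so the form bound for ladder operators becomes a norm bound
  -- for R⁻¹a(f)R².
  have h1 : ‖Φ‖ₑ ^ 2 = energyForm ħ (fun e => ENNReal.ofReal (1 + e)) (fockR d ħ Φ) := by
    rw [← energyForm_one ħ, energyForm_energyOp hħ.le isBoundedEnergyFun_invSqrtFun]
    refine le_antisymm (energyForm_mono hħ.le (fun e he => ?_) _)
      (energyForm_mono hħ.le (fun e he => ?_) _)
    all_goals
      rw [enorm_invSqrtFun_sq he, ← ENNReal.ofReal_mul (by positivity),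
        mul_inv_cancel₀ (by positivity), ENNReal.ofReal_one]
  rw [h1]
  refine ((isLadderDominated_of_mem h).energyForm_add_le hd hħ hħ1 hf.aesm.enorm).trans ?_
  gcongr
  exact energyForm_add_sq_fockR_le hħ.le φ

theorem exists_ladderR (hd : 0 < d) (hħ : 0 < ħ) (hħ1 : ħ < 1) (b : Bool) {f : Mode d → ℂ}
    (hf : IsCoupling 1 f) : ∃ T : Fock d →L[ℂ] Fock d,
      (∀ φ, (fockR d ħ φ, T φ) ∈ ladderGraph b ħ f) ∧ ‖T‖ ≤ couplingNorm 1 f := by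
  refine exists_clm_of_graph (ladderGraph_functional b f) _ (couplingNorm_nonneg 1 f) fun φ => ?_
  obtain ⟨Φ, hΦ⟩ := exists_ladder hd hħ hħ1 b hf (Ψ := fockR d ħ φ)
    (ne_top_of_le_ne_top (by simp) (energyForm_add_fockR_le hħ.le φ))
  exact ⟨Φ, hΦ, norm_le_of_mem_ladderGraph hd hħ hħ1 hf hΦ⟩

/-- The form domain of H_f lies in the range of R; the preimage is (1 + H_f)^{1/2}Φ. -/
theorem exists_fockR_eq (hħ : 0 ≤ ħ) {Φ : Fock d}
    (h : energyForm ħ (fun e => ENNReal.ofReal (1 + e)) Φ ≠ ∞) : ∃ Θ, fockR d ħ Θ = Φ := by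
  have hm : Measurable fun e : ℝ => Real.sqrt (1 + e) := by fun_prop
  obtain ⟨Θ, hΘ⟩ := exists_energy_mul (ħ := ħ) hm (Ψ := Φ) (by
    refine ne_top_of_le_ne_top h (energyForm_mono hħ (fun e he => ?_) Φ)
    rw [← ofReal_norm, ← ENNReal.ofReal_pow (norm_nonneg _), Real.norm_eq_abs, sq_abs,
      Real.sq_sqrt (by positivity)])
  refine ⟨Θ, energyOp_eq hħ isBoundedEnergyFun_invSqrtFun fun N => ?_⟩
  filter_upwards [hΘ N] with K hK
  have h1 := photonEnergy_nonneg hħ K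
  have h2 : (Real.sqrt (1 + photonEnergy ħ K) : ℂ) ≠ 0 := by
    have : 0 < Real.sqrt (1 + photonEnergy ħ K) := by positivity
    exact_mod_cast this.ne'
  rw [hK, invSqrtFun]
  push_cast
  rw [inv_mul_cancel_left₀ h2]

theorem exists_ladderR₂ (hd : 0 < d) (hħ : 0 < ħ) (hħ1 : ħ < 1) (b : Bool) {f : Mode d → ℂ}
    (hf : IsCoupling 2 f) : ∃ T : Fock d →L[ℂ] Fock d,
      (∀ φ, (fockR d ħ (fockR d ħ φ), fockR d ħ (T φ)) ∈ ladderGraph b ħ f) ∧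
        ‖T‖ ≤ couplingNorm 2 f := by
  -- Injectivity of R makes the graph of R⁻¹a(f) single valued.
  have hG : IsFunctional ((ladderGraph b ħ f).comap
      (LinearMap.prodMap LinearMap.id (fockR d ħ).toLinearMap)) := by
    rintro ⟨x, y⟩ h hx
    exact fockR_injective hħ.le ((ladderGraph_functional b f _ h hx).trans (map_zero _).symm)
  refine exists_clm_of_graph hG (fockR d ħ ∘L fockR d ħ) (couplingNorm_nonneg 2 f) fun φ => ?_
  obtain ⟨Φ, hΦ⟩ := exists_ladder hd hħ hħ1 b (hf.mono one_le_two) (Ψ := fockR d ħ (fockR d ħ φ))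
    (ne_top_of_le_ne_top (by simp) (energyForm_add_fockR_le hħ.le (fockR d ħ φ)))
  have h1 : energyForm ħ (fun e => ENNReal.ofReal (1 + e)) Φ ≠ ∞ := by
    refine ne_top_of_le_ne_top (ENNReal.mul_ne_top hf.fin ?_)
      ((isLadderDominated_of_mem hΦ).energyForm_add_le hd hħ hħ1 hf.aesm.enorm)
    exact ne_top_of_le_ne_top (by simp) (energyForm_add_sq_fockR_le hħ.le φ)
  obtain ⟨Θ, rfl⟩ := exists_fockR_eq hħ.le h1
  exact ⟨Θ, hΦ, norm_le_of_fockR_mem_ladderGraph hd hħ hħ1 hf hΦ⟩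

end Ladder

/-! ### Linearity in the form factor, and adjoints -/

section Adjoint

variable {d : ℕ} {ħ : ℝ}

theorem ladderGraph_sub_smul {b : Bool} {f f' : Mode d → ℂ} (t : ℝ) {Ψ Φ Φ' : Fock d}
    (h : (Ψ, Φ) ∈ ladderGraph b ħ f) (h' : (Ψ, Φ') ∈ ladderGraph b ħ f') :
    (Ψ, Φ - (t : ℂ) • Φ') ∈ ladderGraph b ħ (fun κ => f κ - (t : ℂ) * f' κ) := by
  cases b
  · intro N
    filter_upwards [h N, h' N, comp_sub Φ ((t : ℂ) • Φ') N, comp_smul (t : ℂ) Φ' N]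
      with K h1 h2 h3 h4
    have h5 : ∀ κ, star (f κ - (t : ℂ) * f' κ) * comp Ψ (N + 1) (Fin.cons κ K) =
        star (f κ) * comp Ψ (N + 1) (Fin.cons κ K) -
          (t : ℂ) * (star (f' κ) * comp Ψ (N + 1) (Fin.cons κ K)) := by
      intro κ
      have : star (t : ℂ) = t := Complex.conj_ofReal t
      rw [star_sub, star_mul', this]
      ring
    simp only [h5]
    refine ⟨h1.1.sub (h2.1.const_mul _), ?_⟩
    rw [integral_sub h1.1 (h2.1.const_mul _), integral_const_mul, h3, Pi.sub_apply, h4,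
      Pi.smul_apply, smul_eq_mul, h1.2, h2.2]
    ring
  · refine ⟨?_, fun N => ?_⟩
    · filter_upwards [h.1, h'.1, comp_sub Φ ((t : ℂ) • Φ') 0, comp_smul (t : ℂ) Φ' 0]
        with K h1 h2 h3 h4
      rw [h3, Pi.sub_apply, h4, Pi.smul_apply, h1, h2]
      simp
    · filter_upwards [h.2 N, h'.2 N, comp_sub Φ ((t : ℂ) • Φ') (N + 1),
        comp_smul (t : ℂ) Φ' (N + 1)] with K h1 h2 h3 h4
      rw [h3, Pi.sub_apply, h4, Pi.smul_apply, smul_eq_mul, h1, h2]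
      simp only [sub_mul, Finset.sum_sub_distrib, mul_assoc, ← Finset.mul_sum]
      ring

/-- The weight (1 + |k|)|k|⁻¹ is at least 1. Plain square integrability is what the Fubini argument
for the adjoint needs. -/
theorem IsCoupling.memLp (hd : 0 < d) {f : Mode d → ℂ} (hf : IsCoupling 1 f) :
    MemLp f 2 (modeMeasure d) := by
  refine ⟨hf.aesm, ?_⟩
  rw [eLpNorm_lt_top_iff_lintegral_rpow_enorm_lt_top (by norm_num) (by norm_num)]
  refine lt_of_le_of_lt ?_ hf.fin.lt_top
  refine lintegral_mono_ae ?_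
  filter_upwards [ae_mode_ne_zero hd] with κ hκ
  have h1 : (1 : ℝ≥0∞) ≤ ENNReal.ofReal ((1 + ‖κ.1‖) ^ 1) * ‖κ.1‖ₑ⁻¹ := by
    rw [← div_eq_mul_inv, ENNReal.le_div_iff_mul_le (by simp [hκ]) (by simp), one_mul,
      ← ofReal_norm]
    exact ENNReal.ofReal_le_ofReal (by linarith)
  simp only [ENNReal.toReal_ofNat, ENNReal.rpow_ofNat]
  exact le_mul_of_one_le_left (zero_le) h1

theorem memLp_comp (Ψ : Fock d) (N : ℕ) : MemLp (comp Ψ N) 2 (photonMeasure d N) := Lp.memLp _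

theorem integrable_removeNth (hd : 0 < d) {f : Mode d → ℂ} (hf : IsCoupling 1 f) (φ ψ : Fock d)
    {N : ℕ} (j : Fin (N + 1)) :
    Integrable (fun K => f (K j) * inner ℂ (comp φ (N + 1) K) (comp ψ N (j.removeNth K)))
      (photonMeasure d (N + 1)) := by
  have hfψ : MemLp (fun K : Fin (N + 1) → Mode d => f (K j) * comp ψ N (j.removeNth K)) 2
      (photonMeasure d (N + 1)) := by
    have h1 : MemLp (fun p : (Fin N → Mode d) × Mode d => f p.2 * comp ψ N p.1) 2
        ((photonMeasure d N).prod (modeMeasure d)) := by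
      have hm : AEStronglyMeasurable (fun p : (Fin N → Mode d) × Mode d => f p.2 * comp ψ N p.1)
          ((photonMeasure d N).prod (modeMeasure d)) :=
        hf.aesm.comp_snd.mul (stronglyMeasurable_comp ψ N).aestronglyMeasurable.comp_fst
      rw [memLp_two_iff_integrable_sq_norm hm]
      have h2 := ((memLp_two_iff_integrable_sq_norm (memLp_comp ψ N).1).1 (memLp_comp ψ N)).mul_prod
        ((memLp_two_iff_integrable_sq_norm hf.aesm).1 (hf.memLp hd))
      refine h2.congr (Filter.Eventually.of_forall fun p => ?_)
      simp only [norm_mul]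
      ring
    have e := (measurePreserving_piFinSuccAbove (fun _ : Fin (N + 1) => modeMeasure d) j)
    have e' := (Measure.measurePreserving_swap
      (μ := modeMeasure d) (ν := photonMeasure d N)).comp e
    exact h1.comp_measurePreserving e'
  have h2 : Integrable (fun K => inner ℂ (comp φ (N + 1) K) (f (K j) * comp ψ N (j.removeNth K)))
      (photonMeasure d (N + 1)) := by
    have h3 := (memLp_comp φ (N + 1)).star
    have h4 := h3.integrable_mul hfψ
    refine h4.congr (Filter.Eventually.of_forall fun K => ?_)
    simp [RCLike.inner_apply, mul_comm]
  refine h2.congr (Filter.Eventually.of_forall fun K => ?_)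
  simp only [← smul_eq_mul, inner_smul_right]

theorem integral_insertNth {N : ℕ} (j : Fin (N + 1)) {h : (Fin (N + 1) → Mode d) → ℂ}
    (hh : Integrable h (photonMeasure d (N + 1))) :
    ∫ K, h K ∂photonMeasure d (N + 1) =
      ∫ K, ∫ κ, h (j.insertNth κ K) ∂modeMeasure d ∂photonMeasure d N := by
  have e := measurePreserving_insertNth (d := d) j
  rw [← e.map_eq] at hh ⊢
  rw [integral_map e.aemeasurable hh.aestronglyMeasurable]
  exact integral_prod _ (hh.comp_aemeasurable e.aemeasurable)

/-- The creation operator is the adjoint of the annihilation operator. -/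
theorem inner_annihilation_left (hd : 0 < d) (hħ : 0 < ħ) {f : Mode d → ℂ} (hf : IsCoupling 1 f)
    {φ φ' ψ ψ' : Fock d} (hφ : (φ, φ') ∈ annihilationGraph ħ f)
    (hψ : (ψ, ψ') ∈ creationGraph ħ f) : inner ℂ φ' ψ = inner ℂ φ ψ' := by
  rw [inner_eq_tsum_integral, inner_eq_tsum_integral,
    (summable_integral_inner φ ψ').tsum_eq_zero_add]
  have h0 : ∫ K, inner ℂ (comp φ 0 K) (comp ψ' 0 K) ∂photonMeasure d 0 = 0 := by
    rw [← integral_zero (Fin 0 → Mode d) ℂ (μ := photonMeasure d 0)]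
    refine integral_congr_ae ?_
    filter_upwards [hψ.1] with K hK
    rw [hK, inner_zero_right]
  rw [h0, zero_add]
  refine tsum_congr fun N => ?_
  have h1 : ∫ K, inner ℂ (comp φ' N K) (comp ψ N K) ∂photonMeasure d N =
      (Real.sqrt (ħ * (N + 1)) : ℂ) * ∫ K, ∫ κ, f κ *
        inner ℂ (comp φ (N + 1) (Fin.cons κ K)) (comp ψ N K) ∂modeMeasure d ∂photonMeasure d N := by
    rw [← integral_const_mul]
    refine integral_congr_ae ?_
    filter_upwards [hφ N] with K hK
    rw [hK.2]
    simp only [RCLike.inner_apply, map_mul, Complex.conj_ofReal]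
    rw [← integral_conj, mul_left_comm, ← integral_const_mul]
    congr 2
    funext κ
    simp
    ring
  -- By symmetry of φ every summand of the creation operator gives the same integral, so the sum is
  -- N + 1 times one of them.
  have h2 : ∀ j : Fin (N + 1),
      ∫ K, f (K j) * inner ℂ (comp φ (N + 1) K) (comp ψ N (j.removeNth K))
        ∂photonMeasure d (N + 1) = ∫ K, ∫ κ, f κ *
        inner ℂ (comp φ (N + 1) (Fin.cons κ K)) (comp ψ N K) ∂modeMeasure d ∂photonMeasure d N := by
    intro j
    rw [integral_insertNth j (integrable_removeNth hd hf φ ψ j)]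
    refine integral_congr_ae ?_
    filter_upwards [comp_insertNth φ j] with K hK
    refine integral_congr_ae ?_
    filter_upwards [hK] with κ hκ
    simp only [Fin.insertNth_apply_same, Fin.removeNth_insertNth, hκ]
  have h3 : ∫ K, inner ℂ (comp φ (N + 1) K) (comp ψ' (N + 1) K) ∂photonMeasure d (N + 1) =
      (Real.sqrt (ħ / (N + 1)) : ℂ) * ∑ j : Fin (N + 1),
        ∫ K, f (K j) * inner ℂ (comp φ (N + 1) K) (comp ψ N (j.removeNth K))
          ∂photonMeasure d (N + 1) := by
    rw [← integral_finsetSum _ fun j _ => integrable_removeNth hd hf φ ψ j, ← integral_const_mul]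
    refine integral_congr_ae ?_
    filter_upwards [hψ.2 N] with K hK
    rw [hK, ← smul_eq_mul, inner_smul_right, inner_sum]
    simp only [← smul_eq_mul, inner_smul_right]
  rw [h1, h3]
  simp only [h2, Finset.sum_const, Finset.card_univ, Fintype.card_fin, nsmul_eq_mul]
  rw [← mul_assoc]
  congr 1
  -- The normalizations of annihilation and creation differ by exactly the number of summands.
  have h4 : Real.sqrt (ħ * (N + 1)) = Real.sqrt (ħ / (N + 1)) * (N + 1) := by
    have h5 : (0 : ℝ) < N + 1 := by positivity
    rw [Real.sqrt_eq_iff_mul_self_eq (by positivity) (by positivity)]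
    rw [mul_mul_mul_comm, Real.mul_self_sqrt (by positivity)]
    field_simp
  rw [h4]
  push_cast
  ring

end Adjoint

/-! ### Field operators regularized by `R` -/

section Regularized

variable {d : ℕ} {ħ : ℝ}

open Classical in
/-- The bounded operators `a(f) R` and `a*(f) R`. -/
def ladderR (b : Bool) (ħ : ℝ) (f : Mode d → ℂ) : Fock d →L[ℂ] Fock d :=
  if h : ∃ T : Fock d →L[ℂ] Fock d, ∀ φ, (fockR d ħ φ, T φ) ∈ ladderGraph b ħ f
  then h.choose else 0

open Classical in
/-- The bounded operators `R⁻¹ a(f) R²` and `R⁻¹ a*(f) R²`. -/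
def ladderR₂ (b : Bool) (ħ : ℝ) (f : Mode d → ℂ) : Fock d →L[ℂ] Fock d :=
  if h : ∃ T : Fock d →L[ℂ] Fock d,
    ∀ φ, (fockR d ħ (fockR d ħ φ), fockR d ħ (T φ)) ∈ ladderGraph b ħ f
  then h.choose else 0

theorem ladderR_mem (hd : 0 < d) (hħ : 0 < ħ) (hħ1 : ħ < 1) (b : Bool) {f : Mode d → ℂ}
    (hf : IsCoupling 1 f) (φ : Fock d) :
    (fockR d ħ φ, ladderR b ħ f φ) ∈ ladderGraph b ħ f := by
  obtain ⟨T, hT, -⟩ := exists_ladderR hd hħ hħ1 b hf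
  have hex : ∃ T : Fock d →L[ℂ] Fock d, ∀ φ, (fockR d ħ φ, T φ) ∈ ladderGraph b ħ f := ⟨T, hT⟩
  rw [ladderR, dif_pos hex]
  exact hex.choose_spec φ

theorem ladderR₂_mem (hd : 0 < d) (hħ : 0 < ħ) (hħ1 : ħ < 1) (b : Bool) {f : Mode d → ℂ}
    (hf : IsCoupling 2 f) (φ : Fock d) :
    (fockR d ħ (fockR d ħ φ), fockR d ħ (ladderR₂ b ħ f φ)) ∈ ladderGraph b ħ f := by
  obtain ⟨T, hT, -⟩ := exists_ladderR₂ hd hħ hħ1 b hf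
  have hex : ∃ T : Fock d →L[ℂ] Fock d,
    ∀ φ, (fockR d ħ (fockR d ħ φ), fockR d ħ (T φ)) ∈ ladderGraph b ħ f := ⟨T, hT⟩
  rw [ladderR₂, dif_pos hex]
  exact hex.choose_spec φ

theorem fockR_ladderR₂ (hd : 0 < d) (hħ : 0 < ħ) (hħ1 : ħ < 1) (b : Bool) {f : Mode d → ℂ}
    (hf : IsCoupling 2 f) (φ : Fock d) :
    fockR d ħ (ladderR₂ b ħ f φ) = ladderR b ħ f (fockR d ħ φ) := by
  have h1 := ladderR₂_mem hd hħ hħ1 b hf φ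
  have h2 := ladderR_mem hd hħ hħ1 b (hf.mono one_le_two) (fockR d ħ φ)
  exact sub_eq_zero.1 (ladderGraph_functional b f _ (Submodule.sub_mem _ h1 h2) (sub_self _))

theorem norm_ladderR_le (hd : 0 < d) (hħ : 0 < ħ) (hħ1 : ħ < 1) (b : Bool) {f : Mode d → ℂ}
    (hf : IsCoupling 1 f) : ‖ladderR b ħ f‖ ≤ couplingNorm 1 f :=
  ContinuousLinearMap.opNorm_le_bound _ (couplingNorm_nonneg 1 f) fun φ =>
    norm_le_of_mem_ladderGraph hd hħ hħ1 hf (ladderR_mem hd hħ hħ1 b hf φ)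

theorem norm_ladderR₂_le (hd : 0 < d) (hħ : 0 < ħ) (hħ1 : ħ < 1) (b : Bool) {f : Mode d → ℂ}
    (hf : IsCoupling 2 f) : ‖ladderR₂ b ħ f‖ ≤ couplingNorm 2 f :=
  ContinuousLinearMap.opNorm_le_bound _ (couplingNorm_nonneg 2 f) fun φ =>
    norm_le_of_fockR_mem_ladderGraph hd hħ hħ1 hf (ladderR₂_mem hd hħ hħ1 b hf φ)

theorem ladderR_sub_smul (hd : 0 < d) (hħ : 0 < ħ) (hħ1 : ħ < 1) (b : Bool) {f f' : Mode d → ℂ}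
    (t : ℝ) (hf : IsCoupling 1 f) (hf' : IsCoupling 1 f')
    (hff : IsCoupling 1 fun κ => f κ - (t : ℂ) * f' κ) :
    ladderR b ħ (fun κ => f κ - (t : ℂ) * f' κ) = ladderR b ħ f - (t : ℂ) • ladderR b ħ f' := by
  ext1 φ
  have h1 := ladderR_mem hd hħ hħ1 b hff φ
  have h2 := ladderGraph_sub_smul t (ladderR_mem hd hħ hħ1 b hf φ) (ladderR_mem hd hħ hħ1 b hf' φ)
  exact sub_eq_zero.1 (ladderGraph_functional b _ _ (Submodule.sub_mem _ h1 h2) (sub_self _))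

theorem ladderR₂_sub (hd : 0 < d) (hħ : 0 < ħ) (hħ1 : ħ < 1) (b : Bool) {f f' : Mode d → ℂ}
    (hf : IsCoupling 2 f) (hf' : IsCoupling 2 f')
    (hff : IsCoupling 2 fun κ => f κ - ((1 : ℝ) : ℂ) * f' κ) :
    ladderR₂ b ħ (fun κ => f κ - ((1 : ℝ) : ℂ) * f' κ) = ladderR₂ b ħ f - ladderR₂ b ħ f' := by
  ext1 φ
  refine fockR_injective hħ.le ?_
  have h1 := ladderR₂_mem hd hħ hħ1 b hff φ
  have h2 := ladderGraph_sub_smul 1 (ladderR₂_mem hd hħ hħ1 b hf φ)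
    (ladderR₂_mem hd hħ hħ1 b hf' φ)
  have h3 := sub_eq_zero.1 (ladderGraph_functional b _ _ (Submodule.sub_mem _ h1 h2) (sub_self _))
  simpa using h3

/-- Symmetry of a(f) + a*(f) on the range of R: the two adjoint relations exchange the summands. -/
theorem inner_ladderR (hd : 0 < d) (hħ : 0 < ħ) (hħ1 : ħ < 1) {f : Mode d → ℂ}
    (hf : IsCoupling 1 f) (φ ψ : Fock d) :
    inner ℂ (ladderR false ħ f φ + ladderR true ħ f φ) (fockR d ħ ψ) =
      inner ℂ (fockR d ħ φ) (ladderR false ħ f ψ + ladderR true ħ f ψ) := by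
  have h1 := inner_annihilation_left hd hħ hf (ladderR_mem hd hħ hħ1 false hf φ)
    (ladderR_mem hd hħ hħ1 true hf ψ)
  have h2 := inner_annihilation_left hd hħ hf (ladderR_mem hd hħ hħ1 false hf ψ)
    (ladderR_mem hd hħ hħ1 true hf φ)
  have h3 := congrArg (starRingEnd ℂ) h2
  simp only [inner_conj_symm] at h3
  rw [inner_add_left, inner_add_right, h1, ← h3, add_comm]

theorem energyOp_comm (hħ : 0 ≤ ħ) {g h : ℝ → ℝ} {C C' : ℝ} (hg : IsBoundedEnergyFun g C)
    (hh : IsBoundedEnergyFun h C') (Ψ : Fock d) :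
    energyOp d ħ g (energyOp d ħ h Ψ) = energyOp d ħ h (energyOp d ħ g Ψ) := by
  refine Fock.ext_comp fun N => ?_
  filter_upwards [comp_energyOp hħ hg (energyOp d ħ h Ψ) N, comp_energyOp hħ hh Ψ N,
    comp_energyOp hħ hh (energyOp d ħ g Ψ) N, comp_energyOp hħ hg Ψ N] with K h1 h2 h3 h4
  rw [h1, h2, h3, h4]
  ring

theorem norm_commutator_ladderR_le (hd : 0 < d) (hħ : 0 < ħ) (hħ1 : ħ < 1) (b : Bool)
    {f : Mode d → ℂ} (hf : IsCoupling 1 f) (hf' : IsCoupling 1 fun κ => (‖κ.1‖ : ℂ) * f κ)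
    {g : ℝ → ℝ} {C : ℝ} (hg : IsBoundedEnergyFun g C)
    (hlip : ∀ e e', 0 ≤ e → 0 ≤ e' → |g e - g e'| ≤ |e - e'|) (φ : Fock d) :
    ‖ladderR b ħ f (energyOp d ħ g φ) - energyOp d ħ g (ladderR b ħ f φ)‖ ≤
      couplingNorm 1 (fun κ => (‖κ.1‖ : ℂ) * f κ) * ‖φ‖ := by
  have h1 := ladderR_mem hd hħ hħ1 b hf φ
  have h2 := ladderR_mem hd hħ hħ1 b hf (energyOp d ħ g φ)
  rw [← energyOp_comm hħ.le hg isBoundedEnergyFun_invSqrtFun] at h2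
  have h3 := isLadderDominated_commutator hħ hħ1 hg hlip h1 h2
  have h4 : (fun κ : Mode d => ‖κ.1‖ₑ * ‖f κ‖ₑ) = fun κ => ‖(‖κ.1‖ : ℂ) * f κ‖ₑ := by
    funext κ
    rw [enorm_mul, enorm_ofReal_complex, enorm_norm]
  rw [h4] at h3
  exact h3.norm_le hd hħ hħ1 hf'.aesm.enorm hf'.fin

end Regularized

/-! ### Kinetic momenta with a regularized field -/

section Kinetic

open Filter Topology

variable {H : Type*} [NormedAddCommGroup H] [InnerProductSpace ℂ H]

/-- A symmetric closed operator (with graph `P`) commuting with the bounded operators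
`R = L⁻¹`, `res k → 1`, `L res k` and `L² res k`. -/
structure RegularizedMomentum (P : Submodule ℂ (H × H)) (R : H →L[ℂ] H)
    (res L F : ℕ → H →L[ℂ] H) : Prop where
  functional : IsFunctional P
  symm : ∀ {u u' w w'}, (u, u') ∈ P → (w, w') ∈ P → inner ℂ u' w = inner ℂ u w'
  closed : ∀ {u u' : ℕ → H} {x x' : H}, (∀ k, (u k, u' k) ∈ P) → Tendsto u atTop (𝓝 x) →
    Tendsto u' atTop (𝓝 x') → (x, x') ∈ P
  R_mem : ∀ {u u'}, (u, u') ∈ P → (R u, R u') ∈ P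
  L_mem : ∀ k {u u'}, (u, u') ∈ P → (L k u, L k u') ∈ P
  F_mem : ∀ k {u u'}, (u, u') ∈ P → (F k u, F k u') ∈ P
  R_symm : ∀ u w, inner ℂ (R u) w = inner ℂ u (R w)
  L_symm : ∀ k u w, inner ℂ (L k u) w = inner ℂ u (L k w)
  R_F : ∀ k u, R (F k u) = L k u
  F_R : ∀ k u, F k (R u) = L k u
  R_L : ∀ k u, R (L k u) = res k u
  L_R : ∀ k u, L k (R u) = res k u
  norm_R : ∀ u, ‖R u‖ ≤ ‖u‖
  norm_res : ∀ k u, ‖res k u‖ ≤ ‖u‖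
  tendsto_res : ∀ u, Tendsto (fun k => res k u) atTop (𝓝 u)

variable {P : Submodule ℂ (H × H)} {R : H →L[ℂ] H} {res L F : ℕ → H →L[ℂ] H}

namespace RegularizedMomentum

theorem res_R (h : RegularizedMomentum P R res L F) (k : ℕ) (u : H) :
    res k (R u) = R (res k u) := by
  rw [← h.R_L, h.L_R]

/-- One p is moved across by symmetry, and both regularizing factors are then collected on the left
of ψ''. This trades a half power of energy on ψ' = pψ for a full power on ψ, where η = (1 + H_f)ψ is
available. -/
theorem norm_sub_sq (h : RegularizedMomentum P R res L F) {η ψ' ψ'' : H}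
    (h1 : (R (R η), ψ') ∈ P) (h2 : (ψ', ψ'') ∈ P) (k l : ℕ) :
    inner ℂ (L k ψ' - L l ψ') (L k ψ' - L l ψ') =
      inner ℂ (res k (res k η - res l η) - res l (res k η - res l η)) ψ'' := by
  have e1 := P.sub_mem (h.L_mem k h1) (h.L_mem l h1)
  have e2 := P.sub_mem (h.L_mem k h2) (h.L_mem l h2)
  have e3 : L k (R (R η)) - L l (R (R η)) = R (res k η - res l η) := by
    rw [h.L_R, h.L_R, h.res_R, h.res_R, map_sub]
  calc _ = inner ℂ (L k (R (R η)) - L l (R (R η))) (L k ψ'' - L l ψ'') := h.symm e1 e2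
    _ = _ := by
      rw [inner_sub_right, ← h.L_symm, ← h.L_symm, ← inner_sub_left, e3, h.L_R, h.L_R]

theorem inner_L (h : RegularizedMomentum P R res L F) {η ψ' ψ'' : H}
    (h1 : (R (R η), ψ') ∈ P) (h2 : (ψ', ψ'') ∈ P) (k : ℕ) :
    inner ℂ (L k ψ') (L k ψ') = inner ℂ (res k (res k η)) ψ'' := by
  calc _ = inner ℂ (L k (R (R η))) (L k ψ'') := h.symm (h.L_mem k h1) (h.L_mem k h2)
    _ = _ := by rw [← h.L_symm, h.L_R, h.res_R, h.L_R]

theorem tendsto_res_res (h : RegularizedMomentum P R res L F) (u : H) :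
    Tendsto (fun k => res k (res k u)) atTop (𝓝 u) := by
  have h1 : Tendsto (fun k => res k (res k u - u)) atTop (𝓝 0) := by
    refine squeeze_zero_norm (fun k => h.norm_res k _) ?_
    have := ((h.tendsto_res u).sub_const u).norm
    simpa using this
  have h2 := h1.add (h.tendsto_res u)
  simpa using h2

/-- `L p R² η` exists as soon as `p² R² η` does. -/
theorem exists_L_momentum [CompleteSpace H] (h : RegularizedMomentum P R res L F) {η ψ' ψ'' : H}
    (h1 : (R (R η), ψ') ∈ P) (h2 : (ψ', ψ'') ∈ P) :
    ∃ θ, (R η, θ) ∈ P ∧ R θ = ψ' ∧ RCLike.re (inner ℂ ψ'' η) = ‖θ‖ ^ 2 := by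
  -- The resolvents are contractions and converge strongly on η, so this estimate makes the
  -- approximations of (1 + H_f)^{1/2}pψ a Cauchy sequence.
  have hle : ∀ k l, ‖L k ψ' - L l ψ'‖ ^ 2 ≤ 2 * ‖ψ''‖ * ‖res k η - res l η‖ := by
    intro k l
    rw [← inner_self_eq_norm_sq (𝕜 := ℂ), h.norm_sub_sq h1 h2]
    refine (RCLike.re_le_norm _).trans ((norm_inner_le_norm _ _).trans ?_)
    have : ‖res k (res k η - res l η) - res l (res k η - res l η)‖ ≤ 2 * ‖res k η - res l η‖ := by
      refine (norm_sub_le _ _).trans ?_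
      linarith [h.norm_res k (res k η - res l η), h.norm_res l (res k η - res l η)]
    nlinarith [norm_nonneg ψ'']
  have hcauchy : CauchySeq fun k => L k ψ' := by
    rw [Metric.cauchySeq_iff]
    intro r hr
    have hres := (h.tendsto_res η).cauchySeq
    rw [Metric.cauchySeq_iff] at hres
    obtain ⟨N, hN⟩ := hres (r ^ 2 / (2 * ‖ψ''‖ + 1)) (by positivity)
    refine ⟨N, fun k hk l hl => ?_⟩
    have h3 := hN k hk l hl
    rw [dist_eq_norm, lt_div_iff₀ (by positivity)] at h3
    rw [dist_eq_norm]
    refine lt_of_pow_lt_pow_left₀ 2 hr.le ((hle k l).trans_lt ?_)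
    nlinarith [norm_nonneg (res k η - res l η)]
  obtain ⟨θ, hθ⟩ := cauchySeq_tendsto_of_complete hcauchy
  have hφ : (R η, θ) ∈ P := by
    refine h.closed (fun k => h.L_mem k h1) ?_ hθ
    simp only [h.L_R]
    exact h.tendsto_res _
  refine ⟨θ, hφ, ?_, ?_⟩
  · exact sub_eq_zero.1 (h.functional _ (P.sub_mem (h.R_mem hφ) h1) (sub_self _))
  -- At finite k the pairing is exactly ‖L k ψ'‖²; both sides converge.
  · have e1 : Tendsto (fun k => RCLike.re (inner ℂ ψ'' (res k (res k η)))) atTop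
        (𝓝 (RCLike.re (inner ℂ ψ'' η))) :=
      (RCLike.continuous_re.tendsto _).comp (tendsto_const_nhds.inner (h.tendsto_res_res η))
    refine tendsto_nhds_unique e1 ((hθ.norm.pow 2).congr fun k => ?_)
    rw [← inner_self_eq_norm_sq (𝕜 := ℂ), h.inner_L h1 h2, ← inner_conj_symm, RCLike.conj_re]

end RegularizedMomentum

/-- A field `A` commuting with the momentum up to lower order, given through `B = A R`,
`B₂ = R⁻¹ A R²` and the regularized commutator `B' = [p, A] R`. -/
structure RegularizedField (P : Submodule ℂ (H × H)) (R : H →L[ℂ] H) (F : ℕ → H →L[ℂ] H)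
    (B B₂ B' : H →L[ℂ] H) (K : ℝ) : Prop where
  R_B₂ : ∀ u, R (B₂ u) = B (R u)
  symm : ∀ u w, inner ℂ (B u) (R w) = inner ℂ (R u) (B w)
  B_mem : ∀ {u u'}, (u, u') ∈ P → (B u, B u' + B' u) ∈ P
  norm_B : ∀ u, ‖B u‖ ≤ K * ‖u‖
  norm_B₂ : ∀ u, ‖B₂ u‖ ≤ K * ‖u‖
  norm_B' : ∀ u, ‖B' u‖ ≤ K * ‖u‖
  norm_comm : ∀ k u, ‖B (F k u) - F k (B u)‖ ≤ K * ‖u‖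

variable {B B₂ B' : H →L[ℂ] H} {K : ℝ}

theorem RegularizedField.kinetic_symm (h : RegularizedMomentum P R res L F)
    (hB : RegularizedField P R F B B₂ B' K) {u u' w w' : H} (hu : (R u, u') ∈ P)
    (hw : (R w, w') ∈ P) : inner ℂ (u' - B u) (R w) = inner ℂ (R u) (w' - B w) := by
  rw [inner_sub_left, inner_sub_right, h.symm hu hw, hB.symm]

/-- The estimates for `(p - A)²` relative to `p²`. -/
theorem RegularizedField.exists_kinetic [CompleteSpace H] (hK : 0 ≤ K)
    (h : RegularizedMomentum P R res L F)
    (hB : RegularizedField P R F B B₂ B' K) {η ψ' ψ'' : H}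
    (h1 : (R (R η), ψ') ∈ P) (h2 : (ψ', ψ'') ∈ P) :
    ∃ θ ξ π' : H, R ξ = ψ' - B (R η) ∧ (R ξ, π') ∈ P ∧
      0 ≤ RCLike.re (inner ℂ (R (R η)) (π' - B ξ)) ∧
      RCLike.re (inner ℂ ψ'' η) = ‖θ‖ ^ 2 ∧
      ‖ξ‖ ^ 2 - K * (2 + K) * ‖ξ‖ * ‖R η‖ ≤ RCLike.re (inner ℂ (π' - B ξ) η) ∧
      ‖ψ'' - (π' - B ξ)‖ ≤ K * (2 + K) * (‖θ‖ + ‖η‖) ∧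
      ‖ψ'' - (π' - B ξ)‖ ≤ K * (2 + K) * (‖ξ‖ + ‖η‖) := by
  obtain ⟨θ, hφ, hθ, hθn⟩ := h.exists_L_momentum h1 h2
  set φ := R η with hφdef
  -- Formally ξ = (1 + H_f)^{1/2}(p - A)ψ, since θ is (1 + H_f)^{1/2}pψ and B₂η is (1 +
  -- H_f)^{1/2}Aψ.
  set ξ := θ - B₂ η with hξ
  have hRξ : R ξ = ψ' - B φ := by rw [hξ, map_sub, hθ, hB.R_B₂]
  -- Product rule for p(Aψ), with A pψ = Bθ and [p, A]ψ = B'φ. Hence (p - A)ψ lies in the domain of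
  -- p, and as an element of the range of R also in that of A.
  have hπ : (R ξ, ψ'' - (B θ + B' φ)) ∈ P := by
    rw [hRξ]
    exact P.sub_mem h2 (hB.B_mem hφ)
  have hφη : ‖φ‖ ≤ ‖η‖ := h.norm_R η
  have hdiff : ψ'' - (ψ'' - (B θ + B' φ) - B ξ) = B θ + B' φ + B ξ := by abel
  have hdn : ‖ψ'' - (ψ'' - (B θ + B' φ) - B ξ)‖ ≤ K * ‖θ‖ + K * ‖η‖ + K * ‖ξ‖ := by
    rw [hdiff]
    refine (norm_add₃_le).trans ?_
    have := hB.norm_B' φ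
    have := mul_le_mul_of_nonneg_left hφη hK
    linarith [hB.norm_B θ, hB.norm_B ξ]
  have hξθ : ‖ξ‖ ≤ ‖θ‖ + K * ‖η‖ := (norm_sub_le _ _).trans (by linarith [hB.norm_B₂ η])
  have hθξ : ‖θ‖ ≤ ‖ξ‖ + K * ‖η‖ := by
    have : θ = ξ + B₂ η := by rw [hξ]; abel
    rw [this]
    exact (norm_add_le _ _).trans (by linarith [hB.norm_B₂ η])
  refine ⟨θ, ξ, ψ'' - (B θ + B' φ), hRξ, hπ, ?_, hθn, ?_, ?_, ?_⟩
  · rw [← hB.kinetic_symm h h1 hπ, ← hRξ]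
    exact inner_self_nonneg
  · set q := ψ'' - (B θ + B' φ) - B ξ with hq
    -- With F k in place of 1 + H_f, p - A can be moved onto the right factor. Commuting it past F k
    -- gives ⟨ξ, res k ξ⟩ and an error in [B, F k] that is bounded uniformly in k; only then k → ∞.
    have hk : ∀ k, RCLike.re (inner ℂ ξ (res k ξ)) - K * ‖ξ‖ * ‖φ‖ ≤
        RCLike.re (inner ℂ q (res k η)) := by
      intro k
      have e1 : (R (F k φ), F k ψ') ∈ P := by
        have := h.F_mem k h1
        rwa [h.F_R, ← h.R_F] at this
      have e2 : R (F k φ) = res k η := by rw [h.R_F, hφdef, h.L_R]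
      have e3 := hB.kinetic_symm h hπ e1
      rw [e2] at e3
      rw [hq, e3]
      have e4 : F k ψ' - B (F k φ) = F k (R ξ) - (B (F k φ) - F k (B φ)) := by
        rw [hRξ, map_sub]; abel
      rw [e4, inner_sub_right, h.R_symm ξ (F k (R ξ)), h.F_R, h.R_L,
        show ∀ a b : ℂ, RCLike.re (a - b) = RCLike.re a - RCLike.re b from fun a b => map_sub _ a b]
      have e5 : RCLike.re (inner ℂ (R ξ) (B (F k φ) - F k (B φ))) ≤ K * ‖ξ‖ * ‖φ‖ := by
        refine (RCLike.re_le_norm _).trans ((norm_inner_le_norm _ _).trans ?_)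
        calc _ ≤ ‖ξ‖ * (K * ‖φ‖) := by
              gcongr
              · exact h.norm_R ξ
              · exact hB.norm_comm k φ
          _ = _ := by ring
      linarith
    have e6 : Tendsto (fun k => RCLike.re (inner ℂ ξ (res k ξ)) - K * ‖ξ‖ * ‖φ‖) atTop
        (𝓝 (‖ξ‖ ^ 2 - K * ‖ξ‖ * ‖φ‖)) := by
      rw [← inner_self_eq_norm_sq (𝕜 := ℂ) ξ]
      exact ((RCLike.continuous_re.tendsto _).comp
        (tendsto_const_nhds.inner (h.tendsto_res ξ))).sub_const _
    have e7 : Tendsto (fun k => RCLike.re (inner ℂ q (res k η))) atTop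
        (𝓝 (RCLike.re (inner ℂ q η))) :=
      (RCLike.continuous_re.tendsto _).comp (tendsto_const_nhds.inner (h.tendsto_res η))
    have e8 := le_of_tendsto_of_tendsto' e6 e7 hk
    have e9 : 0 ≤ ‖ξ‖ * ‖φ‖ := by positivity
    nlinarith [mul_nonneg hK e9, mul_nonneg (mul_nonneg hK hK) e9]
  · refine hdn.trans ?_
    nlinarith [mul_le_mul_of_nonneg_left hξθ hK, mul_nonneg hK (norm_nonneg η),
      mul_nonneg (mul_nonneg hK hK) (norm_nonneg θ)]
  · refine hdn.trans ?_
    nlinarith [mul_le_mul_of_nonneg_left hθξ hK, mul_nonneg hK (norm_nonneg η),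
      mul_nonneg (mul_nonneg hK hK) (norm_nonneg ξ)]

end Kinetic

/-! ### The coupling functions -/

section Coupling

open Filter Topology

variable {d : ℕ} {m j : ℕ} {f g : Mode d → ℂ} {c : ℝ}

theorem couplingIntegrand_le (hc : 0 ≤ c) {κ : Mode d}
    (h : ‖g κ‖ ≤ c * (1 + ‖κ.1‖) ^ j * ‖f κ‖) :
    ENNReal.ofReal ((1 + ‖κ.1‖) ^ m) * ‖κ.1‖ₑ⁻¹ * ‖g κ‖ₑ ^ 2 ≤ ENNReal.ofReal (c ^ 2) *
      (ENNReal.ofReal ((1 + ‖κ.1‖) ^ (m + 2 * j)) * ‖κ.1‖ₑ⁻¹ * ‖f κ‖ₑ ^ 2) := by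
  have h1 : ‖g κ‖ₑ ≤ ENNReal.ofReal (c * (1 + ‖κ.1‖) ^ j) * ‖f κ‖ₑ := by
    rw [← ofReal_norm, ← ofReal_norm, ← ENNReal.ofReal_mul (by positivity)]
    exact ENNReal.ofReal_le_ofReal h
  calc _ ≤ ENNReal.ofReal ((1 + ‖κ.1‖) ^ m) * ‖κ.1‖ₑ⁻¹ *
        (ENNReal.ofReal (c * (1 + ‖κ.1‖) ^ j) * ‖f κ‖ₑ) ^ 2 := by gcongr
    _ = _ := by
      rw [pow_add, ENNReal.ofReal_mul hc, ENNReal.ofReal_mul (p := (1 + ‖κ.1‖) ^ m) (by positivity),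
        pow_mul', ENNReal.ofReal_pow hc, ENNReal.ofReal_pow (n := 2) (by positivity)]
      ring

/-- A multiplier growing like (1 + |k|)^j raises the weight exponent by 2j, the form being
quadratic. -/
theorem couplingForm_le_of_norm_le (hc : 0 ≤ c)
    (h : ∀ᵐ κ ∂modeMeasure d, ‖g κ‖ ≤ c * (1 + ‖κ.1‖) ^ j * ‖f κ‖) :
    couplingForm m (fun κ => ‖g κ‖ₑ) ≤
      ENNReal.ofReal (c ^ 2) * couplingForm (m + 2 * j) (fun κ => ‖f κ‖ₑ) := by
  rw [couplingForm, couplingForm, ← lintegral_const_mul' _ _ ENNReal.ofReal_ne_top]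
  refine lintegral_mono_ae ?_
  filter_upwards [h] with κ hκ
  exact couplingIntegrand_le hc hκ

theorem IsCoupling.of_norm_le (hf : IsCoupling (m + 2 * j) f)
    (hg : AEStronglyMeasurable g (modeMeasure d)) (hc : 0 ≤ c)
    (h : ∀ᵐ κ ∂modeMeasure d, ‖g κ‖ ≤ c * (1 + ‖κ.1‖) ^ j * ‖f κ‖) : IsCoupling m g :=
  ⟨hg, ne_top_of_le_ne_top (ENNReal.mul_ne_top ENNReal.ofReal_ne_top hf.fin)
    (couplingForm_le_of_norm_le hc h)⟩

theorem couplingNorm_le_of_norm_le (hf : IsCoupling (m + 2 * j) f) (hc : 0 ≤ c)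
    (h : ∀ᵐ κ ∂modeMeasure d, ‖g κ‖ ≤ c * (1 + ‖κ.1‖) ^ j * ‖f κ‖) :
    couplingNorm m g ≤ c * couplingNorm (m + 2 * j) f := by
  rw [couplingNorm, couplingNorm, ← Real.sqrt_sq hc, ← Real.sqrt_mul (sq_nonneg c)]
  refine Real.sqrt_le_sqrt ?_
  have h0 : c ^ 2 = (ENNReal.ofReal (c ^ 2)).toReal := (ENNReal.toReal_ofReal (sq_nonneg c)).symm
  rw [h0, ← ENNReal.toReal_mul]
  exact ENNReal.toReal_mono (ENNReal.mul_ne_top ENNReal.ofReal_ne_top hf.fin)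
    (couplingForm_le_of_norm_le hc h)

theorem couplingNorm_mono {m' : ℕ} (hf : IsCoupling m' f) (h : m ≤ m') :
    couplingNorm m f ≤ couplingNorm m' f :=
  Real.sqrt_le_sqrt (ENNReal.toReal_mono hf.fin (couplingForm_mono h _))

theorem couplingNorm_congr (h : ∀ κ, ‖g κ‖ = ‖f κ‖) : couplingNorm m g = couplingNorm m f := by
  have : (fun κ => ‖g κ‖ₑ) = fun κ => ‖f κ‖ₑ := by
    funext κ
    rw [← ofReal_norm, h, ofReal_norm]
  rw [couplingNorm, couplingNorm, this]

theorem couplingNorm_smul (t : ℝ) (f : Mode d → ℂ) :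
    couplingNorm m (fun κ => t • f κ) = |t| * couplingNorm m f := by
  have : couplingForm m (fun κ => ‖t • f κ‖ₑ) =
      ENNReal.ofReal (|t| ^ 2) * couplingForm m (fun κ => ‖f κ‖ₑ) := by
    rw [couplingForm, couplingForm, ← lintegral_const_mul' _ _ ENNReal.ofReal_ne_top]
    refine lintegral_congr fun κ => ?_
    rw [enorm_smul, ENNReal.ofReal_pow (abs_nonneg t), ← Real.norm_eq_abs, ofReal_norm]
    ring
  rw [couplingNorm, this, ENNReal.toReal_mul, ENNReal.toReal_ofReal (sq_nonneg _),
    Real.sqrt_mul (sq_nonneg _), Real.sqrt_sq (abs_nonneg t), couplingNorm]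

/-- Dominated convergence for coupling functions. -/
theorem tendsto_couplingNorm (hd : 0 < d) {ι : Type*} {l : Filter ι} [l.IsCountablyGenerated]
    {F : ι → Mode d → ℂ} (hf : IsCoupling (m + 2 * j) f)
    (hF : ∀ i, AEStronglyMeasurable (F i) (modeMeasure d)) (hc : 0 ≤ c)
    (h : ∀ i κ, ‖F i κ‖ ≤ c * (1 + ‖κ.1‖) ^ j * ‖f κ‖)
    (h0 : ∀ κ, Tendsto (fun i => F i κ) l (𝓝 0)) :
    Tendsto (fun i => couplingNorm m (F i)) l (𝓝 0) := by
  have h1 : Tendsto (fun i => couplingForm m fun κ => ‖F i κ‖ₑ) l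
      (𝓝 (∫⁻ _ : Mode d, 0 ∂modeMeasure d)) := by
    refine tendsto_lintegral_filter_of_dominated_convergence'
      (fun κ => ENNReal.ofReal (c ^ 2) * (ENNReal.ofReal ((1 + ‖κ.1‖) ^ (m + 2 * j)) *
        ‖κ.1‖ₑ⁻¹ * ‖f κ‖ₑ ^ 2)) ?_ ?_ ?_ ?_
    · refine Eventually.of_forall fun i => ?_
      have := (hF i).enorm
      fun_prop
    · refine Eventually.of_forall fun i => Eventually.of_forall fun κ => ?_
      exact couplingIntegrand_le hc (h i κ)
    · rw [lintegral_const_mul' _ _ ENNReal.ofReal_ne_top]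
      exact ENNReal.mul_ne_top ENNReal.ofReal_ne_top hf.fin
    · filter_upwards [ae_mode_ne_zero hd] with κ hκ
      have h2 : Tendsto (fun i => ‖F i κ‖ₑ ^ 2) l (𝓝 (0 ^ 2)) := by
        refine ((ENNReal.continuous_pow 2).tendsto _).comp ?_
        have h3 := (continuous_enorm.tendsto _).comp (h0 κ)
        rwa [enorm_zero] at h3
      have h3 := ENNReal.Tendsto.const_mul (a := ENNReal.ofReal ((1 + ‖κ.1‖) ^ m) * ‖κ.1‖ₑ⁻¹) h2
        (Or.inr (ENNReal.mul_ne_top ENNReal.ofReal_ne_top (by simpa using hκ)))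
      simpa using h3
  rw [lintegral_zero] at h1
  have h2 := (Real.continuous_sqrt.tendsto _).comp
    ((ENNReal.tendsto_toReal ENNReal.zero_ne_top).comp h1)
  rwa [ENNReal.toReal_zero, Real.sqrt_zero] at h2

/-- The form factor `f(k, λ) exp(-2πi k·q)`. -/
def twist (f : Mode d → ℂ) (q : EuclideanSpace ℝ (Fin d)) : Mode d → ℂ := fun κ =>
  f κ * Complex.exp (-(2 * Real.pi * inner ℝ κ.1 q : ℝ) * Complex.I)

/-- The derivative of `twist f` at `0` in the direction `v`. -/
def twistSlope (f : Mode d → ℂ) (v : EuclideanSpace ℝ (Fin d)) : Mode d → ℂ := fun κ =>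
  f κ * (-(2 * Real.pi * inner ℝ κ.1 v : ℝ) * Complex.I)

theorem norm_twist (f : Mode d → ℂ) (q : EuclideanSpace ℝ (Fin d)) (κ : Mode d) :
    ‖twist f q κ‖ = ‖f κ‖ := by
  rw [twist, norm_mul, ← Complex.ofReal_neg, Complex.norm_exp_ofReal_mul_I, mul_one]

theorem twist_add (f : Mode d → ℂ) (q v : EuclideanSpace ℝ (Fin d)) (κ : Mode d) :
    twist f (q + v) κ =
      twist f v κ * Complex.exp (-(2 * Real.pi * inner ℝ κ.1 q : ℝ) * Complex.I) := by
  rw [twist, twist, inner_add_right, mul_assoc (f κ), ← Complex.exp_add]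
  push_cast
  ring_nf

theorem abs_slope_le (k v : EuclideanSpace ℝ (Fin d)) :
    |2 * Real.pi * inner ℝ k v| ≤ 2 * Real.pi * ‖v‖ * ‖k‖ := by
  rw [abs_mul, abs_of_pos Real.two_pi_pos, mul_assoc (2 * Real.pi), mul_comm ‖v‖]
  exact mul_le_mul_of_nonneg_left (abs_real_inner_le_norm k v) Real.two_pi_pos.le

theorem norm_twistSlope_le (f : Mode d → ℂ) (v : EuclideanSpace ℝ (Fin d)) (κ : Mode d) :
    ‖twistSlope f v κ‖ ≤ 2 * Real.pi * ‖v‖ * ‖κ.1‖ * ‖f κ‖ := by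
  rw [twistSlope, norm_mul, norm_mul, Complex.norm_I, mul_one, norm_neg, Complex.norm_real,
    Real.norm_eq_abs, mul_comm]
  gcongr
  exact abs_slope_le _ _

theorem aestronglyMeasurable_twist (hf : AEStronglyMeasurable f (modeMeasure d))
    (q : EuclideanSpace ℝ (Fin d)) : AEStronglyMeasurable (twist f q) (modeMeasure d) :=
  hf.mul (by fun_prop : Measurable fun κ : Mode d =>
    Complex.exp (-(2 * Real.pi * inner ℝ κ.1 q : ℝ) * Complex.I)).aestronglyMeasurable

theorem aestronglyMeasurable_twistSlope (hf : AEStronglyMeasurable f (modeMeasure d))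
    (v : EuclideanSpace ℝ (Fin d)) : AEStronglyMeasurable (twistSlope f v) (modeMeasure d) :=
  hf.mul (by fun_prop : Measurable fun κ : Mode d =>
    (-(2 * Real.pi * inner ℝ κ.1 v : ℝ) * Complex.I : ℂ)).aestronglyMeasurable

theorem IsCoupling.twist (hf : IsCoupling m f) (q : EuclideanSpace ℝ (Fin d)) :
    IsCoupling m (twist f q) :=
  IsCoupling.of_norm_le (j := 0) (c := 1) hf (aestronglyMeasurable_twist hf.aesm q) zero_le_one
    (Eventually.of_forall fun κ => by rw [norm_twist, pow_zero, mul_one, one_mul])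

theorem couplingNorm_twist (f : Mode d → ℂ) (q : EuclideanSpace ℝ (Fin d)) :
    couplingNorm m (twist f q) = couplingNorm m f := couplingNorm_congr (norm_twist f q)

theorem norm_twistSlope_le' (f : Mode d → ℂ) (v : EuclideanSpace ℝ (Fin d)) (κ : Mode d) :
    ‖twistSlope f v κ‖ ≤ 2 * Real.pi * ‖v‖ * (1 + ‖κ.1‖) ^ 1 * ‖f κ‖ := by
  refine (norm_twistSlope_le f v κ).trans ?_
  gcongr
  linarith

theorem IsCoupling.twistSlope (hf : IsCoupling (m + 2) f) (v : EuclideanSpace ℝ (Fin d)) :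
    IsCoupling m (twistSlope f v) :=
  IsCoupling.of_norm_le (j := 1) hf (aestronglyMeasurable_twistSlope hf.aesm v)
    (by positivity) (Eventually.of_forall (norm_twistSlope_le' f v))

theorem couplingNorm_twistSlope_le (hf : IsCoupling (m + 2) f) (v : EuclideanSpace ℝ (Fin d)) :
    couplingNorm m (twistSlope f v) ≤ 2 * Real.pi * ‖v‖ * couplingNorm (m + 2) f :=
  couplingNorm_le_of_norm_le (j := 1) hf (by positivity)
    (Eventually.of_forall (norm_twistSlope_le' f v))

theorem norm_norm_mul_le (f : Mode d → ℂ) (κ : Mode d) :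
    ‖(‖κ.1‖ : ℂ) * f κ‖ ≤ 1 * (1 + ‖κ.1‖) ^ 1 * ‖f κ‖ := by
  rw [norm_mul, Complex.norm_real, norm_norm]
  gcongr
  linarith

theorem IsCoupling.norm_mul (hf : IsCoupling (m + 2) f) :
    IsCoupling m fun κ => (‖κ.1‖ : ℂ) * f κ := by
  refine IsCoupling.of_norm_le (j := 1) (c := 1) hf ?_ zero_le_one
    (Eventually.of_forall (norm_norm_mul_le f))
  exact (by fun_prop : Measurable fun κ : Mode d => (‖κ.1‖ : ℂ)).aestronglyMeasurable.mul hf.aesm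

theorem couplingNorm_norm_mul_le (hf : IsCoupling (m + 2) f) :
    couplingNorm m (fun κ => (‖κ.1‖ : ℂ) * f κ) ≤ couplingNorm (m + 2) f := by
  have := couplingNorm_le_of_norm_le (m := m) (j := 1) hf zero_le_one
    (Eventually.of_forall (norm_norm_mul_le f))
  rwa [one_mul] at this

theorem norm_twist_sub_le (f : Mode d → ℂ) (q q' : EuclideanSpace ℝ (Fin d)) (κ : Mode d) :
    ‖twist f q κ - ((1 : ℝ) : ℂ) * twist f q' κ‖ ≤ 2 * (1 + ‖κ.1‖) ^ 0 * ‖f κ‖ := by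
  refine (norm_sub_le _ _).trans ?_
  rw [Complex.ofReal_one, one_mul, norm_twist, norm_twist, pow_zero]
  linarith

theorem aestronglyMeasurable_twist_sub (hf : AEStronglyMeasurable f (modeMeasure d))
    (q q' : EuclideanSpace ℝ (Fin d)) :
    AEStronglyMeasurable (fun κ => twist f q κ - ((1 : ℝ) : ℂ) * twist f q' κ) (modeMeasure d) :=
  (aestronglyMeasurable_twist hf q).sub ((aestronglyMeasurable_twist hf q').const_mul _)

theorem IsCoupling.twist_sub (hf : IsCoupling m f) (q q' : EuclideanSpace ℝ (Fin d)) :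
    IsCoupling m fun κ => PauliFierz.twist f q κ - ((1 : ℝ) : ℂ) * PauliFierz.twist f q' κ :=
  IsCoupling.of_norm_le (j := 0) hf (aestronglyMeasurable_twist_sub hf.aesm q q') zero_le_two
    (Eventually.of_forall (norm_twist_sub_le f q q'))

/-- Dominated convergence: the twist is a phase, so 2|f| dominates and no extra weight is spent on
continuity in the particle position. -/
theorem tendsto_couplingNorm_twist_sub (hd : 0 < d) (hf : IsCoupling m f)
    (q : EuclideanSpace ℝ (Fin d)) :
    Tendsto (fun p => couplingNorm m fun κ => twist f p κ - ((1 : ℝ) : ℂ) * twist f q κ) (𝓝 q)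
      (𝓝 0) := by
  refine tendsto_couplingNorm (j := 0) hd hf
    (fun p => aestronglyMeasurable_twist_sub hf.aesm p q) zero_le_two
    (fun p => norm_twist_sub_le f p q) fun κ => ?_
  have : Continuous fun p => twist f p κ - ((1 : ℝ) : ℂ) * twist f q κ := by
    unfold twist
    fun_prop
  have h := this.tendsto q
  simpa using h

variable {ħ : ℝ}

/-- Operator norm continuity in the position provides the strong measurability needed to define
fibered operators. -/
theorem continuous_ladderR_twist (hd : 0 < d) (hħ : 0 < ħ) (hħ1 : ħ < 1) (b : Bool)
    (hf : IsCoupling 1 f) : Continuous fun q => ladderR b ħ (twist f q) := by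
  refine continuous_iff_continuousAt.2 fun q => ?_
  refine (tendsto_iff_norm_sub_tendsto_zero (E := Fock d →L[ℂ] Fock d)).2 ?_
  refine squeeze_zero (fun p => norm_nonneg (E := Fock d →L[ℂ] Fock d) _) (fun p => ?_)
    (tendsto_couplingNorm_twist_sub hd hf q)
  have h := ladderR_sub_smul hd hħ hħ1 b 1 (hf.twist p) (hf.twist q) (hf.twist_sub p q)
  rw [Complex.ofReal_one, one_smul, ← Complex.ofReal_one] at h
  rw [← h]
  exact norm_ladderR_le hd hħ hħ1 b (hf.twist_sub p q)

theorem continuous_ladderR₂_twist (hd : 0 < d) (hħ : 0 < ħ) (hħ1 : ħ < 1) (b : Bool)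
    (hf : IsCoupling 2 f) : Continuous fun q => ladderR₂ b ħ (twist f q) := by
  refine continuous_iff_continuousAt.2 fun q => ?_
  refine (tendsto_iff_norm_sub_tendsto_zero (E := Fock d →L[ℂ] Fock d)).2 ?_
  refine squeeze_zero (fun p => norm_nonneg (E := Fock d →L[ℂ] Fock d) _) (fun p => ?_)
    (tendsto_couplingNorm_twist_sub hd hf q)
  rw [← ladderR₂_sub hd hħ hħ1 b (hf.twist p) (hf.twist q) (hf.twist_sub p q)]
  exact norm_ladderR₂_le hd hħ hħ1 b (hf.twist_sub p q)

/-- The remainder of the first order expansion of `twist f`. -/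
def twistRem (f : Mode d → ℂ) (v : EuclideanSpace ℝ (Fin d)) (t : ℝ) : Mode d → ℂ := fun κ =>
  twist f (t • v) κ - f κ - t * twistSlope f v κ

theorem twist_add_sub (f : Mode d → ℂ) (q v : EuclideanSpace ℝ (Fin d)) (t : ℝ) (κ : Mode d) :
    twist f (q + t • v) κ - ((1 : ℝ) : ℂ) * twist f q κ - t * twist (twistSlope f v) q κ =
      twist (twistRem f v t) q κ := by
  rw [twist_add, twist.eq_def f q, twist.eq_def (twistSlope f v) q, twist.eq_def (twistRem f v t),
    twistRem]
  push_cast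
  ring

theorem norm_twistRem_le (f : Mode d → ℂ) (v : EuclideanSpace ℝ (Fin d)) (t : ℝ) (κ : Mode d) :
    ‖twistRem f v t κ‖ ≤ |t| * (4 * Real.pi * ‖v‖ * (1 + ‖κ.1‖) ^ 1 * ‖f κ‖) := by
  -- The increment of the phase and its linear part are bounded separately, each by 2π|t|‖v‖|k|;
  -- together they give the factor 4π.
  have h1 : ‖twist f (t • v) κ - f κ‖ ≤ |t| * (2 * Real.pi * ‖v‖ * (1 + ‖κ.1‖) ^ 1 * ‖f κ‖) := by
    have h2 : twist f (t • v) κ - f κ =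
        f κ * (Complex.exp (Complex.I * ((-(2 * Real.pi * inner ℝ κ.1 (t • v)) : ℝ) : ℂ)) - 1) := by
      rw [twist, mul_sub, mul_one, Complex.ofReal_neg, mul_comm Complex.I]
    rw [h2, norm_mul]
    have h3 := (Real.norm_exp_I_mul_ofReal_sub_one_le
      (x := -(2 * Real.pi * inner ℝ κ.1 (t • v)))).trans_eq (norm_neg _)
    rw [Real.norm_eq_abs] at h3
    have h4 := abs_slope_le κ.1 (t • v)
    rw [norm_smul, Real.norm_eq_abs] at h4
    have h5 : 2 * Real.pi * (|t| * ‖v‖) * ‖κ.1‖ ≤ |t| * (2 * Real.pi * ‖v‖ * (1 + ‖κ.1‖) ^ 1) := by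
      have : 0 ≤ |t| * (2 * Real.pi * ‖v‖) := by positivity
      linarith
    calc _ ≤ ‖f κ‖ * (|t| * (2 * Real.pi * ‖v‖ * (1 + ‖κ.1‖) ^ 1)) := by
          gcongr
          exact h3.trans (h4.trans h5)
      _ = _ := by ring
  have h2 : ‖(t : ℂ) * twistSlope f v κ‖ ≤
      |t| * (2 * Real.pi * ‖v‖ * (1 + ‖κ.1‖) ^ 1 * ‖f κ‖) := by
    rw [norm_mul, Complex.norm_real, Real.norm_eq_abs]
    gcongr
    exact norm_twistSlope_le' f v κ
  exact (norm_sub_le _ _).trans (by linarith)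

theorem aestronglyMeasurable_twistRem (hf : AEStronglyMeasurable f (modeMeasure d))
    (v : EuclideanSpace ℝ (Fin d)) (t : ℝ) :
    AEStronglyMeasurable (twistRem f v t) (modeMeasure d) :=
  ((aestronglyMeasurable_twist hf _).sub hf).sub
    ((aestronglyMeasurable_twistSlope hf v).const_mul _)

theorem IsCoupling.twistRem (hf : IsCoupling (m + 2) f) (v : EuclideanSpace ℝ (Fin d)) (t : ℝ) :
    IsCoupling m (twistRem f v t) :=
  IsCoupling.of_norm_le (j := 1) (c := |t| * (4 * Real.pi * ‖v‖)) hf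
    (aestronglyMeasurable_twistRem hf.aesm v t) (by positivity)
    (Eventually.of_forall fun κ => (norm_twistRem_le f v t κ).trans_eq (by ring))

theorem isLittleO_twistRem (f : Mode d → ℂ) (v : EuclideanSpace ℝ (Fin d)) (κ : Mode d) :
    (fun t => twistRem f v t κ) =o[𝓝 0] fun t : ℝ => t := by
  have h1 : HasDerivAt (fun t : ℝ => (-(2 * Real.pi * inner ℝ κ.1 (t • v) : ℝ) * Complex.I : ℂ))
      (-(2 * Real.pi * inner ℝ κ.1 v : ℝ) * Complex.I) 0 := by
    have h2 : HasDerivAt (fun t : ℝ => ((t : ℂ) * (-(2 * Real.pi * inner ℝ κ.1 v : ℝ) * Complex.I)))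
        (1 * (-(2 * Real.pi * inner ℝ κ.1 v : ℝ) * Complex.I)) 0 :=
      (Complex.ofRealCLM.hasDerivAt (x := (0 : ℝ))).mul_const _
    rw [one_mul] at h2
    refine h2.congr_of_eventuallyEq (Eventually.of_forall fun t => ?_)
    simp only [inner_smul_right]
    push_cast
    ring
  have h3 := (h1.cexp).const_mul (f κ)
  have h4 := hasDerivAt_iff_isLittleO_nhds_zero.1 h3
  refine h4.congr_left fun t => ?_
  simp only [twistRem, twist, twistSlope]
  simp

/-- Differentiability of q ↦ f exp(-2πi k·q) in the coupling norm. The difference quotients are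
dominated by a multiple of (1 + |k|)|f|, which is why two extra powers of the weight are needed. -/
theorem isLittleO_couplingNorm_twistRem (hd : 0 < d) (hf : IsCoupling (m + 2) f)
    (v : EuclideanSpace ℝ (Fin d)) :
    (fun t => couplingNorm m (twistRem f v t)) =o[𝓝 0] fun t : ℝ => t := by
  have h1 : Tendsto (fun t : ℝ => couplingNorm m fun κ => t⁻¹ • twistRem f v t κ) (𝓝 0) (𝓝 0) := by
    refine tendsto_couplingNorm (j := 1) (c := 4 * Real.pi * ‖v‖) hd hf
      (fun t => (aestronglyMeasurable_twistRem hf.aesm v t).const_smul (t⁻¹ : ℝ)) (by positivity)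
      (fun t κ => ?_) fun κ => (isLittleO_twistRem f v κ).tendsto_inv_smul_nhds_zero
    rw [norm_smul, norm_inv, Real.norm_eq_abs]
    rcases eq_or_ne t 0 with rfl | ht
    · rw [abs_zero, inv_zero, zero_mul]
      positivity
    · rw [inv_mul_le_iff₀ (abs_pos.2 ht)]
      exact norm_twistRem_le f v t κ
  rw [Asymptotics.isLittleO_iff]
  intro r hr
  filter_upwards [h1.eventually (gt_mem_nhds hr)] with t ht
  rw [couplingNorm_smul, abs_inv] at ht
  rw [Real.norm_eq_abs, Real.norm_eq_abs, abs_of_nonneg (couplingNorm_nonneg _ _)]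
  -- At t = 0 the quotient `t⁻¹ • _` is zero and carries no information, so the vanishing of the
  -- remainder is checked directly.
  rcases eq_or_ne t 0 with rfl | ht0
  · have h0 : couplingNorm m (twistRem f v 0) = 0 := by
      have h2 : couplingNorm m (twistRem f v 0) ≤ 0 * couplingNorm (m + 2 * 1) f := by
        refine couplingNorm_le_of_norm_le (j := 1) hf le_rfl (Eventually.of_forall fun κ => ?_)
        refine (norm_twistRem_le f v 0 κ).trans_eq ?_
        rw [abs_zero]
        ring
      rw [zero_mul] at h2
      exact le_antisymm h2 (couplingNorm_nonneg _ _)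
    rw [h0]
    positivity
  · rw [inv_mul_lt_iff₀ (abs_pos.2 ht0)] at ht
    linarith

/-- Linearity in the form factor turns the Taylor remainder of the operators into the operator of
the remainder form factor. The bound is independent of q, since twisting preserves the coupling
norm. -/
theorem norm_ladderR_twist_sub_le (hd : 0 < d) (hħ : 0 < ħ) (hħ1 : ħ < 1) (b : Bool)
    (hf : IsCoupling 3 f) (q v : EuclideanSpace ℝ (Fin d)) (t : ℝ) :
    ‖ladderR b ħ (twist f (q + t • v)) - ladderR b ħ (twist f q) -
      (t : ℂ) • ladderR b ħ (twist (twistSlope f v) q)‖ ≤ couplingNorm 1 (twistRem f v t) := by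
  have hf1 : IsCoupling 1 f := hf.mono (by norm_num)
  have h1 := ladderR_sub_smul hd hħ hħ1 b 1 (hf1.twist (q + t • v)) (hf1.twist q)
    (hf1.twist_sub _ _)
  have hrem : IsCoupling 1 (twist (twistRem f v t) q) := (hf.twistRem v t).twist q
  have heq : (fun κ => (fun κ => twist f (q + t • v) κ - ((1 : ℝ) : ℂ) * twist f q κ) κ -
      (t : ℂ) * twist (twistSlope f v) q κ) = twist (twistRem f v t) q :=
    funext fun κ => twist_add_sub f q v t κ
  have h2 := ladderR_sub_smul hd hħ hħ1 b t (hf1.twist_sub (q + t • v) q)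
    ((hf.twistSlope v).twist q) (by rw [heq]; exact hrem)
  rw [h1, heq, Complex.ofReal_one, one_smul] at h2
  rw [← h2, ← couplingNorm_twist (twistRem f v t) q]
  exact norm_ladderR_le hd hħ hħ1 b hrem

end Coupling

/-! ### The coupling function of the model is an admissible form factor. -/

section CouplingFunction

open Filter Topology

variable {d : ℕ} {ε : Fin (d - 1) → EuclideanSpace ℝ (Fin d) → EuclideanSpace ℝ (Fin d)}
  {χ : EuclideanSpace ℝ (Fin d) → ℂ}

/-- The coupling function at the origin. -/
def couplingZero (ε : Fin (d - 1) → EuclideanSpace ℝ (Fin d) → EuclideanSpace ℝ (Fin d))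
    (χ : EuclideanSpace ℝ (Fin d) → ℂ) (ν : Fin d) : Mode d → ℂ := fun κ =>
  ((ε κ.2 κ.1 ν / Real.sqrt (2 * ‖κ.1‖) : ℝ) : ℂ) * χ κ.1

theorem ae_ne_zero (hd : 0 < d) : ∀ᵐ k : EuclideanSpace ℝ (Fin d), k ≠ 0 := by
  have : Nontrivial (EuclideanSpace ℝ (Fin d)) := by
    rw [← Module.finrank_pos_iff (R := ℝ)]
    simpa using hd
  exact Measure.ae_ne volume 0

theorem AssumptionA1.aestronglyMeasurable (hd : 0 < d) (h : AssumptionA1 χ) :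
    AEStronglyMeasurable χ volume := by
  have h1 : AEStronglyMeasurable (fun k => (‖k‖ : ℂ) * (((‖k‖⁻¹ : ℝ) : ℂ) * χ k)) volume :=
    (by fun_prop : Measurable fun k : EuclideanSpace ℝ (Fin d) =>
      (‖k‖ : ℂ)).aestronglyMeasurable.mul h.1
  refine h1.congr ?_
  filter_upwards [ae_ne_zero hd] with k hk
  have hk' : (‖k‖ : ℂ) ≠ 0 := by exact_mod_cast (norm_pos_iff.2 hk).ne'
  rw [Complex.ofReal_inv, mul_inv_cancel_left₀ hk']

theorem aemeasurable_polarization (hε : IsPolarization ε) (ν : Fin d) :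
    AEMeasurable (fun κ : Mode d => ε κ.2 κ.1 ν) (modeMeasure d) := by
  have hm : Measurable fun κ : Mode d => (hε.aemeasurable κ.2).mk (ε κ.2) κ.1 ν := by
    refine measurable_from_prod_countable_left fun l => ?_
    exact (by fun_prop : Measurable fun k : EuclideanSpace ℝ (Fin d) => k ν).comp
      (hε.aemeasurable l).measurable_mk
  refine ⟨_, hm, ?_⟩
  have h := Measure.quasiMeasurePreserving_fst
    (μ := (volume : Measure (EuclideanSpace ℝ (Fin d))))
    (ν := (Measure.count : Measure (Fin (d - 1)))) |>.ae
      (ae_all_iff.2 fun l => (hε.aemeasurable l).ae_eq_mk)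
  filter_upwards [h] with κ hκ
  rw [hκ κ.2]

theorem ae_abs_polarization_le (hε : IsPolarization ε) (ν : Fin d) :
    ∀ᵐ κ ∂modeMeasure d, |ε κ.2 κ.1 ν| ≤ 1 := by
  have h := Measure.quasiMeasurePreserving_fst
    (μ := (volume : Measure (EuclideanSpace ℝ (Fin d))))
    (ν := (Measure.count : Measure (Fin (d - 1)))) |>.ae hε.orthonormal
  filter_upwards [h] with κ hκ
  have h1 := PiLp.norm_apply_le (ε κ.2 κ.1) ν
  rwa [hκ.1 κ.2] at h1

theorem lintegral_fst_ne_top {h : EuclideanSpace ℝ (Fin d) → ℝ≥0∞} (hm : AEMeasurable h volume)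
    (hfin : ∫⁻ k, h k ≠ ∞) : ∫⁻ κ, h κ.1 ∂modeMeasure d ≠ ∞ := by
  rw [lintegral_prod _ hm.comp_fst]
  simp only [lintegral_const]
  rw [lintegral_mul_const' _ _ (by simp)]
  exact ENNReal.mul_ne_top hfin (by simp)

theorem lintegral_enorm_sq_ne_top {α : Type*} [MeasurableSpace α] {μ : Measure α} {f : α → ℂ}
    (hf : MemLp f 2 μ) : ∫⁻ x, ‖f x‖ₑ ^ 2 ∂μ ≠ ∞ := by
  have := (eLpNorm_lt_top_iff_lintegral_rpow_enorm_lt_top (by norm_num) (by norm_num)).1 hf.2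
  simpa using this.ne

theorem coupling_weight_le {r e x : ℝ} (hr : 0 < r) (he : |e| ≤ 1) :
    (1 + r) ^ 3 * r⁻¹ * (|e / Real.sqrt (2 * r)| * x) ^ 2 ≤
      2 * ((r⁻¹ * x) ^ 2 + (r ^ (3 / 2 - 1 : ℝ) * x) ^ 2) := by
  have h1 : (r ^ (3 / 2 - 1 : ℝ)) ^ 2 = r := by
    rw [← Real.rpow_natCast, ← Real.rpow_mul hr.le]
    norm_num
  have h2 : |e / Real.sqrt (2 * r)| ^ 2 = e ^ 2 / (2 * r) := by
    rw [sq_abs, div_pow, Real.sq_sqrt (by positivity)]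
  have h3 : e ^ 2 ≤ 1 := (sq_le_one_iff_abs_le_one e).2 he
  rw [mul_pow, mul_pow, mul_pow, h1, h2, ← add_mul, ← mul_assoc, ← mul_assoc]
  refine mul_le_mul_of_nonneg_right ?_ (sq_nonneg x)
  have h4 : (1 + r) ^ 3 ≤ 4 * (1 + r ^ 3) := by
    nlinarith [mul_nonneg hr.le (sq_nonneg (r - 1)), sq_nonneg (r - 1)]
  calc (1 + r) ^ 3 * r⁻¹ * (e ^ 2 / (2 * r)) ≤ 4 * (1 + r ^ 3) * r⁻¹ * (1 / (2 * r)) := by gcongr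
    _ = 2 * ((r⁻¹) ^ 2 + r) := by field_simp; ring

/-- The assumptions on χ enter here. With |f|² ≤ |χ|²/(2|k|) the weight becomes (1 + |k|)³/(2|k|²),
which is dominated by the two admissible weights |k|⁻² and |k|. -/
theorem isCoupling_couplingZero (hd : 0 < d) (hε : IsPolarization ε) (h1 : AssumptionA1 χ)
    (h2 : AssumptionA2 1 χ) (ν : Fin d) : IsCoupling 3 (couplingZero ε χ ν) := by
  have hm : AEStronglyMeasurable (couplingZero ε χ ν) (modeMeasure d) := by
    have h3 : AEStronglyMeasurable (fun κ : Mode d => χ κ.1) (modeMeasure d) :=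
      (h1.aestronglyMeasurable hd).comp_fst
    have h4 := aemeasurable_polarization hε ν
    have h5 : AEMeasurable (fun κ : Mode d =>
        ((ε κ.2 κ.1 ν / Real.sqrt (2 * ‖κ.1‖) : ℝ) : ℂ)) (modeMeasure d) := by
      refine Complex.measurable_ofReal.comp_aemeasurable (h4.div ?_)
      fun_prop
    exact h5.aestronglyMeasurable.mul h3
  refine ⟨hm, ?_⟩
  have hfin : ∫⁻ κ, ENNReal.ofReal 2 * (‖((‖κ.1‖⁻¹ : ℝ) : ℂ) * χ κ.1‖ₑ ^ 2 +
      ‖((‖κ.1‖ ^ (3 / 2 - 1 : ℝ) : ℝ) : ℂ) * χ κ.1‖ₑ ^ 2) ∂modeMeasure d ≠ ∞ := by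
    refine lintegral_fst_ne_top (d := d) (h := fun k => ENNReal.ofReal 2 *
      (‖((‖k‖⁻¹ : ℝ) : ℂ) * χ k‖ₑ ^ 2 + ‖((‖k‖ ^ (3 / 2 - 1 : ℝ) : ℝ) : ℂ) * χ k‖ₑ ^ 2))
      (((h1.1.enorm.pow_const 2).add (h2.1.enorm.pow_const 2)).const_mul _) ?_
    rw [lintegral_const_mul' _ _ ENNReal.ofReal_ne_top,
      lintegral_add_left' (h1.1.enorm.pow_const 2)]
    exact ENNReal.mul_ne_top ENNReal.ofReal_ne_top
      (ENNReal.add_ne_top.2 ⟨lintegral_enorm_sq_ne_top h1, lintegral_enorm_sq_ne_top h2⟩)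
  refine ne_top_of_le_ne_top hfin (lintegral_mono_ae ?_)
  filter_upwards [ae_mode_ne_zero hd, ae_abs_polarization_le hε ν] with κ hκ he
  have hr : 0 < ‖κ.1‖ := norm_pos_iff.2 hκ
  have h3 := ENNReal.ofReal_le_ofReal (coupling_weight_le (x := ‖χ κ.1‖) hr he)
  refine Eq.trans_le ?_ (h3.trans_eq ?_)
  · rw [ENNReal.ofReal_mul (by positivity), ENNReal.ofReal_mul (by positivity),
      ENNReal.ofReal_pow (n := 2) (by positivity), ENNReal.ofReal_inv_of_pos hr, ofReal_norm]
    congr 2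
    rw [← ofReal_norm, couplingZero, norm_mul, Complex.norm_real, Real.norm_eq_abs]
  · rw [ENNReal.ofReal_mul zero_le_two, ENNReal.ofReal_add (sq_nonneg _) (sq_nonneg _),
      ENNReal.ofReal_pow (by positivity), ENNReal.ofReal_pow (by positivity), ← ofReal_norm,
      ← ofReal_norm, norm_mul, norm_mul, Complex.norm_real, Complex.norm_real,
      Real.norm_of_nonneg (by positivity), Real.norm_of_nonneg (by positivity)]

end CouplingFunction

/-! ### Fibered operators -/

section BoundedFiber

variable {X F : Type*} [NormedAddCommGroup X] [NormedAddCommGroup F] [NormedSpace ℂ F]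

/-- A continuous bounded family of bounded operators. -/
structure IsBoundedFiber (T : X → F →L[ℂ] F) (C : ℝ) : Prop where
  continuous : Continuous T
  bound : ∀ x, ‖T x‖ ≤ C

variable {T T' : X → F →L[ℂ] F} {C C' : ℝ}

theorem isBoundedFiber_const (T : F →L[ℂ] F) : IsBoundedFiber (fun _ : X => T) ‖T‖ :=
  ⟨continuous_const, fun _ => le_rfl⟩

theorem IsBoundedFiber.add (hT : IsBoundedFiber T C) (hT' : IsBoundedFiber T' C') :
    IsBoundedFiber (fun x => T x + T' x) (C + C') :=
  ⟨hT.continuous.add hT'.continuous,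
    fun x => (norm_add_le _ _).trans (add_le_add (hT.bound x) (hT'.bound x))⟩

theorem IsBoundedFiber.comp_add (hT : IsBoundedFiber T C) (a : X) :
    IsBoundedFiber (fun x => T (x + a)) C :=
  ⟨hT.continuous.comp (by fun_prop), fun x => hT.bound _⟩

end BoundedFiber

section Fiber

open Filter Topology

variable {X F : Type*} [NormedAddCommGroup X] [InnerProductSpace ℝ X] [FiniteDimensional ℝ X]
  [MeasurableSpace X] [BorelSpace X] [NormedAddCommGroup F] [NormedSpace ℂ F]

theorem exists_fiberLift {T : X → F →L[ℂ] F} {C : ℝ} (hT : IsBoundedFiber T C) :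
    ∃ S : Lp F 2 (volume : Measure X) →L[ℂ] Lp F 2 (volume : Measure X),
      ∀ Ψ, S Ψ =ᵐ[volume] fun x => T x (Ψ x) := by
  have hC : 0 ≤ C := (norm_nonneg _).trans (hT.bound 0)
  have hmem : ∀ Ψ : Lp F 2 (volume : Measure X), MemLp (fun x => T x (Ψ x)) 2 volume := by
    intro Ψ
    refine (Lp.memLp Ψ).of_le_mul (c := C) ?_ (Eventually.of_forall fun x =>
      (T x).le_of_opNorm_le (hT.bound x) _)
    -- Norm continuity of the family is what makes x ↦ T(x)Ψ(x) strongly measurable.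
    have h1 : AEStronglyMeasurable T (volume : Measure X) := hT.continuous.aestronglyMeasurable
    exact (isBoundedBilinearMap_apply (𝕜 := ℂ) (E := F)
      (F := F)).continuous.comp_aestronglyMeasurable
      (h1.prodMk (Lp.aestronglyMeasurable Ψ))
  let S : Lp F 2 (volume : Measure X) →ₗ[ℂ] Lp F 2 (volume : Measure X) :=
    { toFun := fun Ψ => (hmem Ψ).toLp
      map_add' := by
        intro Ψ Φ
        ext1
        filter_upwards [(hmem (Ψ + Φ)).coeFn_toLp, (hmem Ψ).coeFn_toLp, (hmem Φ).coeFn_toLp,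
          Lp.coeFn_add Ψ Φ, Lp.coeFn_add (hmem Ψ).toLp (hmem Φ).toLp] with x h1 h2 h3 h4 h5
        rw [h1, h5, Pi.add_apply, h2, h3, h4, Pi.add_apply, map_add]
      map_smul' := by
        intro c Ψ
        ext1
        filter_upwards [(hmem (c • Ψ)).coeFn_toLp, (hmem Ψ).coeFn_toLp,
          Lp.coeFn_smul c Ψ, Lp.coeFn_smul c (hmem Ψ).toLp] with x h1 h2 h3 h4
        rw [h1, RingHom.id_apply, h4, Pi.smul_apply, h2, h3, Pi.smul_apply, map_smul] }
  refine ⟨S.mkContinuous C fun Ψ => ?_, fun Ψ => (hmem Ψ).coeFn_toLp⟩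
  refine Lp.norm_le_mul_norm_of_ae_le_mul ?_
  filter_upwards [(hmem Ψ).coeFn_toLp] with x hx
  change ‖(hmem Ψ).toLp _ x‖ ≤ _
  rw [hx]
  exact (T x).le_of_opNorm_le (hT.bound x) _

open Classical in
/-- The operator `(TΨ)(x) = T(x) Ψ(x)`. -/
def fiberLift (T : X → F →L[ℂ] F) :
    Lp F 2 (volume : Measure X) →L[ℂ] Lp F 2 (volume : Measure X) :=
  if h : ∃ S : Lp F 2 (volume : Measure X) →L[ℂ] Lp F 2 (volume : Measure X),
      ∀ Ψ, S Ψ =ᵐ[volume] fun x => T x (Ψ x) then h.choose else 0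

variable {T T' : X → F →L[ℂ] F} {C C' : ℝ}

theorem coeFn_fiberLift (hT : IsBoundedFiber T C) (Ψ : Lp F 2 (volume : Measure X)) :
    fiberLift T Ψ =ᵐ[volume] fun x => T x (Ψ x) := by
  rw [fiberLift, dif_pos (exists_fiberLift hT)]
  exact (exists_fiberLift hT).choose_spec Ψ

theorem norm_fiberLift_le (hT : IsBoundedFiber T C) (Ψ : Lp F 2 (volume : Measure X)) :
    ‖fiberLift T Ψ‖ ≤ C * ‖Ψ‖ := by
  refine Lp.norm_le_mul_norm_of_ae_le_mul ?_
  filter_upwards [coeFn_fiberLift hT Ψ] with x hx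
  rw [hx]
  exact (T x).le_of_opNorm_le (hT.bound x) _

theorem coeFn_fiberLift_const (T : F →L[ℂ] F) (Ψ : Lp F 2 (volume : Measure X)) :
    fiberLift (fun _ => T) Ψ =ᵐ[volume] fun x => T (Ψ x) :=
  coeFn_fiberLift (isBoundedFiber_const T) Ψ

theorem translate_fiberLift (hT : IsBoundedFiber T C) (a : X) (Ψ : Lp F 2 (volume : Measure X)) :
    translate ℂ a (fiberLift T Ψ) = fiberLift (fun x => T (x + a)) (translate ℂ a Ψ) := by
  ext1
  have h := (measurePreserving_add_right volume a).quasiMeasurePreserving.ae (coeFn_fiberLift hT Ψ)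
  filter_upwards [h, coeFn_translate a (fiberLift T Ψ), coeFn_translate a Ψ,
    coeFn_fiberLift (hT.comp_add a) (translate ℂ a Ψ)] with x h1 h2 h3 h4
  rw [h2, h4, h1, h3]

theorem translate_fiberLift_const (T : F →L[ℂ] F) (a : X) (Ψ : Lp F 2 (volume : Measure X)) :
    translate ℂ a (fiberLift (fun _ => T) Ψ) = fiberLift (fun _ => T) (translate ℂ a Ψ) :=
  translate_fiberLift (isBoundedFiber_const T) a Ψ

/-- The remainder bound is uniform in x, so pointwise Taylor expansion of the fibres is
differentiability in operator norm of the lifted, translated operators. -/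
theorem hasDerivAt_fiberLift (hT : IsBoundedFiber T C) (hT' : IsBoundedFiber T' C') {v : X}
    {ρ : ℝ → ℝ} (hρ : ρ =o[𝓝 0] fun t => t)
    (h : ∀ (t : ℝ) x, ‖T (x + t • v) - T x - (t : ℂ) • T' x‖ ≤ ρ t) :
    HasDerivAt (fun t : ℝ => fiberLift fun x => T (x + t • v)) (fiberLift T') 0 := by
  rw [hasDerivAt_iff_isLittleO_nhds_zero]
  refine Asymptotics.IsBigO.trans_isLittleO (Asymptotics.IsBigO.of_bound 1
    (Eventually.of_forall fun t => ?_)) hρ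
  have hρ0 : 0 ≤ ρ t := (norm_nonneg _).trans (h t 0)
  rw [one_mul, Real.norm_of_nonneg hρ0]
  refine ContinuousLinearMap.opNorm_le_bound _ hρ0 fun Ψ => ?_
  have e : (fiberLift (fun x => T (x + (0 + t) • v)) - fiberLift (fun x => T (x + (0 : ℝ) • v)) -
      t • fiberLift T') Ψ = fiberLift (fun x => T (x + t • v)) Ψ - fiberLift T Ψ -
        (t : ℂ) • fiberLift T' Ψ := by
    simp only [zero_add, zero_smul, add_zero]
    rfl
  rw [e]
  refine Lp.norm_le_mul_norm_of_ae_le_mul ?_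
  filter_upwards [coeFn_fiberLift (hT.comp_add (t • v)) Ψ, coeFn_fiberLift hT Ψ,
    coeFn_fiberLift hT' Ψ, Lp.coeFn_sub (fiberLift (fun x => T (x + t • v)) Ψ) (fiberLift T Ψ),
    Lp.coeFn_sub (fiberLift (fun x => T (x + t • v)) Ψ - fiberLift T Ψ)
      ((t : ℂ) • fiberLift T' Ψ), Lp.coeFn_smul (t : ℂ) (fiberLift T' Ψ)] with x h1 h2 h3 h4 h5 h6
  rw [h5, Pi.sub_apply, h4, Pi.sub_apply, h6, Pi.smul_apply, h1, h2, h3]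
  exact (T (x + t • v) - T x - (t : ℂ) • T' x).le_of_opNorm_le (h t x) (Ψ x)

/-- Product rule for a differentiable family of operators. -/
theorem HasTranslationDeriv.fiberLift (hT : IsBoundedFiber T C) (hT' : IsBoundedFiber T' C') {v : X}
    {ρ : ℝ → ℝ} (hρ : ρ =o[𝓝 0] fun t => t)
    (h : ∀ (t : ℝ) x, ‖T (x + t • v) - T x - (t : ℂ) • T' x‖ ≤ ρ t)
    {Ψ Φ : Lp F 2 (volume : Measure X)} (hΨ : HasTranslationDeriv v Ψ Φ) :
    HasTranslationDeriv v (fiberLift T Ψ)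
      (PauliFierz.fiberLift T' Ψ + PauliFierz.fiberLift T Φ) := by
  have h1 := HasTranslationDeriv.clm_apply
    (T := fun t : ℝ => PauliFierz.fiberLift fun x => T (x + t • v))
    (fun t Ψ => by
      simp only [zero_smul, add_zero]
      exact translate_fiberLift hT _ Ψ)
    (hasDerivAt_fiberLift hT hT' hρ h) hΨ
  simpa only [zero_smul, add_zero] using h1

end Fiber

/-! ### The operator -iħ∂_v: action of fibered operators, closedness and symmetry. -/

section WeakDeriv

open Filter Topology

variable {X F : Type*} [NormedAddCommGroup X] [InnerProductSpace ℝ X] [FiniteDimensional ℝ X]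
  [MeasurableSpace X] [BorelSpace X] [NormedAddCommGroup F]

section Normed

variable [NormedSpace ℂ F] [CompleteSpace F] {ħ : ℝ} {v : X}

theorem fiberLift_const_mem_weakDerivGraph (hħ : ħ ≠ 0) (T : F →L[ℂ] F)
    {u u' : Lp F 2 (volume : Measure X)} (h : (u, u') ∈ weakDerivGraph F ħ v) :
    (fiberLift (fun _ => T) u, fiberLift (fun _ => T) u') ∈ weakDerivGraph F ħ v := by
  obtain ⟨Φ, hΦ, rfl⟩ := (mem_weakDerivGraph_iff hħ).1 h
  exact (mem_weakDerivGraph_iff hħ).2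
    ⟨_, hΦ.clm (fiberLift fun _ => T) (translate_fiberLift_const T), map_smul _ _ _⟩

theorem fiberLift_mem_weakDerivGraph (hħ : ħ ≠ 0) {T T' : X → F →L[ℂ] F} {C C' : ℝ}
    (hT : IsBoundedFiber T C) (hT' : IsBoundedFiber T' C') {ρ : ℝ → ℝ}
    (hρ : ρ =o[𝓝 0] fun t => t) (h : ∀ (t : ℝ) x, ‖T (x + t • v) - T x - (t : ℂ) • T' x‖ ≤ ρ t)
    {u u' : Lp F 2 (volume : Measure X)} (hu : (u, u') ∈ weakDerivGraph F ħ v) :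
    (fiberLift T u, fiberLift T u' + (-Complex.I * ħ : ℂ) • fiberLift T' u) ∈
      weakDerivGraph F ħ v := by
  obtain ⟨Φ, hΦ, rfl⟩ := (mem_weakDerivGraph_iff hħ).1 hu
  refine (mem_weakDerivGraph_iff hħ).2 ⟨_, hΦ.fiberLift hT hT' hρ h, ?_⟩
  rw [map_smul, smul_add, add_comm]

theorem weakDerivGraph_closed (hħ : ħ ≠ 0) {u u' : ℕ → Lp F 2 (volume : Measure X)}
    {x x' : Lp F 2 (volume : Measure X)} (h : ∀ k, (u k, u' k) ∈ weakDerivGraph F ħ v)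
    (hu : Tendsto u atTop (𝓝 x)) (hu' : Tendsto u' atTop (𝓝 x')) :
    (x, x') ∈ weakDerivGraph F ħ v := by
  have hc : (-Complex.I * ħ : ℂ) ≠ 0 := by simp [hħ]
  have h1 : ∀ k, HasTranslationDeriv v (u k) ((-Complex.I * ħ : ℂ)⁻¹ • u' k) := by
    intro k
    obtain ⟨Φ, hΦ, h2⟩ := (mem_weakDerivGraph_iff hħ).1 (h k)
    rwa [h2, smul_smul, inv_mul_cancel₀ hc, one_smul]
  refine (mem_weakDerivGraph_iff hħ).2 ⟨(-Complex.I * ħ : ℂ)⁻¹ • x',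
    HasTranslationDeriv.of_tendsto h1 hu (hu'.const_smul _), ?_⟩
  rw [smul_smul, mul_inv_cancel₀ hc, one_smul]

end Normed

theorem weakDerivGraph_symm [InnerProductSpace ℂ F] [CompleteSpace F] {ħ : ℝ} {v : X} (hħ : ħ ≠ 0)
    {u u' w w' : Lp F 2 (volume : Measure X)}
    (h : (u, u') ∈ weakDerivGraph F ħ v) (h' : (w, w') ∈ weakDerivGraph F ħ v) :
    inner ℂ u' w = inner ℂ u w' := by
  obtain ⟨Φ, hΦ, rfl⟩ := (mem_weakDerivGraph_iff hħ).1 h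
  obtain ⟨Φ', hΦ', rfl⟩ := (mem_weakDerivGraph_iff hħ).1 h'
  rw [inner_smul_left, inner_smul_right, hΦ.inner_eq hΦ', map_mul, map_neg, Complex.conj_I,
    Complex.conj_ofReal]
  ring

end WeakDeriv

/-! ### The regularized momentum -/

section EnergyFunctions

/-- The function `(1 + e)^{1/2} / (1 + δ (1 + e))`. -/
def sqrtResolventFun (δ e : ℝ) : ℝ := Real.sqrt (1 + e) / (1 + δ * (1 + e))

/-- The function `(1 + e) / (1 + δ (1 + e))`. -/
def yosidaFun (δ e : ℝ) : ℝ := (1 + e) / (1 + δ * (1 + e))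

variable {δ : ℝ}

theorem isBoundedEnergyFun_resolventFun (hδ : 0 < δ) : IsBoundedEnergyFun (resolventFun δ) 1 where
  measurable := by unfold resolventFun; fun_prop
  bound e he := by
    rw [resolventFun, abs_of_nonneg (by positivity)]
    exact inv_le_one_of_one_le₀ (by nlinarith)

theorem isBoundedEnergyFun_yosidaFun (hδ : 0 < δ) : IsBoundedEnergyFun (yosidaFun δ) δ⁻¹ where
  measurable := by unfold yosidaFun; fun_prop
  bound e he := by
    rw [yosidaFun, abs_of_nonneg (by positivity), div_le_iff₀ (by positivity), mul_add,
      inv_mul_cancel_left₀ hδ.ne']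
    have := inv_pos.2 hδ
    linarith

theorem isBoundedEnergyFun_sqrtResolventFun (hδ : 0 < δ) :
    IsBoundedEnergyFun (sqrtResolventFun δ) δ⁻¹ where
  measurable := by unfold sqrtResolventFun; fun_prop
  bound e he := by
    refine le_trans ?_ ((isBoundedEnergyFun_yosidaFun hδ).bound e he)
    rw [sqrtResolventFun, yosidaFun, abs_of_nonneg (by positivity), abs_of_nonneg (by positivity)]
    gcongr
    exact Real.sqrt_le_self_iff.2 (Or.inr (by linarith))

/-- The difference is e - e' divided by two factors that are at least 1. Having Lipschitz constant 1
for every δ keeps the commutator bounds uniform in the regularization. -/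
theorem abs_yosidaFun_sub_le (hδ : 0 < δ) {e e' : ℝ} (he : 0 ≤ e) (he' : 0 ≤ e') :
    |yosidaFun δ e - yosidaFun δ e'| ≤ |e - e'| := by
  have h1 : 1 ≤ 1 + δ * (1 + e) := by nlinarith
  have h2 : 1 ≤ 1 + δ * (1 + e') := by nlinarith
  have h3 : yosidaFun δ e - yosidaFun δ e' =
      (e - e') / ((1 + δ * (1 + e)) * (1 + δ * (1 + e'))) := by
    rw [yosidaFun, yosidaFun, div_sub_div _ _ (by positivity) (by positivity)]
    congr 1
    ring
  rw [h3, abs_div]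
  refine div_le_self (abs_nonneg _) ((one_le_mul_of_one_le_of_one_le h1 h2).trans (le_abs_self _))

theorem invSqrtFun_mul_yosidaFun {e : ℝ} (he : 0 ≤ e) :
    sqrtResolventFun δ e = invSqrtFun e * yosidaFun δ e := by
  have h : Real.sqrt (1 + e) ≠ 0 := by positivity
  rw [sqrtResolventFun, invSqrtFun, yosidaFun, mul_div_assoc', inv_mul_eq_div, Real.div_sqrt]

theorem invSqrtFun_mul_sqrtResolventFun {e : ℝ} (he : 0 ≤ e) :
    resolventFun δ e = invSqrtFun e * sqrtResolventFun δ e := by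
  have h : Real.sqrt (1 + e) ≠ 0 := by positivity
  rw [sqrtResolventFun, invSqrtFun, resolventFun, mul_div_assoc', inv_mul_cancel₀ h, one_div]

end EnergyFunctions

attribute [local irreducible] fiberLift energyOp ladderR ladderR₂

theorem norm_add_sub_add_sub_smul_add_le {E : Type*} [NormedAddCommGroup E] [NormedSpace ℂ E]
    (c : ℂ) (x y z x' y' z' : E) :
    ‖x + x' - (y + y') - c • (z + z')‖ ≤ ‖x - y - c • z‖ + ‖x' - y' - c • z'‖ := by
  have e : x + x' - (y + y') - c • (z + z') = (x - y - c • z) + (x' - y' - c • z') := by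
    rw [smul_add]
    abel
  rw [e]
  exact norm_add_le _ _

section StateEnergy

open Filter Topology

variable {d n : ℕ} {ħ : ℝ}

/-- The function `g(H_f)` of the field energy on the particles-field space. -/
def stateEnergyOp (d n : ℕ) (ħ : ℝ) (g : ℝ → ℝ) : State d n →L[ℂ] State d n :=
  fiberLift fun _ => energyOp d ħ g

variable {g h k : ℝ → ℝ} {C C' C'' : ℝ}

theorem coeFn_stateEnergyOp (g : ℝ → ℝ) (Ψ : State d n) :
    stateEnergyOp d n ħ g Ψ =ᵐ[volume] fun x => energyOp d ħ g (Ψ x) :=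
  coeFn_fiberLift_const _ Ψ

theorem norm_stateEnergyOp_le (hħ : 0 ≤ ħ) (hg : IsBoundedEnergyFun g C) (Ψ : State d n) :
    ‖stateEnergyOp d n ħ g Ψ‖ ≤ C * ‖Ψ‖ :=
  norm_fiberLift_le ⟨continuous_const, fun _ => norm_energyOp_le hħ hg⟩ Ψ

theorem stateEnergyOp_stateEnergyOp (hħ : 0 ≤ ħ) (hg : IsBoundedEnergyFun g C)
    (hh : IsBoundedEnergyFun h C') (hk : IsBoundedEnergyFun k C'')
    (hgh : ∀ e, 0 ≤ e → k e = g e * h e) (Ψ : State d n) :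
    stateEnergyOp d n ħ g (stateEnergyOp d n ħ h Ψ) = stateEnergyOp d n ħ k Ψ := by
  ext1
  filter_upwards [coeFn_stateEnergyOp g (stateEnergyOp d n ħ h Ψ), coeFn_stateEnergyOp h Ψ,
    coeFn_stateEnergyOp k Ψ] with x h1 h2 h3
  rw [h1, h2, h3, energyOp_energyOp hħ hg hh hk hgh]

theorem inner_stateEnergyOp_left (hħ : 0 ≤ ħ) (hg : IsBoundedEnergyFun g C) (Φ Ψ : State d n) :
    inner ℂ (stateEnergyOp d n ħ g Φ) Ψ = inner ℂ Φ (stateEnergyOp d n ħ g Ψ) := by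
  rw [L2.inner_def, L2.inner_def]
  refine integral_congr_ae ?_
  filter_upwards [coeFn_stateEnergyOp g Φ, coeFn_stateEnergyOp g Ψ] with x h1 h2
  rw [h1, h2, inner_energyOp_left hħ hg]

/-- The operator `R = (1 + H_f)^{-1/2}` on the particles-field space. -/
abbrev stateR (d n : ℕ) (ħ : ℝ) : State d n →L[ℂ] State d n := stateEnergyOp d n ħ invSqrtFun

theorem stateR_injective (hħ : 0 ≤ ħ) : Function.Injective (stateR d n ħ) := by
  rw [injective_iff_map_eq_zero]
  intro Ψ h
  refine (Lp.eq_zero_iff_ae_eq_zero).2 ?_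
  have h0 : stateR d n ħ Ψ =ᵐ[volume] 0 := (Lp.eq_zero_iff_ae_eq_zero).1 h
  filter_upwards [h0, coeFn_stateEnergyOp invSqrtFun Ψ] with x h1 h2
  rw [h1] at h2
  exact fockR_injective hħ (h2.symm.trans (map_zero _).symm)

/-- A vector orthogonal to the range of a symmetric operator lies in its kernel. -/
theorem dense_range_of_symm_of_injective {H : Type*} [NormedAddCommGroup H] [InnerProductSpace ℂ H]
    [CompleteSpace H] {T : H →L[ℂ] H} (hT : ∀ u w, inner ℂ (T u) w = inner ℂ u (T w))
    (hi : Function.Injective T) : DenseRange T := by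
  have h : (T.range)ᗮ = ⊥ := by
    rw [Submodule.eq_bot_iff]
    intro w hw
    refine hi (((inner_self_eq_zero (𝕜 := ℂ)).1 ?_).trans (map_zero T).symm)
    rw [← hT]
    exact (Submodule.mem_orthogonal _ _).1 hw _ ⟨T w, rfl⟩
  rw [← Submodule.topologicalClosure_eq_top_iff] at h
  exact (Submodule.dense_iff_topologicalClosure_eq_top).2 h

theorem tendsto_of_denseRange {H : Type*} [NormedAddCommGroup H] [NormedSpace ℂ H]
    {S : ℕ → H →L[ℂ] H} {T : H →L[ℂ] H} (hS : ∀ k u, ‖S k u‖ ≤ ‖u‖) (hT : DenseRange T)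
    (h : ∀ u, Tendsto (fun k => S k (T u)) atTop (𝓝 (T u))) (u : H) :
    Tendsto (fun k => S k u) atTop (𝓝 u) := by
  rw [Metric.tendsto_atTop]
  intro r hr
  obtain ⟨w, hw⟩ := hT.exists_dist_lt u (show 0 < r / 3 by positivity)
  obtain ⟨N, hN⟩ := Metric.tendsto_atTop.1 (h w) (r / 3) (by positivity)
  refine ⟨N, fun k hk => ?_⟩
  have h1 : dist (S k u) (S k (T w)) ≤ dist u (T w) := by
    rw [dist_eq_norm, dist_eq_norm, ← map_sub]
    exact hS k _
  have h2 := dist_triangle4 (S k u) (S k (T w)) (T w) u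
  rw [dist_comm (T w)] at h2
  linarith [hN k hk]

theorem norm_stateEnergyOp_sub_le (hħ : 0 ≤ ħ) (hg : IsBoundedEnergyFun g C)
    (hh : IsBoundedEnergyFun h C') {r : ℝ} (hr : ∀ e, 0 ≤ e → |g e - h e| ≤ r) (Ψ : State d n) :
    ‖stateEnergyOp d n ħ g Ψ - stateEnergyOp d n ħ h Ψ‖ ≤ r * ‖Ψ‖ := by
  have hgh : IsBoundedEnergyFun (fun e => g e - h e) r := ⟨hg.measurable.sub hh.measurable, hr⟩
  have e : stateEnergyOp d n ħ g Ψ - stateEnergyOp d n ħ h Ψ =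
      stateEnergyOp d n ħ (fun e => g e - h e) Ψ := by
    ext1
    filter_upwards [coeFn_stateEnergyOp g Ψ, coeFn_stateEnergyOp h Ψ,
      coeFn_stateEnergyOp (fun e => g e - h e) Ψ,
      Lp.coeFn_sub (stateEnergyOp d n ħ g Ψ) (stateEnergyOp d n ħ h Ψ)] with x h1 h2 h3 h4
    rw [h4, Pi.sub_apply, h1, h2, h3]
    refine Fock.ext_comp fun N => ?_
    filter_upwards [comp_energyOp hħ hg (Ψ x) N, comp_energyOp hħ hh (Ψ x) N,
      comp_energyOp hħ hgh (Ψ x) N,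
      comp_sub (energyOp d ħ g (Ψ x)) (energyOp d ħ h (Ψ x)) N] with K h1 h2 h3 h4
    rw [h4, Pi.sub_apply, h1, h2, h3]
    push_cast
    ring
  rw [e]
  exact norm_stateEnergyOp_le hħ hgh Ψ

/-- The function `(1 + e)⁻¹`. -/
def invFun (e : ℝ) : ℝ := invSqrtFun e * invSqrtFun e

theorem isBoundedEnergyFun_invFun : IsBoundedEnergyFun invFun 1 where
  measurable := isBoundedEnergyFun_invSqrtFun.measurable.mul
    isBoundedEnergyFun_invSqrtFun.measurable
  bound e he := by
    rw [invFun, abs_mul]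
    exact mul_le_one₀ (isBoundedEnergyFun_invSqrtFun.bound e he) (abs_nonneg _)
      (isBoundedEnergyFun_invSqrtFun.bound e he)

theorem isBoundedEnergyFun_resolventFun_mul {δ : ℝ} (hδ : 0 < δ) :
    IsBoundedEnergyFun (fun e => resolventFun δ e * invFun e) 1 where
  measurable := (isBoundedEnergyFun_resolventFun hδ).measurable.mul
    isBoundedEnergyFun_invFun.measurable
  bound e he := by
    rw [abs_mul]
    exact mul_le_one₀ ((isBoundedEnergyFun_resolventFun hδ).bound e he) (abs_nonneg _)
      (isBoundedEnergyFun_invFun.bound e he)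

theorem abs_resolventFun_mul_sub_le {δ e : ℝ} (hδ : 0 < δ) (he : 0 ≤ e) :
    |resolventFun δ e * invFun e - invFun e| ≤ δ := by
  have h1 : invFun e = (1 + e)⁻¹ := by rw [invFun, ← sq, invSqrtFun_sq he]
  have h2 : resolventFun δ e * invFun e - invFun e = -(δ * resolventFun δ e) := by
    rw [h1, resolventFun]
    field_simp
    ring
  rw [h2, abs_neg, abs_mul, abs_of_pos hδ]
  exact mul_le_of_le_one_right hδ.le ((isBoundedEnergyFun_resolventFun hδ).bound e he)

/-- On the dense range of (1 + H_f)⁻¹ the resolvents converge at rate δ; being contractions, they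
converge everywhere. -/
theorem tendsto_stateEnergyOp_resolventFun (hħ : 0 ≤ ħ) {δ : ℕ → ℝ} (hδ : ∀ k, 0 < δ k)
    (hδ0 : Tendsto δ atTop (𝓝 0)) (u : State d n) :
    Tendsto (fun k => stateEnergyOp d n ħ (resolventFun (δ k)) u) atTop (𝓝 u) := by
  have hR := isBoundedEnergyFun_invSqrtFun
  have hinv : ∀ u : State d n, stateEnergyOp d n ħ invFun u = stateR d n ħ (stateR d n ħ u) :=
    fun u => (stateEnergyOp_stateEnergyOp hħ hR hR isBoundedEnergyFun_invFun
      (fun e _ => rfl) u).symm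
  refine tendsto_of_denseRange (T := stateEnergyOp d n ħ invFun) (fun k u => ?_)
    (dense_range_of_symm_of_injective
      (inner_stateEnergyOp_left hħ isBoundedEnergyFun_invFun) ?_) (fun u => ?_) u
  · simpa using norm_stateEnergyOp_le hħ (isBoundedEnergyFun_resolventFun (hδ k)) u
  · intro u w huw
    rw [hinv, hinv] at huw
    exact stateR_injective hħ (stateR_injective hħ huw)
  · refine tendsto_iff_norm_sub_tendsto_zero.2 (squeeze_zero (fun _ => norm_nonneg _)
      (fun k => ?_) (g := fun k => δ k * ‖u‖) ?_)
    · rw [stateEnergyOp_stateEnergyOp hħ (isBoundedEnergyFun_resolventFun (hδ k))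
        isBoundedEnergyFun_invFun (isBoundedEnergyFun_resolventFun_mul (hδ k)) (fun e _ => rfl)]
      exact norm_stateEnergyOp_sub_le hħ (isBoundedEnergyFun_resolventFun_mul (hδ k))
        isBoundedEnergyFun_invFun (fun e he => abs_resolventFun_mul_sub_le (hδ k) he) u
    · simpa using hδ0.mul_const ‖u‖

/-- The regularization parameters. -/
def regParam (k : ℕ) : ℝ := 1 / ((k : ℝ) + 1)

theorem regParam_pos (k : ℕ) : 0 < regParam k := Nat.one_div_pos_of_nat

theorem regularizedMomentum (hħ : 0 < ħ) (v : Config d n) :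
    RegularizedMomentum (weakDerivGraph (Fock d) ħ v) (stateR d n ħ)
      (fun k => stateEnergyOp d n ħ (resolventFun (regParam k)))
      (fun k => stateEnergyOp d n ħ (sqrtResolventFun (regParam k)))
      (fun k => stateEnergyOp d n ħ (yosidaFun (regParam k))) := by
  have hR := isBoundedEnergyFun_invSqrtFun
  have hres := fun k => isBoundedEnergyFun_resolventFun (regParam_pos k)
  have hL := fun k => isBoundedEnergyFun_sqrtResolventFun (regParam_pos k)
  have hF := fun k => isBoundedEnergyFun_yosidaFun (regParam_pos k)
  exact
    { functional := weakDerivGraph_functional ħ v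
      symm := weakDerivGraph_symm hħ.ne'
      closed := weakDerivGraph_closed hħ.ne'
      R_mem := fiberLift_const_mem_weakDerivGraph hħ.ne' _
      L_mem := fun k => fiberLift_const_mem_weakDerivGraph hħ.ne' _
      F_mem := fun k => fiberLift_const_mem_weakDerivGraph hħ.ne' _
      R_symm := inner_stateEnergyOp_left hħ.le hR
      L_symm := fun k => inner_stateEnergyOp_left hħ.le (hL k)
      R_F := fun k => stateEnergyOp_stateEnergyOp hħ.le hR (hF k) (hL k)
        fun e he => invSqrtFun_mul_yosidaFun he
      F_R := fun k => stateEnergyOp_stateEnergyOp hħ.le (hF k) hR (hL k)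
        fun e he => (invSqrtFun_mul_yosidaFun he).trans (mul_comm _ _)
      R_L := fun k => stateEnergyOp_stateEnergyOp hħ.le hR (hL k) (hres k)
        fun e he => invSqrtFun_mul_sqrtResolventFun he
      L_R := fun k => stateEnergyOp_stateEnergyOp hħ.le (hL k) hR (hres k)
        fun e he => (invSqrtFun_mul_sqrtResolventFun he).trans (mul_comm _ _)
      norm_R := fun u => by simpa using norm_stateEnergyOp_le hħ.le hR u
      norm_res := fun k u => by simpa using norm_stateEnergyOp_le hħ.le (hres k) u
      tendsto_res := tendsto_stateEnergyOp_resolventFun hħ.le regParam_pos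
        tendsto_one_div_add_atTop_nhds_zero_nat }

end StateEnergy

/-! ### The regularized vector potential -/

section StateField

variable {d n : ℕ} {ħ : ℝ} {f : Mode d → ℂ} {i : Fin n}

theorem continuous_position (i : Fin n) : Continuous fun x : Config d n => position x i := by
  unfold position
  fun_prop

theorem position_add_single (x : Config d n) (i : Fin n) (ν : Fin d) (t : ℝ) :
    position (x + t • EuclideanSpace.single (i, ν) 1) i =
      position x i + t • EuclideanSpace.single ν 1 := by
  ext μ
  simp [position, Prod.ext_iff]

/-- The bounded operator `(a(v) + a*(v)) R` on Fock space. -/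
def fieldR (ħ : ℝ) (f : Mode d → ℂ) (q : EuclideanSpace ℝ (Fin d)) : Fock d →L[ℂ] Fock d :=
  ladderR false ħ (twist f q) + ladderR true ħ (twist f q)

/-- The bounded operator `R⁻¹ (a(v) + a*(v)) R²` on Fock space. -/
def fieldR₂ (ħ : ℝ) (f : Mode d → ℂ) (q : EuclideanSpace ℝ (Fin d)) : Fock d →L[ℂ] Fock d :=
  ladderR₂ false ħ (twist f q) + ladderR₂ true ħ (twist f q)

theorem isBoundedFiber_ladderR (hd : 0 < d) (hħ : 0 < ħ) (hħ1 : ħ < 1) (b : Bool)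
    (hf : IsCoupling 1 f) (i : Fin n) :
    IsBoundedFiber (fun x : Config d n => ladderR b ħ (twist f (position x i)))
      (couplingNorm 1 f) :=
  ⟨(continuous_ladderR_twist hd hħ hħ1 b hf).comp (continuous_position i), fun _ =>
    (norm_ladderR_le hd hħ hħ1 b (hf.twist _)).trans_eq (couplingNorm_twist f _)⟩

theorem isBoundedFiber_fieldR (hd : 0 < d) (hħ : 0 < ħ) (hħ1 : ħ < 1) (hf : IsCoupling 1 f)
    (i : Fin n) : IsBoundedFiber (fun x : Config d n => fieldR ħ f (position x i))
      (couplingNorm 1 f + couplingNorm 1 f) :=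
  (isBoundedFiber_ladderR hd hħ hħ1 false hf i).add (isBoundedFiber_ladderR hd hħ hħ1 true hf i)

theorem isBoundedFiber_fieldR₂ (hd : 0 < d) (hħ : 0 < ħ) (hħ1 : ħ < 1) (hf : IsCoupling 2 f)
    (i : Fin n) : IsBoundedFiber (fun x : Config d n => fieldR₂ ħ f (position x i))
      (couplingNorm 2 f + couplingNorm 2 f) := by
  have h : ∀ b, IsBoundedFiber (fun x : Config d n => ladderR₂ b ħ (twist f (position x i)))
      (couplingNorm 2 f) := fun b =>
    ⟨(continuous_ladderR₂_twist hd hħ hħ1 b hf).comp (continuous_position i), fun x =>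
      (norm_ladderR₂_le hd hħ hħ1 b (hf.twist _)).trans_eq (couplingNorm_twist f _)⟩
  exact (h false).add (h true)

theorem norm_fieldR_remainder_le (hd : 0 < d) (hħ : 0 < ħ) (hħ1 : ħ < 1) (hf : IsCoupling 3 f)
    (q v : EuclideanSpace ℝ (Fin d)) (t : ℝ) :
    ‖fieldR ħ f (q + t • v) - fieldR ħ f q - (t : ℂ) • fieldR ħ (twistSlope f v) q‖ ≤
      couplingNorm 1 (twistRem f v t) + couplingNorm 1 (twistRem f v t) := by
  unfold fieldR
  refine (norm_add_sub_add_sub_smul_add_le (E := Fock d →L[ℂ] Fock d) _ _ _ _ _ _ _).trans ?_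
  exact (add_le_add (norm_ladderR_twist_sub_le hd hħ hħ1 false hf q v t)
      (norm_ladderR_twist_sub_le hd hħ hħ1 true hf q v t))

theorem fockR_fieldR₂ (hd : 0 < d) (hħ : 0 < ħ) (hħ1 : ħ < 1) (hf : IsCoupling 2 f)
    (q : EuclideanSpace ℝ (Fin d)) (φ : Fock d) :
    fockR d ħ (fieldR₂ ħ f q φ) = fieldR ħ f q (fockR d ħ φ) := by
  rw [fieldR, fieldR₂, add_apply, add_apply, map_add,
    fockR_ladderR₂ hd hħ hħ1 _ (hf.twist q), fockR_ladderR₂ hd hħ hħ1 _ (hf.twist q)]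

theorem inner_fieldR (hd : 0 < d) (hħ : 0 < ħ) (hħ1 : ħ < 1) (hf : IsCoupling 1 f)
    (q : EuclideanSpace ℝ (Fin d)) (φ ψ : Fock d) :
    inner ℂ (fieldR ħ f q φ) (fockR d ħ ψ) = inner ℂ (fockR d ħ φ) (fieldR ħ f q ψ) :=
  inner_ladderR hd hħ hħ1 (hf.twist q) φ ψ

theorem norm_commutator_fieldR_le (hd : 0 < d) (hħ : 0 < ħ) (hħ1 : ħ < 1) (hf : IsCoupling 3 f)
    {g : ℝ → ℝ} {C : ℝ} (hg : IsBoundedEnergyFun g C)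
    (hlip : ∀ e e', 0 ≤ e → 0 ≤ e' → |g e - g e'| ≤ |e - e'|) (q : EuclideanSpace ℝ (Fin d))
    (φ : Fock d) :
    ‖fieldR ħ f q (energyOp d ħ g φ) - energyOp d ħ g (fieldR ħ f q φ)‖ ≤
      2 * couplingNorm 3 f * ‖φ‖ := by
  have hf1 : IsCoupling 1 f := hf.mono (by norm_num)
  have hcomm := fun b => norm_commutator_ladderR_le hd hħ hħ1 b (hf1.twist q)
    (IsCoupling.norm_mul (m := 1) (hf.twist q)) hg hlip φ
  have hn := couplingNorm_norm_mul_le (m := 1) (hf.twist q)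
  rw [couplingNorm_twist] at hn
  have hcomm' := fun b => (hcomm b).trans (mul_le_mul_of_nonneg_right hn (norm_nonneg φ))
  rw [fieldR, add_apply, add_apply, map_add,
    add_sub_add_comm]
  refine (norm_add_le _ _).trans ((add_le_add (hcomm' false) (hcomm' true)).trans_eq ?_)
  ring

/-- The operator `(a(v) + a*(v)) R` on the particles-field space, with `v` the coupling function
of the `i`-th particle. -/
def stateField (ħ : ℝ) (f : Mode d → ℂ) (i : Fin n) : State d n →L[ℂ] State d n :=
  fiberLift fun x => fieldR ħ f (position x i)

/-- The operator `R⁻¹ (a(v) + a*(v)) R²` on the particles-field space, with `v` the coupling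
function of the `i`-th particle. -/
def stateField₂ (ħ : ℝ) (f : Mode d → ℂ) (i : Fin n) : State d n →L[ℂ] State d n :=
  fiberLift fun x => fieldR₂ ħ f (position x i)

theorem coeFn_stateField (hd : 0 < d) (hħ : 0 < ħ) (hħ1 : ħ < 1) (hf : IsCoupling 1 f)
    (i : Fin n) (Ψ : State d n) :
    stateField ħ f i Ψ =ᵐ[volume] fun x => fieldR ħ f (position x i) (Ψ x) :=
  coeFn_fiberLift (isBoundedFiber_fieldR hd hħ hħ1 hf i) Ψ

theorem coeFn_stateField₂ (hd : 0 < d) (hħ : 0 < ħ) (hħ1 : ħ < 1) (hf : IsCoupling 2 f)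
    (i : Fin n) (Ψ : State d n) :
    stateField₂ ħ f i Ψ =ᵐ[volume] fun x => fieldR₂ ħ f (position x i) (Ψ x) :=
  coeFn_fiberLift (isBoundedFiber_fieldR₂ hd hħ hħ1 hf i) Ψ

theorem norm_stateField_le (hd : 0 < d) (hħ : 0 < ħ) (hħ1 : ħ < 1) (hf : IsCoupling 1 f)
    (i : Fin n) (Ψ : State d n) :
    ‖stateField ħ f i Ψ‖ ≤ (couplingNorm 1 f + couplingNorm 1 f) * ‖Ψ‖ :=
  norm_fiberLift_le (isBoundedFiber_fieldR hd hħ hħ1 hf i) Ψ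

theorem norm_stateField₂_le (hd : 0 < d) (hħ : 0 < ħ) (hħ1 : ħ < 1) (hf : IsCoupling 2 f)
    (i : Fin n) (Ψ : State d n) :
    ‖stateField₂ ħ f i Ψ‖ ≤ (couplingNorm 2 f + couplingNorm 2 f) * ‖Ψ‖ :=
  norm_fiberLift_le (isBoundedFiber_fieldR₂ hd hħ hħ1 hf i) Ψ

theorem stateR_stateField₂ (hd : 0 < d) (hħ : 0 < ħ) (hħ1 : ħ < 1) (hf : IsCoupling 2 f)
    (i : Fin n) (u : State d n) :
    stateR d n ħ (stateField₂ ħ f i u) = stateField ħ f i (stateR d n ħ u) := by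
  ext1
  filter_upwards [coeFn_stateEnergyOp invSqrtFun (stateField₂ ħ f i u),
    coeFn_stateField₂ hd hħ hħ1 hf i u,
    coeFn_stateField hd hħ hħ1 (hf.mono one_le_two) i (stateR d n ħ u),
    coeFn_stateEnergyOp invSqrtFun u] with x h1 h2 h3 h4
  exact h1.trans ((congrArg (fockR d ħ) h2).trans ((fockR_fieldR₂ hd hħ hħ1 hf _ _).trans
    ((congrArg (fieldR ħ f (position x i)) h4).symm.trans h3.symm)))

theorem inner_stateField (hd : 0 < d) (hħ : 0 < ħ) (hħ1 : ħ < 1) (hf : IsCoupling 1 f)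
    (i : Fin n) (u w : State d n) :
    inner ℂ (stateField ħ f i u) (stateR d n ħ w) =
      inner ℂ (stateR d n ħ u) (stateField ħ f i w) := by
  rw [L2.inner_def, L2.inner_def]
  refine integral_congr_ae ?_
  filter_upwards [coeFn_stateField hd hħ hħ1 hf i u, coeFn_stateField hd hħ hħ1 hf i w,
    coeFn_stateEnergyOp invSqrtFun u, coeFn_stateEnergyOp invSqrtFun w] with x h1 h2 h3 h4
  exact (congrArg₂ (inner ℂ) h1 h4).trans ((inner_fieldR hd hħ hħ1 hf _ _ _).trans
    (congrArg₂ (inner ℂ) h3 h2).symm)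

/-- Since p commutes with R, only the position dependence of the form factor is differentiated. The
commutator [p, A]R is therefore the field operator with the slope as form factor. -/
theorem stateField_mem (hd : 0 < d) (hħ : 0 < ħ) (hħ1 : ħ < 1) (hf : IsCoupling 3 f)
    (i : Fin n) (ν : Fin d) {u u' : State d n}
    (hu : (u, u') ∈ weakDerivGraph (Fock d) ħ (EuclideanSpace.single (i, ν) 1 : Config d n)) :
    (stateField ħ f i u, stateField ħ f i u' + (-Complex.I * ħ : ℂ) •
      stateField ħ (twistSlope f (EuclideanSpace.single ν 1)) i u) ∈
      weakDerivGraph (Fock d) ħ (EuclideanSpace.single (i, ν) 1 : Config d n) := by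
  have hρ := isLittleO_couplingNorm_twistRem (m := 1) hd hf (EuclideanSpace.single ν 1)
  refine fiberLift_mem_weakDerivGraph hħ.ne'
    (isBoundedFiber_fieldR hd hħ hħ1 (hf.mono (by norm_num)) i)
    (isBoundedFiber_fieldR hd hħ hħ1 (hf.twistSlope _) i) (hρ.add hρ) (fun t x => ?_) hu
  rw [position_add_single]
  exact norm_fieldR_remainder_le hd hħ hħ1 hf (position x i) _ t

/-- Of the constant 4π, 2π comes from the derivative of the phase and 2 from the sum of annihilation
and creation; the prefactor satisfies |-iħ| ≤ 1. -/
theorem norm_stateField_twistSlope_le (hd : 0 < d) (hħ : 0 < ħ) (hħ1 : ħ < 1)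
    (hf : IsCoupling 3 f) (i : Fin n) (ν : Fin d) (u : State d n) :
    ‖(-Complex.I * ħ : ℂ) • stateField ħ (twistSlope f (EuclideanSpace.single ν 1)) i u‖ ≤
      4 * Real.pi * couplingNorm 3 f * ‖u‖ := by
  have hs := couplingNorm_twistSlope_le (m := 1) hf (EuclideanSpace.single ν 1)
  rw [PiLp.norm_single, norm_one, mul_one] at hs
  have hc : ‖(-Complex.I * ħ : ℂ)‖ ≤ 1 := by
    rw [norm_mul, norm_neg, Complex.norm_I, one_mul, Complex.norm_real,
      Real.norm_of_nonneg hħ.le]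
    exact hħ1.le
  rw [norm_smul]
  refine (mul_le_of_le_one_left (norm_nonneg _) hc).trans
    ((norm_stateField_le hd hħ hħ1 (hf.twistSlope _) i u).trans ?_)
  refine mul_le_mul_of_nonneg_right ?_ (norm_nonneg u)
  linarith

theorem norm_commutator_stateField_le (hd : 0 < d) (hħ : 0 < ħ) (hħ1 : ħ < 1)
    (hf : IsCoupling 3 f) {g : ℝ → ℝ} {C : ℝ} (hg : IsBoundedEnergyFun g C)
    (hlip : ∀ e e', 0 ≤ e → 0 ≤ e' → |g e - g e'| ≤ |e - e'|) (i : Fin n) (u : State d n) :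
    ‖stateField ħ f i (stateEnergyOp d n ħ g u) - stateEnergyOp d n ħ g (stateField ħ f i u)‖ ≤
      2 * couplingNorm 3 f * ‖u‖ := by
  have hf1 : IsCoupling 1 f := hf.mono (by norm_num)
  refine Lp.norm_le_mul_norm_of_ae_le_mul ?_
  filter_upwards [coeFn_stateField hd hħ hħ1 hf1 i u, coeFn_stateEnergyOp g u,
    coeFn_stateField hd hħ hħ1 hf1 i (stateEnergyOp d n ħ g u),
    coeFn_stateEnergyOp g (stateField ħ f i u),
    Lp.coeFn_sub (stateField ħ f i (stateEnergyOp d n ħ g u))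
      (stateEnergyOp d n ħ g (stateField ħ f i u))] with x e1 e2 e3 e4 e5
  have e6 := e3.trans (congrArg (fieldR ħ f (position x i)) e2)
  have e7 := e4.trans (congrArg (energyOp d ħ g) e1)
  exact (congrArg norm (e5.trans (congrArg₂ (fun a b => a - b) e6 e7))).trans_le
    (norm_commutator_fieldR_le hd hħ hħ1 hf hg hlip (position x i) (u x))

theorem regularizedField (hd : 0 < d) (hħ : 0 < ħ) (hħ1 : ħ < 1) (hf : IsCoupling 3 f)
    (i : Fin n) (ν : Fin d) {K : ℝ} (hK : 4 * Real.pi * couplingNorm 3 f ≤ K) :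
    RegularizedField (weakDerivGraph (Fock d) ħ (EuclideanSpace.single (i, ν) 1 : Config d n))
      (stateR d n ħ) (fun k => stateEnergyOp d n ħ (yosidaFun (regParam k)))
      (stateField ħ f i) (stateField₂ ħ f i)
      ((-Complex.I * ħ : ℂ) • stateField ħ (twistSlope f (EuclideanSpace.single ν 1)) i) K := by
  have hf1 : IsCoupling 1 f := hf.mono (by norm_num)
  have hf2 : IsCoupling 2 f := hf.mono (by norm_num)
  have h0 := couplingNorm_nonneg 3 f
  have hpi : 2 * couplingNorm 3 f ≤ K := by
    nlinarith [Real.pi_gt_three]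
  have h1 : couplingNorm 1 f ≤ couplingNorm 3 f := couplingNorm_mono hf (by norm_num)
  have h2 : couplingNorm 2 f ≤ couplingNorm 3 f := couplingNorm_mono hf (by norm_num)
  exact
    { R_B₂ := stateR_stateField₂ hd hħ hħ1 hf2 i
      symm := inner_stateField hd hħ hħ1 hf1 i
      B_mem := stateField_mem hd hħ hħ1 hf i ν
      norm_B := fun u => (norm_stateField_le hd hħ hħ1 hf1 i u).trans
        (mul_le_mul_of_nonneg_right (by linarith) (norm_nonneg u))
      norm_B₂ := fun u => (norm_stateField₂_le hd hħ hħ1 hf2 i u).trans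
        (mul_le_mul_of_nonneg_right (by linarith) (norm_nonneg u))
      norm_B' := fun u => (norm_stateField_twistSlope_le hd hħ hħ1 hf i ν u).trans
        (mul_le_mul_of_nonneg_right hK (norm_nonneg u))
      norm_comm := fun k u => (norm_commutator_stateField_le hd hħ hħ1 hf
        (isBoundedEnergyFun_yosidaFun (regParam_pos k))
        (fun e e' he he' => abs_yosidaFun_sub_le (regParam_pos k) he he') i u).trans
        (mul_le_mul_of_nonneg_right hpi (norm_nonneg u)) }

end StateField

/-! ### The free and the interacting Hamiltonian -/

section Hamiltonian

variable {d n : ℕ} {ħ : ℝ}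

/-- Gives ψ = R²(1 + H_f)ψ, which is how a vector of the energy domain enters the regularized
calculus. -/
theorem fockR_fockR_of_mem (hħ : 0 ≤ ħ) {ψ φ : Fock d} (h : (ψ, φ) ∈ fieldEnergyGraph d ħ) :
    fockR d ħ (fockR d ħ (ψ + φ)) = ψ := by
  have hR := isBoundedEnergyFun_invSqrtFun
  rw [energyOp_energyOp hħ hR hR isBoundedEnergyFun_invFun fun e _ => rfl]
  refine energyOp_eq hħ isBoundedEnergyFun_invFun fun N => ?_
  filter_upwards [h N, comp_add ψ φ N] with K h1 h2
  have h3 : comp φ N K = (photonEnergy ħ K : ℂ) * comp ψ N K := h1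
  have h4 := photonEnergy_nonneg hħ K
  have h5 : (1 + photonEnergy ħ K : ℂ) ≠ 0 := by
    have : 1 + photonEnergy ħ K ≠ 0 := by positivity
    exact_mod_cast this
  rw [h2, Pi.add_apply, h3, invFun, ← sq, invSqrtFun_sq h4]
  push_cast
  field_simp

theorem mem_graph_fiberOp {T : Config d n → (Fock d →ₗ.[ℂ] Fock d)} {Ψ Φ : State d n} :
    (Ψ, Φ) ∈ (fiberOp T).graph ↔ ∀ᵐ x, (Ψ x, Φ x) ∈ (T x).graph :=
  (fiberGraph_functional T).mem_graph_iff

theorem stateR_stateR_of_mem (hħ : 0 ≤ ħ) {ψ φ : State d n}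
    (h : (ψ, φ) ∈ (fieldHamiltonian ħ).graph) : stateR d n ħ (stateR d n ħ (ψ + φ)) = ψ := by
  ext1
  filter_upwards [mem_graph_fiberOp.1 h, coeFn_stateEnergyOp invSqrtFun (stateR d n ħ (ψ + φ)),
    coeFn_stateEnergyOp invSqrtFun (ψ + φ), Lp.coeFn_add ψ φ] with x h1 h2 h3 h4
  have h5 := (fieldEnergyGraph_functional d ħ).mem_graph_iff.1 h1
  have h6 := h3.trans (congrArg (fockR d ħ) h4)
  exact (h2.trans (congrArg (fockR d ħ) h6)).trans (fockR_fockR_of_mem hħ h5)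

theorem mem_graph_vectorPotential (hd : 0 < d) (hħ : 0 < ħ) (hħ1 : ħ < 1)
    {ε : Fin (d - 1) → EuclideanSpace ℝ (Fin d) → EuclideanSpace ℝ (Fin d)}
    {χ : Fin n → EuclideanSpace ℝ (Fin d) → ℂ} {i : Fin n} {ν : Fin d}
    (hf : IsCoupling 1 (couplingZero ε (χ i) ν)) (u : State d n) :
    (stateR d n ħ u, stateField ħ (couplingZero ε (χ i) ν) i u) ∈
      (vectorPotential ħ ε χ i ν).graph := by
  set f := couplingZero ε (χ i) ν with hfdef
  have hT := fun b => isBoundedFiber_ladderR (n := n) hd hħ hħ1 b hf i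
  have hb : ∀ b, ∀ᵐ x, (stateR d n ħ u x,
      fiberLift (fun x : Config d n => ladderR b ħ (twist f (position x i))) u x) ∈
        ladderGraph b ħ (coupling ε (χ i) ν (position x i)) := by
    intro b
    filter_upwards [coeFn_stateEnergyOp invSqrtFun u, coeFn_fiberLift (hT b) u] with x h1 h2
    -- By definition `coupling` at the position q is `couplingZero` twisted by q.
    have h3 := ladderR_mem hd hħ hħ1 b (hf.twist (position x i)) (u x)
    exact (congrArg₂ (fun a b => (a, b)) h1 h2).symm ▸ h3
  have h1 : (stateR d n ħ u,
      fiberLift (fun x : Config d n => ladderR false ħ (twist f (position x i))) u) ∈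
      (fiberOp fun x => annihilation ħ (coupling ε (χ i) ν (position x i))).graph := by
    refine mem_graph_fiberOp.2 ?_
    filter_upwards [hb false] with x hx
    exact (annihilationGraph_functional _ _).mem_graph_iff.2 hx
  have h2 : (stateR d n ħ u,
      fiberLift (fun x : Config d n => ladderR true ħ (twist f (position x i))) u) ∈
      (fiberOp fun x => creation ħ (coupling ε (χ i) ν (position x i))).graph := by
    refine mem_graph_fiberOp.2 ?_
    filter_upwards [hb true] with x hx
    exact (creationGraph_functional _ _).mem_graph_iff.2 hx
  have e : stateField ħ f i u =
      fiberLift (fun x : Config d n => ladderR false ħ (twist f (position x i))) u +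
        fiberLift (fun x : Config d n => ladderR true ħ (twist f (position x i))) u := by
    ext1
    filter_upwards [coeFn_stateField hd hħ hħ1 hf i u, coeFn_fiberLift (hT false) u,
      coeFn_fiberLift (hT true) u, Lp.coeFn_add
        (fiberLift (fun x : Config d n => ladderR false ħ (twist f (position x i))) u)
        (fiberLift (fun x : Config d n => ladderR true ħ (twist f (position x i))) u)]
      with x h1 h2 h3 h4
    exact h1.trans (h4.trans (congrArg₂ (fun a b => a + b) h2 h3)).symm
  rw [e]
  exact mem_graph_add h1 h2

theorem mem_graph_momentum {i : Fin n} {ν : Fin d} {u u' : State d n} :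
    (u, u') ∈ (momentum ħ i ν).graph ↔
      (u, u') ∈ weakDerivGraph (Fock d) ħ (EuclideanSpace.single (i, ν) 1 : Config d n) :=
  (weakDerivGraph_functional ħ _).mem_graph_iff

theorem mem_graph_kineticMomentum (hd : 0 < d) (hħ : 0 < ħ) (hħ1 : ħ < 1)
    {ε : Fin (d - 1) → EuclideanSpace ℝ (Fin d) → EuclideanSpace ℝ (Fin d)}
    {χ : Fin n → EuclideanSpace ℝ (Fin d) → ℂ} {i : Fin n} {ν : Fin d}
    (hf : IsCoupling 1 (couplingZero ε (χ i) ν)) {u u' : State d n}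
    (h : (stateR d n ħ u, u') ∈
      weakDerivGraph (Fock d) ħ (EuclideanSpace.single (i, ν) 1 : Config d n)) :
    (stateR d n ħ u, u' - stateField ħ (couplingZero ε (χ i) ν) i u) ∈
      (kineticMomentum ħ ε χ i ν).graph :=
  mem_graph_sub (mem_graph_momentum.2 h) (mem_graph_vectorPotential hd hħ hħ1 hf u)

theorem exists_potential {V : Config d n → ℝ} {M : ℝ} (hV : Continuous V) (hM : ∀ x, |V x| ≤ M)
    (ψ : State d n) : ∃ v, (ψ, v) ∈ (potential V).graph ∧ ‖v‖ ≤ M * ‖ψ‖ := by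
  have hT : IsBoundedFiber (fun x => (V x : ℂ) • ContinuousLinearMap.id ℂ (Fock d)) M := by
    refine ⟨by fun_prop, fun x => ContinuousLinearMap.opNorm_le_bound _
      ((abs_nonneg _).trans (hM x)) fun φ => ?_⟩
    rw [smul_apply, norm_smul, Complex.norm_real, Real.norm_eq_abs]
    exact mul_le_mul_of_nonneg_right (hM x) (norm_nonneg φ)
  refine ⟨fiberLift (fun x => (V x : ℂ) • ContinuousLinearMap.id ℂ (Fock d)) ψ,
    mem_graph_fiberOp.2 ?_, norm_fiberLift_le hT ψ⟩
  filter_upwards [coeFn_fiberLift hT ψ] with x hx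
  rw [hx]
  exact mem_graph_const_smul _ ((LinearPMap.mem_graph_iff _).2
    ⟨⟨ψ x, Submodule.mem_top⟩, rfl, rfl⟩)

theorem exists_of_mem_freeHamiltonian_domain {m : Fin n → ℝ} {ψ : State d n}
    (h : ψ ∈ (freeHamiltonian ħ m).domain) :
    ∃ (ψ' ψ'' : Fin n × Fin d → State d n) (e : State d n),
      (∀ α, (ψ, ψ' α) ∈ (momentum ħ α.1 α.2).graph) ∧
      (∀ α, (ψ' α, ψ'' α) ∈ (momentum ħ α.1 α.2).graph) ∧
      (ψ, e) ∈ (fieldHamiltonian ħ).graph := by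
  have h1 : ∀ α : Fin n × Fin d, ∃ y z, (ψ, y) ∈ (momentum ħ α.1 α.2).graph ∧
      (y, z) ∈ (momentum ħ α.1 α.2).graph := by
    intro α
    have h2 := mem_domain_of_mem_sum_domain h.1 α.1 (Finset.mem_univ _)
    have h3 := mem_domain_of_mem_sum_domain
      (T := fun ν => opComp (momentum ħ α.1 ν) (momentum ħ α.1 ν)) h2 α.2 (Finset.mem_univ _)
    exact exists_of_mem_opComp_domain h3
  choose ψ' ψ'' h1 h2 using h1
  exact ⟨ψ', ψ'', _, h1, h2, (fieldHamiltonian ħ).mem_graph ⟨ψ, h.2⟩⟩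

theorem mem_graph_sum_smul_sum {E : Type*} [AddCommGroup E] [Module ℂ E] (c : Fin n → ℝ)
    {T : Fin n → Fin d → E →ₗ.[ℂ] E} {x : E} {y : Fin n × Fin d → E}
    (h : ∀ α, (x, y α) ∈ (T α.1 α.2).graph) :
    (x, ∑ α, (c α.1 : ℂ) • y α) ∈ (∑ i, (c i : ℂ) • ∑ ν, T i ν).graph := by
  have e : ∑ α, (c α.1 : ℂ) • y α = ∑ i, (c i : ℂ) • ∑ ν, y (i, ν) := by
    rw [Fintype.sum_prod_type]
    simp only [Finset.smul_sum]
  rw [e]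
  exact mem_graph_sum _ fun i _ => mem_graph_const_smul _ (mem_graph_sum _ fun ν _ => h (i, ν))

/-- The kinetic energies on the domain of the free Hamiltonian. -/
theorem exists_kinetic_state (hd : 0 < d) (hħ : 0 < ħ) (hħ1 : ħ < 1)
    {ε : Fin (d - 1) → EuclideanSpace ℝ (Fin d) → EuclideanSpace ℝ (Fin d)}
    {χ : Fin n → EuclideanSpace ℝ (Fin d) → ℂ} {i : Fin n} {ν : Fin d}
    (hf : IsCoupling 3 (couplingZero ε (χ i) ν)) {K : ℝ} (hK : 0 ≤ K)
    (hfK : 4 * Real.pi * couplingNorm 3 (couplingZero ε (χ i) ν) ≤ K)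
    {ψ η ψ' ψ'' : State d n} (hη : stateR d n ħ (stateR d n ħ η) = ψ)
    (h1 : (ψ, ψ') ∈ (momentum ħ i ν).graph) (h2 : (ψ', ψ'') ∈ (momentum ħ i ν).graph) :
    ∃ θ ξ q : State d n,
      (ψ, q) ∈ (opComp (kineticMomentum ħ ε χ i ν) (kineticMomentum ħ ε χ i ν)).graph ∧
      0 ≤ RCLike.re (inner ℂ ψ q) ∧
      RCLike.re (inner ℂ ψ'' η) = ‖θ‖ ^ 2 ∧
      ‖ξ‖ ^ 2 - K * (2 + K) * ‖ξ‖ * ‖stateR d n ħ η‖ ≤ RCLike.re (inner ℂ q η) ∧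
      ‖ψ'' - q‖ ≤ K * (2 + K) * (‖θ‖ + ‖η‖) ∧
      ‖ψ'' - q‖ ≤ K * (2 + K) * (‖ξ‖ + ‖η‖) := by
  have hf1 : IsCoupling 1 (couplingZero ε (χ i) ν) := hf.mono (by norm_num)
  subst hη
  have h1' := mem_graph_momentum.1 h1
  obtain ⟨θ, ξ, π', hξ, hπ, h⟩ := RegularizedField.exists_kinetic hK
    (regularizedMomentum hħ (EuclideanSpace.single (i, ν) 1))
    (regularizedField hd hħ hħ1 hf i ν hfK) h1' (mem_graph_momentum.1 h2)
  have h3 := mem_graph_kineticMomentum hd hħ hħ1 hf1 h1'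
  rw [← hξ] at h3
  exact ⟨θ, ξ, _, mem_graph_opComp h3 (mem_graph_kineticMomentum hd hħ hħ1 hf1 hπ), h⟩

theorem add_add_add_one_smul {E : Type*} [AddCommGroup E] [Module ℂ E] (M : ℝ) (x v e ψ : E) :
    x + v + e + ((M + 1 : ℝ) : ℂ) • ψ = x + (ψ + e) + v + (M : ℂ) • ψ := by
  push_cast
  rw [add_smul, one_smul]
  abel

theorem neg_mul_sq_le_re_inner {H : Type*} [NormedAddCommGroup H] [InnerProductSpace ℂ H] {M : ℝ}
    {ψ v : H} (h : ‖v‖ ≤ M * ‖ψ‖) : -M * ‖ψ‖ ^ 2 ≤ RCLike.re (inner ℂ ψ v) := by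
  have h1 := (abs_le.1 ((RCLike.abs_re_le_norm _).trans (norm_inner_le_norm (𝕜 := ℂ) ψ v))).1
  nlinarith [mul_le_mul_of_nonneg_left h (norm_nonneg ψ)]

theorem re_inner_eq_norm_sq {H : Type*} [NormedAddCommGroup H] [InnerProductSpace ℂ H]
    {R : H →L[ℂ] H} (hR : ∀ u w, inner ℂ (R u) w = inner ℂ u (R w)) {ψ η : H}
    (h : R (R η) = ψ) : RCLike.re (inner ℂ ψ η) = ‖R η‖ ^ 2 := by
  rw [← h, hR]
  exact inner_self_eq_norm_sq _

theorem AssumptionA0.exists_bound {V : Config d n → ℝ} (h : AssumptionA0 V) :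
    ∃ M, 0 ≤ M ∧ ∀ x, |V x| ≤ M := by
  obtain ⟨M, hM⟩ := h.2
  have h1 : ∀ x, |V x| ≤ M := by
    intro x
    have := hM 0 zero_le_two x
    rwa [norm_iteratedFDeriv_zero, Real.norm_eq_abs] at this
  exact ⟨M, (abs_nonneg _).trans (h1 0), h1⟩

set_option maxHeartbeats 1600000 in
/-- The graph norms of the free and of the Pauli–Fierz Hamiltonian are equivalent. -/
theorem exists_pauliFierz_bounds (d n : ℕ) (hd : 3 ≤ d)
    (m : Fin n → ℝ) (hm : ∀ i, 0 < m i)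
    (ε : Fin (d - 1) → EuclideanSpace ℝ (Fin d) → EuclideanSpace ℝ (Fin d))
    (hε : IsPolarization ε)
    (V : Config d n → ℝ) (χ : Fin n → EuclideanSpace ℝ (Fin d) → ℂ)
    (hA0 : AssumptionA0 V)
    (hA1 : ∀ i, AssumptionA1 (χ i))
    (hA2 : ∀ i, AssumptionA2 1 (χ i)) :
    ∃ c C γ : ℝ, 0 < c ∧ 0 < C ∧ 0 < γ ∧
      ∀ ħ : ℝ, 0 < ħ → ħ < 1 →
        ∀ (ψ : State d n) (h₀ : ψ ∈ (freeHamiltonian ħ m).domain),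
          ∃ h : ψ ∈ (pauliFierz ħ m V ε χ).domain,
            c * ‖pauliFierz ħ m V ε χ ⟨ψ, h⟩ + (γ : ℂ) • ψ‖ ≤
                ‖freeHamiltonian ħ m ⟨ψ, h₀⟩ + ψ‖ ∧
              ‖freeHamiltonian ħ m ⟨ψ, h₀⟩ + ψ‖ ≤
                C * ‖pauliFierz ħ m V ε χ ⟨ψ, h⟩ + (γ : ℂ) • ψ‖ := by
  have hd0 : 0 < d := by omega
  obtain ⟨M, hM, hVM⟩ := hA0.exists_bound
  have hf : ∀ α : Fin n × Fin d, IsCoupling 3 (couplingZero ε (χ α.1) α.2) := fun α =>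
    isCoupling_couplingZero hd0 hε (hA1 α.1) (hA2 α.1) α.2
  have hnonneg : ∀ α : Fin n × Fin d,
      0 ≤ 4 * Real.pi * couplingNorm 3 (couplingZero ε (χ α.1) α.2) := fun α =>
    mul_nonneg (by positivity) (couplingNorm_nonneg _ _)
  -- One constant serving all particles and components; it involves only the form factors, not ħ.
  set K : ℝ := ∑ α : Fin n × Fin d, 4 * Real.pi * couplingNorm 3 (couplingZero ε (χ α.1) α.2)
  have hK : 0 ≤ K := Finset.sum_nonneg fun α _ => hnonneg α
  have hKα : ∀ α : Fin n × Fin d,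
      4 * Real.pi * couplingNorm 3 (couplingZero ε (χ α.1) α.2) ≤ K := fun α =>
    Finset.single_le_sum (f := fun α : Fin n × Fin d =>
      4 * Real.pi * couplingNorm 3 (couplingZero ε (χ α.1) α.2)) (fun α _ => hnonneg α)
      (Finset.mem_univ α)
  obtain ⟨a, C, ha, hC, hcomp⟩ := exists_comparison_constants (H := State d n)
    (fun α : Fin n × Fin d => 1 / (2 * m α.1)) (fun α => by have := hm α.1; positivity)
    (K * (2 + K)) M (by positivity) hM
  -- In γ = M + 1 the 1 completes H_f to 1 + H_f and M makes V + M nonnegative.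
  refine ⟨a, C, M + 1, ha, hC, by positivity, fun ħ hħ hħ1 ψ h₀ => ?_⟩
  obtain ⟨ψ', ψ'', e, h1, h2, he⟩ := exists_of_mem_freeHamiltonian_domain h₀
  obtain ⟨η, hη⟩ : ∃ η, η = ψ + e := ⟨_, rfl⟩
  have hRR : stateR d n ħ (stateR d n ħ η) = ψ := by rw [hη, stateR_stateR_of_mem hħ.le he]
  have hkin := fun α : Fin n × Fin d =>
    exists_kinetic_state hd0 hħ hħ1 (hf α) hK (hKα α) hRR (h1 α) (h2 α)
  choose θ ξ q hq hpos hθ hQη hPQ hPQ' using hkin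
  obtain ⟨v, hv, hvn⟩ := exists_potential hA0.1.continuous hVM ψ
  have hfree := mem_graph_add (mem_graph_sum_smul_sum (fun i => 1 / (2 * m i))
    (T := fun i ν => opComp (momentum ħ i ν) (momentum ħ i ν))
    fun α => mem_graph_opComp (h1 α) (h2 α)) he
  have hpf := mem_graph_add (mem_graph_add (mem_graph_sum_smul_sum (fun i => 1 / (2 * m i))
    (T := fun i ν => opComp (kineticMomentum ħ ε χ i ν) (kineticMomentum ħ ε χ i ν)) hq) hv)
    he
  have hdom : ψ ∈ (pauliFierz ħ m V ε χ).domain := LinearPMap.mem_domain_of_mem_graph hpf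
  refine ⟨hdom, ?_⟩
  have hfree' := (congrArg (fun x => x + ψ) (apply_eq_of_mem_graph hfree h₀)).trans
    ((add_assoc _ e ψ).trans (congrArg _ ((add_comm e ψ).trans hη.symm)))
  have hpf' := (congrArg (fun x => x + ((M + 1 : ℝ) : ℂ) • ψ)
    (apply_eq_of_mem_graph hpf hdom)).trans ((add_add_add_one_smul M _ v e ψ).trans
      (congrArg (fun x => _ + x + v + (M : ℂ) • ψ) hη.symm))
  have hnR : ∀ u, ‖stateR d n ħ u‖ ≤ ‖u‖ := fun u => by
    simpa using norm_stateEnergyOp_le hħ.le isBoundedEnergyFun_invSqrtFun u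
  -- The abstract comparison with φ = Rη, P the vectors p²ψ and Q the vectors (p - A)²ψ, indexed by
  -- pairs (particle, component).
  have key := hcomp ψ (stateR d n ħ η) η v ψ'' q θ ξ hvn (neg_mul_sq_le_re_inner hvn)
    ((congrArg norm hRR).symm.trans_le (hnR _)) (hnR η)
    (re_inner_eq_norm_sq (inner_stateEnergyOp_left hħ.le isBoundedEnergyFun_invSqrtFun) hRR)
    hpos hθ hQη hPQ hPQ'
  have e1 := congrArg norm hfree'
  have e2 := congrArg norm hpf'
  exact ⟨((congrArg (fun r => a * r) e2).trans_le key.1).trans_eq e1.symm,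
    (e1.trans_le key.2).trans_eq (congrArg (fun r => C * r) e2).symm⟩

end Hamiltonian

end PauliFierz

end

theorem lemma3p2 (d n : ℕ) (hd : 3 ≤ d)
    (m : Fin n → ℝ) (hm : ∀ i, 0 < m i)
    (ε : Fin (d - 1) → EuclideanSpace ℝ (Fin d) → EuclideanSpace ℝ (Fin d))
    (hε : IsPolarization ε)
    (V : Config d n → ℝ) (χ : Fin n → EuclideanSpace ℝ (Fin d) → ℂ)
    (hA0 : AssumptionA0 V)
    (hA1 : ∀ i, AssumptionA1 (χ i))
    (hA2 : ∀ i, AssumptionA2 1 (χ i)) :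
    ∃ c C γ : ℝ, 0 < c ∧ 0 < C ∧ 0 < γ ∧
      ∀ ħ : ℝ, 0 < ħ → ħ < 1 →
        ∀ (ψ : State d n) (h₀ : ψ ∈ (freeHamiltonian ħ m).domain),
          ∃ h : ψ ∈ (pauliFierz ħ m V ε χ).domain,
            c * ‖pauliFierz ħ m V ε χ ⟨ψ, h⟩ + (γ : ℂ) • ψ‖ ≤
                ‖freeHamiltonian ħ m ⟨ψ, h₀⟩ + ψ‖ ∧
              ‖freeHamiltonian ħ m ⟨ψ, h₀⟩ + ψ‖ ≤
                C * ‖pauliFierz ħ m V ε χ ⟨ψ, h⟩ + (γ : ℂ) • ψ‖ :=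
  exists_pauliFierz_bounds d n hd m hm ε hε V χ hA0 hA1 hA2
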